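/- Let $k\in\mathbb N$, $\delta\in(0,1)$, $\mu_0\in\mathbb R$, and let $\nu_1,\dots,\nu_k$ be $1$-sub-Gaussian distributions on $\mathbb R$ with means $\mu_1,\dots,\mu_k$, that is, $\int e^{\lambda(x-\mu_i)}\,d\nu_i(x)\le e^{\lambda^2/2}$ for all $\lambda\in\mathbb R$. Rewards $X_{i,t}\sim\nu_i$ are independent over all arms $i\in[k]$ and rounds $t\ge1$, and independent of a private random variable $U$ that is uniform on $[0,1]$. Put $\mathcal H_0=\{i:\mu_i\le\mu_0\}$ and $\mathcal H_1=\{i:\mu_i>\mu_0\}$. In round $t$ a set of arms $\mathcal K_t$ is sampled, and $\mathcal F_t$ is the $\sigma$-algebra generated by $U$, the sets $\mathcal K_s$ $(s\le t)$ and the rewards $X_{i,s}$ $(s\le t,\ i\in\mathcal K_s)$. Let $T_i(t)=|\{s\le t: i\in\mathcal K_s\}|$, and let $\widehat\mu_{i,t}$ be the mean of the $T_i(t)$ rewards sampled from arm $i$ by time $t$. *Evidence.* For $\ell\ge0$ let $\lambda_\ell=e^{-(\ell+5/2)}$ and $w_\ell=\frac{2(e-1)}{e(\ell+2)^2}$,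 and let $$E_{i,t}=\sum_{\ell=0}^\infty w_\ell\exp\Big(\sum_{s\le t,\ i\in\mathcal K_s}\big(\lambda_\ell(X_{i,s}-\mu_0)-\lambda_\ell^2/2\big)\Big).$$ The rejection set $\mathcal R_t$ is the e-BH set at level $\delta$, i.e. the largest $\mathcal R\subseteq[k]$ with $E_{i,t}\ge \frac{k}{\delta|\mathcal R|}$ for all $i\in\mathcal R$ (so $\mathcal R_0=\emptyset$). *Exploration.* Let $\varphi$ be one of $$\varphi^0(t,\delta)=\sqrt{\tfrac{4\log(\log_2(2t)/\delta)}{t}},\qquad \varphi^{\mathrm{IS}}(t,\delta)=\sqrt{\tfrac{2.89\log\log(2.041t)+2.065\log(4.983/\delta)}{t}},$$ or, if $\delta\le0.1$, $\varphi^{\mathrm{JJ}}(t,\delta)=\sqrt{\tfrac{2\log(1/\delta)+6\log\log(1/\delta)+3\log\log(et/2)}{t}}$. In round $t$, $\mathcal K_t=\{I_t\}$, where $\mathcal K_t$ is $\mathcal F_{t-1}$-measurable and $$I_t\in\operatorname*{argmax}_{i\in[k]\setminus\mathcal R_{t-1}}\ \widehat\mu_{i,t-1}+\varphi(T_i(t-1),\delta),$$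 with ties broken arbitrarily and with the index of an arm that has not been sampled equal to $+\infty$; if $\mathcal R_{t-1}=[k]$, then $\mathcal K_t=\emptyset$. For a random time $\tau$ let $\mathrm{FDR}(\mathcal R_\tau)=\mathbb E\big[\frac{|\mathcal H_0\cap\mathcal R_\tau|}{|\mathcal R_\tau|\vee1}\big]$ and $\mathrm{TPR}(\mathcal R_\tau)=\mathbb E\big[\frac{|\mathcal H_1\cap\mathcal R_\tau|}{|\mathcal H_1|}\big]$. If $\mathcal H_1\neq\emptyset$, let $\Delta=\min_{i\in\mathcal H_1}(\mu_i-\mu_0)$, let $\Delta_i=\mu_i-\mu_0$ for $i\in\mathcal H_1$ and $\Delta_i=\min_{j\in\mathcal H_1}\mu_j-\mu_i$ for $i\in\mathcal H_0$. Write $H_i=\max(\Delta_i^{-2},e^e)$ and $H=\max(\Delta^{-2},e^e)$; thus $H_i=\Delta_i^{-2}$ and $H=\Delta^{-2}$ as soon as $\log\log\Delta_i^{-2}\ge1$, respectively $\log\log\Delta^{-2}\ge1$. **Theorem.** There is a universal constant $c>0$ such that in every such setting: 1. $\mathrm{FDR}(\mathcal R_\tau)\le\delta$ for every $\mathbb N$-valued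 stopping time $\tau$ of $(\mathcal F_t)$, so that $\sup_\tau\mathrm{FDR}(\mathcal R_\tau)\le\delta$. 2. If $\mathcal H_1\ne\emptyset$, there is a (deterministic) time $$T\ \le\ c\left[\Big(\sum_{i=1}^k H_i\log\log H_i+H_i\log(k/\delta)\Big)\wedge kH\log\big(\log(H)/\delta\big)\right]$$ such that $\mathrm{TPR}(\mathcal R_t)\ge1-\delta$ for all $t\ge T$; moreover $\mathrm{TPR}(\mathcal R_\tau)\ge1-\delta$ for every random time $\tau\ge T$. -/

import Mathlib

open MeasureTheory ProbabilityTheory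

noncomputable section

namespace BanditTesting

/-! ### e-BH -/

/-- A set `R` of arms is e-self-consistent at level `α` for the e-values `e` if
`e i ≥ k / (α |R|)` for every `i ∈ R`. -/
def ESelfConsistent {k : ℕ} (α : ℝ) (e : Fin k → ℝ) (R : Finset (Fin k)) : Prop :=
  ∀ i ∈ R, (k : ℝ) / (α * (R.card : ℝ)) ≤ e i

open Classical in
/-- The e-BH rejection set at level `α`: the union of all e-self-consistent sets. It is itself
e-self-consistent (`eBH_selfConsistent`), hence the largest such set. -/
def eBH {k : ℕ} (α : ℝ) (e : Fin k → ℝ) : Finset (Fin k) :=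
  (Finset.univ.filter fun R : Finset (Fin k) => ESelfConsistent α e R).sup id

theorem subset_eBH {k : ℕ} (α : ℝ) (e : Fin k → ℝ) (R : Finset (Fin k))
    (hR : ESelfConsistent α e R) : R ⊆ eBH α e := by
  classical
  intro i hi
  simp only [eBH, Finset.mem_sup, Finset.mem_filter, Finset.mem_univ, true_and, id]
  exact ⟨R, hR, hi⟩

theorem eBH_selfConsistent {k : ℕ} (α : ℝ) (hα : 0 < α) (e : Fin k → ℝ) :
    ESelfConsistent α e (eBH α e) := by
  classical
  intro i hi
  have hi2 := hi
  simp only [eBH, Finset.mem_sup, Finset.mem_filter, Finset.mem_univ, true_and, id] at hi2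
  obtain ⟨R, hR, hiR⟩ := hi2
  refine le_trans ?_ (hR i hiR)
  have hcard : R.card ≤ (eBH α e).card := Finset.card_le_card (subset_eBH α e R hR)
  have hpos : 0 < R.card := Finset.card_pos.mpr ⟨i, hiR⟩
  have h1 : (0 : ℝ) < R.card := by exact_mod_cast hpos
  have h2 : (R.card : ℝ) ≤ (eBH α e).card := by exact_mod_cast hcard
  gcongr

/-! ### Path-wise statistics

Rounds are indexed by `0, 1, 2, …`: `A s` is the set of arms sampled in round `s + 1`, `x i s` is
the reward that arm `i` yields in round `s + 1` (observed only if `i ∈ A s`), and time `t`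
means after the first `t` rounds, that is, rounds `s < t`. -/

/-- `T_i(t)`: the number of samples taken from arm `i` by time `t`. -/
def numSamples {k : ℕ} (A : ℕ → Finset (Fin k)) (i : Fin k) (t : ℕ) : ℕ :=
  ((Finset.range t).filter fun s => i ∈ A s).card

/-- The sample mean of arm `i` at time `t` (only meaningful when `T_i(t) > 0`). -/
def sampleMean {k : ℕ} (A : ℕ → Finset (Fin k)) (x : Fin k → ℕ → ℝ) (i : Fin k) (t : ℕ) : ℝ :=
  (∑ s ∈ (Finset.range t).filter (fun s => i ∈ A s), x i s) / (numSamples A i t : ℝ)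

/-- The mixture grid `λ_ℓ = e^{-(ℓ + 5/2)}`. -/
def dmLam (l : ℕ) : ℝ := 1 / Real.exp ((l : ℝ) + 5 / 2)

/-- The mixture weights `w_ℓ = 2 (e - 1) / (e (ℓ + 2)^2)`. -/
def dmWeight (l : ℕ) : ℝ := 2 * (Real.exp 1 - 1) / (Real.exp 1 * ((l : ℝ) + 2) ^ 2)

/-- The discrete-mixture e-process of arm `i` at time `t`. The series always converges, as the
weights are summable and `λ_ℓ → 0`. -/
def dmE {k : ℕ} (μ₀ : ℝ) (A : ℕ → Finset (Fin k)) (x : Fin k → ℕ → ℝ) (i : Fin k) (t : ℕ) : ℝ :=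
  ∑' l : ℕ, dmWeight l *
    Real.exp (∑ s ∈ (Finset.range t).filter (fun s => i ∈ A s),
      (dmLam l * (x i s - μ₀) - dmLam l ^ 2 / 2))

/-- The rejection set at time `t`: e-BH at level `δ` applied to the discrete-mixture e-values.
At `t = 0` it is empty, because then every e-value is `∑ w_ℓ < 1`. -/
def rejSet {k : ℕ} (δ μ₀ : ℝ) (A : ℕ → Finset (Fin k)) (x : Fin k → ℕ → ℝ) (t : ℕ) :
    Finset (Fin k) :=
  eBH δ fun i => dmE μ₀ A x i t

/-! ### UCB exploration -/

/-- `φ⁰(t, δ) = √(4 log (log₂(2t) / δ) / t)`. -/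
def phiZero (t : ℕ) (δ : ℝ) : ℝ :=
  Real.sqrt (4 * Real.log (Real.logb 2 (2 * (t : ℝ)) / δ) / (t : ℝ))

/-- `φ^JJ(t, δ) = √((2 log(1/δ) + 6 log log(1/δ) + 3 log log(et/2)) / t)`. -/
def phiJJ (t : ℕ) (δ : ℝ) : ℝ :=
  Real.sqrt ((2 * Real.log (1 / δ) + 6 * Real.log (Real.log (1 / δ))
    + 3 * Real.log (Real.log (Real.exp 1 * (t : ℝ) / 2))) / (t : ℝ))

/-- `φ^IS(t, δ) = √((2.89 log log(2.041 t) + 2.065 log(4.983/δ)) / t)`. -/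
def phiIS (t : ℕ) (δ : ℝ) : ℝ :=
  Real.sqrt ((2.89 * Real.log (Real.log (2.041 * (t : ℝ)))
    + 2.065 * Real.log (4.983 / δ)) / (t : ℝ))

/-- The admissible confidence boundaries: `φ⁰` and `φ^IS` for every `δ ∈ (0, 1)`, and `φ^JJ` for
`δ ∈ (0, 0.1]`. -/
def IsBoundary (φ : ℕ → ℝ → ℝ) (δ : ℝ) : Prop :=
  φ = phiZero ∨ φ = phiIS ∨ (φ = phiJJ ∧ δ ≤ 0.1)

/-- The upper confidence bound of arm `i` at time `t`; it is `+∞` for an arm without samples. -/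
def ucbIndex {k : ℕ} (φ : ℕ → ℝ → ℝ) (δ : ℝ) (A : ℕ → Finset (Fin k)) (x : Fin k → ℕ → ℝ)
    (i : Fin k) (t : ℕ) : EReal :=
  if numSamples A i t = 0 then ⊤
  else ((sampleMean A x i t + φ (numSamples A i t) δ : ℝ) : EReal)

/-- In every round exactly one arm is sampled, and it maximizes the upper confidence bound among
the arms that are not rejected at present (ties are broken in any way). Once every arm is rejected
there is nothing left to sample. -/
def IsUCB {k : ℕ} (φ : ℕ → ℝ → ℝ) (δ μ₀ : ℝ) (A : ℕ → Finset (Fin k)) (x : Fin k → ℕ → ℝ) :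
    Prop :=
  ∀ t : ℕ,
    (rejSet δ μ₀ A x t = Finset.univ → A t = ∅) ∧
    (rejSet δ μ₀ A x t ≠ Finset.univ →
      ∃ i, i ∉ rejSet δ μ₀ A x t ∧ A t = {i} ∧
        ∀ j, j ∉ rejSet δ μ₀ A x t → ucbIndex φ δ A x j t ≤ ucbIndex φ δ A x i t)

/-! ### The canonical filtration -/

/-- The information after `t` rounds: the private randomness `U`, the sets of arms sampled in the
first `t` rounds, and the rewards of the sampled arms. -/
def banditFiltration {Ω : Type*} [m : MeasurableSpace Ω] {k : ℕ} (U : Ω → ℝ)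
    (A : ℕ → Ω → Finset (Fin k)) (X : Fin k → ℕ → Ω → ℝ)
    (hU : Measurable U) (hA : ∀ s, Measurable (A s)) (hX : ∀ i s, Measurable (X i s)) :
    Filtration ℕ m where
  seq t := MeasurableSpace.comap U inferInstance ⊔
    ⨆ s, ⨆ (_ : s < t), (MeasurableSpace.comap (A s) inferInstance ⊔
      ⨆ i, MeasurableSpace.comap (fun ω => if i ∈ A s ω then X i s ω else 0) inferInstance)
  mono' t t' htt := by
    refine sup_le_sup le_rfl ?_
    exact biSup_mono fun s hs => lt_of_lt_of_le hs htt
  le' t := by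
    refine sup_le hU.comap_le (iSup₂_le fun s _ => sup_le (hA s).comap_le (iSup_le fun i => ?_))
    refine Measurable.comap_le (Measurable.ite ?_ (hX i s) measurable_const)
    exact (hA s) (measurableSet_mem_finset i)

/-! ### Error metrics and gaps -/

/-- The mean of a distribution on the real line. -/
def mean (ν : Measure ℝ) : ℝ := ∫ y, y ∂ν

/-- The null arms: those with mean at most `μ₀`. -/
def nulls {k : ℕ} (μ₀ : ℝ) (ν : Fin k → Measure ℝ) : Finset (Fin k) :=
  Finset.univ.filter fun i => mean (ν i) ≤ μ₀

/-- The non-null arms: those with mean larger than `μ₀`. -/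
def nonNulls {k : ℕ} (μ₀ : ℝ) (ν : Fin k → Measure ℝ) : Finset (Fin k) :=
  Finset.univ.filter fun i => μ₀ < mean (ν i)

/-- The false discovery rate of a random rejection set. -/
def FDR {Ω : Type*} [MeasurableSpace Ω] (P : Measure Ω) {k : ℕ} (H₀ : Finset (Fin k))
    (R : Ω → Finset (Fin k)) : ℝ :=
  ∫ ω, ((H₀ ∩ R ω).card : ℝ) / (max (R ω).card 1 : ℕ) ∂P

/-- The true positive rate of a random rejection set. -/
def TPR {Ω : Type*} [MeasurableSpace Ω] (P : Measure Ω) {k : ℕ} (H₁ : Finset (Fin k))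
    (R : Ω → Finset (Fin k)) : ℝ :=
  ∫ ω, ((H₁ ∩ R ω).card : ℝ) / (H₁.card : ℝ) ∂P

/-- `Δ = min_{i ∈ H₁} (μ_i - μ₀)`. -/
def minGap {k : ℕ} (μ₀ : ℝ) (ν : Fin k → Measure ℝ) (h : (nonNulls μ₀ ν).Nonempty) : ℝ :=
  (nonNulls μ₀ ν).inf' h fun i => mean (ν i) - μ₀

/-- `Δ_i = μ_i - μ₀` for a non-null arm, and `Δ_i = min_{j ∈ H₁} μ_j - μ_i` for a null arm. -/
def gap {k : ℕ} (μ₀ : ℝ) (ν : Fin k → Measure ℝ) (h : (nonNulls μ₀ ν).Nonempty) (i : Fin k) : ℝ :=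
  if μ₀ < mean (ν i) then mean (ν i) - μ₀
  else (nonNulls μ₀ ν).inf' h (fun j => mean (ν j)) - mean (ν i)

/-- `Δ⁻²`, except that values below `e^e` are replaced by `e^e`, so that
`log log` of it is at least `1`. -/
def invSq (d : ℝ) : ℝ := max ((d ^ 2)⁻¹) (Real.exp (Real.exp 1))

/-- `∑_i (Δ_i⁻² log log Δ_i⁻² + Δ_i⁻² log (k/δ))`. -/
def boundSum {k : ℕ} (δ μ₀ : ℝ) (ν : Fin k → Measure ℝ) (h : (nonNulls μ₀ ν).Nonempty) : ℝ :=
  ∑ i : Fin k, (invSq (gap μ₀ ν h i) * Real.log (Real.log (invSq (gap μ₀ ν h i)))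
    + invSq (gap μ₀ ν h i) * Real.log ((k : ℝ) / δ))

/-- `k Δ⁻² log (log (Δ⁻²) / δ)`. -/
def boundMin {k : ℕ} (δ μ₀ : ℝ) (ν : Fin k → Measure ℝ) (h : (nonNulls μ₀ ν).Nonempty) : ℝ :=
  (k : ℝ) * invSq (minGap μ₀ ν h) * Real.log (Real.log (invSq (minGap μ₀ ν h)) / δ)

end BanditTesting

end

/-!
False discovery rate. The mixture `dmE` of a null arm is a nonnegative supermartingale started at
most at `1`, for the filtration of all past rewards, which contains the observed data
(`banditFiltration_le_table`). By optional stopping its expectation at a stopping time is at most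
`1` (`lintegral_dmE_stopped_le`), and the self-consistency of e-BH bounds the false discovery
proportion by `δ / k` times the sum of the evidence of the nulls (`fdp_le_sum`).

True positive rate. It suffices to show for every non-null arm `i` that it is rejected at a
deterministic time `T` with probability at least `1 - δ`, since along a UCB path the rejection set
only grows (`rejSet_mono`). Rejection follows on an event that has two parts.

* The upper confidence bound of `i` never falls below its mean. For each of the three boundaries
  there is a countable mixture of exponential supermartingales, started at `1`, that is at least
  `κ = 1 + 1.02 (1 / δ - 1)` whenever the boundary is crossed (`exists_certificate`). So the bound
  fails with probability at most `1 / κ`, which is less than `δ`.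
* The other arms do not deviate much from their means in total. For an arm `j` the deviation is
  measured by the running maximum of one exponential supermartingale with rate `1 / (2 √H_j)`.
  Half of the square root of that maximum is dominated by a supermartingale, a tangent to the
  square root at the running maximum (`isESuper_sqrtTangent`), and these can be summed over `j`. So
  the sum of the square roots is less than `102 k / δ` with probability at least `1 - δ / 51`. This
  bounds the deviation of each arm by `2 log (102 k / δ)`, but, by concavity of the logarithm, the
  sum over all arms only by `2 k log (102 / δ)`; the latter is what makes the second bound free
  of `log k`.

As only one arm is sampled in a round, the two supermartingales never move together, and
`IsESuper.prob_lt_one_and_lt_one` gives that both parts hold with probability at least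
`(1 - 1 / κ) (1 - δ / 51) = 1 - δ`. No independence of the two parts is needed.

On this event (`IsGoodPath`), suppose that `i` is not rejected at time `T`. Then `T` is the total
number of samples. A null arm is sampled only while its index is at least that of `i`,
hence at most of the order `H_j (log log H_j + log (1 / δ)) + H_j z_j` times, where `z_j` is its
deviation. A non-null arm `j` is sampled only while it is not rejected, and past that
many samples its evidence grows exponentially. The first bound follows, because the evidence `k / δ`
always suffices for rejection (`IsGoodPath.le_boundSum`). For the second bound, self-consistency is
used in full: a set of arms that all have evidence `e ^ u / δ` is rejected if it has at least
`k e ^ (-u)` elements. So at most that many arms are sampled until their evidence is so large, and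
the excess `u`, summed over the arms, is of the order `k` without a further logarithm
(`IsGoodPath.card_le`, `IsGoodPath.le_boundMin`).
-/

namespace BanditTesting

open scoped ENNReal

/-! ### The filtration of all past rewards -/

/-- The σ-algebra of the private randomness and of the rewards of *all* arms, sampled or not, in
the first `t` rounds. It contains the σ-algebra `banditFiltration` of the observed data. -/
def tableFiltration {Ω : Type*} [m : MeasurableSpace Ω] {k : ℕ} (U : Ω → ℝ)
    (X : Fin k → ℕ → Ω → ℝ) (hU : Measurable U) (hX : ∀ i s, Measurable (X i s)) :
    Filtration ℕ m where
  seq t := MeasurableSpace.comap U inferInstance ⊔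
    ⨆ s, ⨆ (_ : s < t), ⨆ i, MeasurableSpace.comap (X i s) inferInstance
  mono' t t' htt := by
    refine sup_le_sup le_rfl ?_
    exact biSup_mono fun s hs => lt_of_lt_of_le hs htt
  le' t := by
    refine sup_le hU.comap_le (iSup₂_le fun s _ => iSup_le fun i => (hX i s).comap_le)

/-- The assumptions on the rewards and on the sampling rule, apart from the UCB rule itself. -/
structure IsBanditModel {Ω : Type*} [MeasurableSpace Ω] (P : Measure Ω) {k : ℕ}
    (ν : Fin k → Measure ℝ) (U : Ω → ℝ) (X : Fin k → ℕ → Ω → ℝ) (A : ℕ → Ω → Finset (Fin k))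
    (hU : Measurable U) (hX : ∀ i s, Measurable (X i s)) (hA : ∀ s, Measurable (A s)) :
    Prop where
  law : ∀ i s, P.map (X i s) = ν i
  indep : iIndepFun (fun p : Fin k × ℕ => X p.1 p.2) P
  indepU : IndepFun U (fun ω (p : Fin k × ℕ) => X p.1 p.2 ω) P
  predictable : ∀ t, Measurable[banditFiltration U A X hU hA hX t] (A t)

section Filtration

variable {Ω : Type*} [m : MeasurableSpace Ω] {P : Measure Ω} {k : ℕ}
  {ν : Fin k → Measure ℝ} {U : Ω → ℝ} {X : Fin k → ℕ → Ω → ℝ} {A : ℕ → Ω → Finset (Fin k)}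
  {hU : Measurable U} {hX : ∀ i s, Measurable (X i s)} {hA : ∀ s, Measurable (A s)}

theorem measurable_table (i : Fin k) {s t : ℕ} (h : s < t) :
    Measurable[tableFiltration U X hU hX t] (X i s) := by
  apply Measurable.of_comap_le
  refine le_trans ?_ le_sup_right
  refine le_trans ?_ (le_iSup₂ (f := fun s (_ : s < t) =>
    ⨆ i, MeasurableSpace.comap (X i s) inferInstance) s h)
  exact le_iSup (fun i => MeasurableSpace.comap (X i s) inferInstance) i

/-- The observed data are determined by the rewards of the past rounds: by induction, the sampled
sets are, because each is chosen from the data observed before. -/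
theorem banditFiltration_le_table (h : IsBanditModel P ν U X A hU hX hA) (t : ℕ) :
    banditFiltration U A X hU hA hX t ≤ tableFiltration U X hU hX t := by
  induction t using Nat.strong_induction_on with
  | _ t ih =>
    refine sup_le le_sup_left (iSup₂_le fun s hs => ?_)
    have hAs : Measurable[tableFiltration U X hU hX t] (A s) :=
      (h.predictable s).mono ((ih s hs).trans ((tableFiltration U X hU hX).mono hs.le)) le_rfl
    refine sup_le hAs.comap_le (iSup_le fun i => Measurable.comap_le ?_)
    exact Measurable.ite (hAs (measurableSet_mem_finset i)) (measurable_table i hs)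
      measurable_const

theorem measurable_sampled_table (h : IsBanditModel P ν U X A hU hX hA) {s t : ℕ} (hst : s ≤ t) :
    Measurable[tableFiltration U X hU hX t] (A s) :=
  (h.predictable s).mono
    ((banditFiltration_le_table h s).trans ((tableFiltration U X hU hX).mono hst)) le_rfl

/-- The σ-algebras of the independent sources of randomness: the private randomness (index
`none`) and the single rewards. -/
abbrev sourceSigma (U : Ω → ℝ) (X : Fin k → ℕ → Ω → ℝ) :
    Option (Fin k × ℕ) → MeasurableSpace Ω
  | none => MeasurableSpace.comap U inferInstance
  | some p => MeasurableSpace.comap (X p.1 p.2) inferInstance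

theorem iIndep_option (h : IsBanditModel P ν U X A hU hX hA) :
    iIndep (sourceSigma U X) P := by
  classical
  rw [iIndep_iff]
  intro S f hf
  have h1 := (iIndep_iff _ _).1 ((iIndepFun_iff_iIndep _ _ _).1 h.indep) (S.eraseNone)
    (f := fun p => f (some p)) (fun p hp => hf (some p) (by simpa using hp))
  have hB : MeasurableSet[MeasurableSpace.comap (fun ω (p : Fin k × ℕ) => X p.1 p.2 ω)
      inferInstance] (⋂ p ∈ S.eraseNone, f (some p)) := by
    refine Finset.measurableSet_biInter _ fun p hp => ?_
    obtain ⟨b, hb, hb2⟩ := hf (some p) (by simpa using hp)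
    refine ⟨(fun g => g p) ⁻¹' b, measurable_pi_apply p hb, ?_⟩
    rw [← hb2]; rfl
  by_cases hn : none ∈ S
  · have h2 := (Indep_iff _ _ _).1 h.indepU (f none) (⋂ p ∈ S.eraseNone, f (some p))
      (hf none hn) hB
    have hS : S = insert none (S.eraseNone.map Function.Embedding.some) := by
      rw [Finset.map_some_eraseNone, Finset.insert_erase hn]
    have e1 : (⋂ o ∈ S, f o) = f none ∩ ⋂ p ∈ S.eraseNone, f (some p) := by
      conv_lhs => rw [hS]
      rw [Finset.set_biInter_insert]
      congr 1
      ext ω; simp [Option.forall]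
    have e2 : ∏ o ∈ S, P (f o) = P (f none) * ∏ p ∈ S.eraseNone, P (f (some p)) := by
      conv_lhs => rw [hS]
      rw [Finset.prod_insert (by simp), Finset.prod_map]
      rfl
    rw [e1, e2, h2, h1]
  · have hS : S = S.eraseNone.map Function.Embedding.some := by
      rw [Finset.map_some_eraseNone, Finset.erase_eq_of_notMem hn]
    have e1 : (⋂ o ∈ S, f o) = ⋂ p ∈ S.eraseNone, f (some p) := by
      conv_lhs => rw [hS]
      ext ω; simp [Option.forall]
    have e2 : ∏ o ∈ S, P (f o) = ∏ p ∈ S.eraseNone, P (f (some p)) := by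
      conv_lhs => rw [hS]
      rw [Finset.prod_map]
      rfl
    rw [e1, e2, h1]

/-- The rewards of a round are independent of everything that happened before it. -/
theorem indep_table (h : IsBanditModel P ν U X A hU hX hA) (i : Fin k) (t : ℕ) :
    Indep (tableFiltration U X hU hX t) (MeasurableSpace.comap (X i t) inferInstance) P := by
  have hle : ∀ o, sourceSigma U X o ≤ m := by
    rintro (_ | p)
    · exact hU.comap_le
    · exact (hX _ _).comap_le
  have := indep_iSup_of_disjoint hle (iIndep_option h)
    (S := {o | ∀ p ∈ o, p.2 < t}) (T := {some (i, t)}) (by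
      rw [Set.disjoint_singleton_right]
      intro hh
      exact lt_irrefl _ (hh (i, t) rfl))
  refine indep_of_indep_of_le_left (indep_of_indep_of_le_right this ?_) ?_
  · exact le_iSup₂ (f := fun o (_ : o ∈ ({some (i, t)} : Set (Option (Fin k × ℕ)))) =>
      sourceSigma U X o) (some (i, t)) rfl
  · have key : ∀ o : Option (Fin k × ℕ), (∀ p ∈ o, p.2 < t) → sourceSigma U X o ≤
        ⨆ o ∈ {o : Option (Fin k × ℕ) | ∀ p ∈ o, p.2 < t}, sourceSigma U X o :=
      fun o ho => le_iSup₂ (f := fun o (_ : o ∈ {o : Option (Fin k × ℕ) | ∀ p ∈ o, p.2 < t}) =>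
        sourceSigma U X o) o ho
    refine sup_le (key none (by simp)) (iSup₂_le fun s hs => iSup_le fun j => ?_)
    exact key (some (j, s)) (by simp [hs])

theorem lintegral_mul_reward_le (h : IsBanditModel P ν U X A hU hX hA) (i : Fin k) (t : ℕ)
    {f : Ω → ℝ≥0∞} (hf : Measurable[tableFiltration U X hU hX t] f) {g : ℝ → ℝ≥0∞}
    (hg : Measurable g) (hg1 : ∫⁻ y, g y ∂(ν i) ≤ 1) :
    ∫⁻ ω, f ω * g (X i t ω) ∂P ≤ ∫⁻ ω, f ω ∂P := by
  rw [lintegral_mul_eq_lintegral_mul_lintegral_of_independent_measurableSpace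
    ((tableFiltration U X hU hX).le t) (hX i t).comap_le (indep_table h i t) hf
    (g := fun ω => g (X i t ω)) (hg.comp (Measurable.of_comap_le le_rfl))]
  have : ∫⁻ ω, g (X i t ω) ∂P ≤ 1 := by
    rw [← lintegral_map hg (hX i t), h.law]; exact hg1
  calc _ ≤ (∫⁻ ω, f ω ∂P) * 1 := by gcongr
    _ = _ := mul_one _

end Filtration

/-! ### Nonnegative supermartingales -/

/-- `M` is a nonnegative supermartingale for `𝒢`, possibly with infinite values: it is adapted, and
`E[f M_{t+1}] ≤ E[f M_t]` for every nonnegative `𝒢_t`-measurable `f`. -/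
structure IsESuper {Ω : Type*} [m : MeasurableSpace Ω] (P : Measure Ω) (𝒢 : Filtration ℕ m)
    (M : ℕ → Ω → ℝ≥0∞) : Prop where
  adapted : ∀ t, Measurable[𝒢 t] (M t)
  step : ∀ t (f : Ω → ℝ≥0∞), Measurable[𝒢 t] f →
    ∫⁻ ω, f ω * M (t + 1) ω ∂P ≤ ∫⁻ ω, f ω * M t ω ∂P

theorem measurable_ennreal_tsum {Ω : Type*} {_ : MeasurableSpace Ω} {f : ℕ → Ω → ℝ≥0∞}
    (hf : ∀ l, Measurable (f l)) : Measurable fun ω => ∑' l, f l ω :=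
  Measurable.tsum hf

namespace IsESuper

variable {Ω : Type*} [m : MeasurableSpace Ω] {P : Measure Ω} {𝒢 : Filtration ℕ m}
  {M N : ℕ → Ω → ℝ≥0∞}

theorem measurable (h : IsESuper P 𝒢 M) (t : ℕ) : Measurable (M t) :=
  (h.adapted t).mono (𝒢.le t) le_rfl

theorem const_mul (h : IsESuper P 𝒢 M) (c : ℝ≥0∞) :
    IsESuper P 𝒢 (fun t ω => c * M t ω) where
  adapted t := Measurable.const_mul (h.adapted t) c
  step t f hf := by
    have := h.step t (fun ω => f ω * c) (Measurable.mul_const hf c)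
    simpa only [mul_assoc] using this

theorem sum {ι : Type*} (s : Finset ι) {M : ι → ℕ → Ω → ℝ≥0∞}
    (h : ∀ i ∈ s, IsESuper P 𝒢 (M i)) : IsESuper P 𝒢 (fun t ω => ∑ i ∈ s, M i t ω) where
  adapted t := Finset.measurable_sum s fun i hi => (h i hi).adapted t
  step t f hf := by
    have hf' := hf.mono (𝒢.le t) le_rfl
    simp only [Finset.mul_sum]
    rw [lintegral_finsetSum _ fun i hi => hf'.fun_mul ((h i hi).measurable _),
      lintegral_finsetSum _ fun i hi => hf'.fun_mul ((h i hi).measurable _)]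
    exact Finset.sum_le_sum fun i hi => (h i hi).step t f hf

theorem tsum {M : ℕ → ℕ → Ω → ℝ≥0∞} (h : ∀ l, IsESuper P 𝒢 (M l)) :
    IsESuper P 𝒢 (fun t ω => ∑' l, M l t ω) where
  adapted t := measurable_ennreal_tsum fun l => (h l).adapted t
  step t f hf := by
    have hf' := hf.mono (𝒢.le t) le_rfl
    simp only [← ENNReal.tsum_mul_left]
    rw [lintegral_tsum fun l => (hf'.fun_mul ((h l).measurable _)).aemeasurable,
      lintegral_tsum fun l => (hf'.fun_mul ((h l).measurable _)).aemeasurable]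
    exact ENNReal.tsum_le_tsum fun l => (h l).step t f hf

theorem lintegral_stopped_min_le (h : IsESuper P 𝒢 M) {τ : Ω → ℕ}
    (hτ : ∀ n, MeasurableSet[𝒢 n] {ω | τ ω ≤ n}) (n : ℕ) :
    ∫⁻ ω, M (min (τ ω) n) ω ∂P ≤ ∫⁻ ω, M 0 ω ∂P := by
  induction n with
  | zero => simp
  | succ n ih =>
    refine le_trans ?_ ih
    set S := {ω | τ ω ≤ n} with hS
    have hSm : MeasurableSet S := 𝒢.le n _ (hτ n)
    rw [← lintegral_add_compl _ hSm, ← lintegral_add_compl (fun ω => M (min (τ ω) n) ω) hSm]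
    refine add_le_add (le_of_eq ?_) ?_
    · refine setLIntegral_congr_fun hSm fun ω hω => ?_
      have hω : τ ω ≤ n := hω
      simp only [min_eq_left hω, min_eq_left (hω.trans n.le_succ)]
    · have e1 : ∫⁻ ω in Sᶜ, M (min (τ ω) (n + 1)) ω ∂P = ∫⁻ ω in Sᶜ, M (n + 1) ω ∂P := by
        refine setLIntegral_congr_fun hSm.compl fun ω hω => ?_
        have hω : n < τ ω := not_le.1 hω
        simp only [min_eq_right (Nat.succ_le_of_lt hω)]
      have e2 : ∫⁻ ω in Sᶜ, M (min (τ ω) n) ω ∂P = ∫⁻ ω in Sᶜ, M n ω ∂P := by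
        refine setLIntegral_congr_fun hSm.compl fun ω hω => ?_
        have hω : n < τ ω := not_le.1 hω
        simp only [min_eq_right hω.le]
      rw [e1, e2, ← lintegral_indicator hSm.compl, ← lintegral_indicator hSm.compl]
      have := h.step n (Sᶜ.indicator fun _ => 1)
        (Measurable.indicator measurable_const (hτ n).compl)
      simpa only [Set.indicator_apply, ite_mul, one_mul, zero_mul] using this

/-- Optional stopping: by Fatou's lemma the stopping time need not be bounded. -/
theorem lintegral_stopped_le (h : IsESuper P 𝒢 M) {τ : Ω → ℕ}
    (hτ : ∀ n, MeasurableSet[𝒢 n] {ω | τ ω ≤ n}) :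
    ∫⁻ ω, M (τ ω) ω ∂P ≤ ∫⁻ ω, M 0 ω ∂P := by
  have hmτ : Measurable τ := measurable_of_Iic fun n => 𝒢.le n _ (hτ n)
  have hm : ∀ n, Measurable fun ω => M (min (τ ω) n) ω := fun n =>
    (measurable_from_prod_countable_right (f := fun p : ℕ × Ω => M p.1 p.2) h.measurable).comp
      ((hmτ.min measurable_const).prodMk measurable_id)
  calc ∫⁻ ω, M (τ ω) ω ∂P
      ≤ ∫⁻ ω, Filter.liminf (fun n => M (min (τ ω) n) ω) Filter.atTop ∂P := by
        refine lintegral_mono fun ω => ?_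
        have : Filter.Tendsto (fun n => M (min (τ ω) n) ω) Filter.atTop (nhds (M (τ ω) ω)) := by
          refine tendsto_const_nhds.congr' ?_
          filter_upwards [Filter.eventually_ge_atTop (τ ω)] with n hn
          rw [min_eq_left hn]
        exact this.liminf_eq.ge
    _ ≤ Filter.liminf (fun n => ∫⁻ ω, M (min (τ ω) n) ω ∂P) Filter.atTop :=
        lintegral_liminf_le hm
    _ ≤ _ := by
        refine Filter.liminf_le_of_frequently_le' ?_
        exact Filter.Frequently.of_forall fun n => h.lintegral_stopped_min_le hτ n

end IsESuper

/-! ### Supermartingales that never move together -/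

namespace IsESuper

variable {Ω : Type*} [m : MeasurableSpace Ω] {P : Measure Ω} {𝒢 : Filtration ℕ m}
  {M N : ℕ → Ω → ℝ≥0∞}

theorem lintegral_mul_one_sub_le [IsProbabilityMeasure P] (h : IsESuper P 𝒢 M) (t : ℕ)
    {f : Ω → ℝ≥0∞} (hf : Measurable[𝒢 t] f) (hf1 : ∀ ω, f ω ≤ 1)
    (hfM : ∀ ω, f ω ≠ 0 → M t ω ≤ 1) :
    ∫⁻ ω, f ω * (1 - M t ω) ∂P ≤ ∫⁻ ω, f ω * (1 - M (t + 1) ω) ∂P := by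
  have hf' : Measurable f := hf.mono (𝒢.le t) le_rfl
  have hfin : ∫⁻ ω, f ω * M t ω ∂P ≠ ∞ := by
    refine ne_top_of_le_ne_top ENNReal.one_ne_top ?_
    calc ∫⁻ ω, f ω * M t ω ∂P ≤ ∫⁻ ω, 1 ∂P := by
          refine lintegral_mono fun ω => ?_
          by_cases h0 : f ω = 0
          · simp [h0]
          · exact (mul_le_mul' (hf1 ω) (hfM ω h0)).trans (by simp)
      _ = 1 := by simp
  have e1 : ∫⁻ ω, f ω * (1 - M t ω) ∂P + ∫⁻ ω, f ω * M t ω ∂P = ∫⁻ ω, f ω ∂P := by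
    rw [← lintegral_add_right _ (hf'.fun_mul (h.measurable t))]
    refine lintegral_congr fun ω => ?_
    by_cases h0 : f ω = 0
    · simp [h0]
    · rw [← mul_add, tsub_add_cancel_of_le (hfM ω h0), mul_one]
  calc ∫⁻ ω, f ω * (1 - M t ω) ∂P ≤ ∫⁻ ω, f ω ∂P - ∫⁻ ω, f ω * M t ω ∂P :=
        ENNReal.le_sub_of_add_le_right hfin e1.le
    _ ≤ ∫⁻ ω, f ω ∂P - ∫⁻ ω, f ω * M (t + 1) ω ∂P := tsub_le_tsub_left (h.step t f hf) _
    _ ≤ ∫⁻ ω, (f ω - f ω * M (t + 1) ω) ∂P :=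
        lintegral_sub_le _ _ (hf'.fun_mul (h.measurable (t + 1)))
    _ = _ := by
        refine lintegral_congr fun ω => ?_
        rw [ENNReal.mul_sub fun _ _ => ne_top_of_le_ne_top ENNReal.one_ne_top (hf1 ω), mul_one]

/-- A product form of Ville's inequality. If two supermartingales never move in the same round,
then the event that neither of them reaches `1` has the probability that it would at least have if
they were independent. The reason is that `(1 - M)(1 - N)` is a submartingale until one of the two
reaches `1`, and nonpositive at that moment. -/
theorem prob_lt_one_and_lt_one [IsProbabilityMeasure P] (hM : IsESuper P 𝒢 M)
    (hN : IsESuper P 𝒢 N) (D : ℕ → Set Ω) (hD : ∀ t, MeasurableSet[𝒢 t] (D t))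
    (hND : ∀ t, ∀ ω ∈ D t, N (t + 1) ω = N t ω) (hMD : ∀ t, ∀ ω ∉ D t, M (t + 1) ω = M t ω)
    {a b : ℝ≥0∞} (ha : ∀ ω, M 0 ω ≤ a) (hb : ∀ ω, N 0 ω ≤ b) :
    (1 - a) * (1 - b) ≤ P {ω | ∀ t, M t ω < 1 ∧ N t ω < 1} := by
  set B : ℕ → Set Ω := fun t => {ω | ∀ s ≤ t, M s ω < 1 ∧ N s ω < 1} with hBdef
  have hB : ∀ t, MeasurableSet[𝒢 t] (B t) := by
    intro t
    have : B t = ⋂ s, ⋂ (_ : s ≤ t), ({ω | M s ω < 1} ∩ {ω | N s ω < 1}) := by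
      ext ω; simp [hBdef]
    rw [this]
    refine MeasurableSet.iInter fun s => MeasurableSet.iInter fun hs => ?_
    exact 𝒢.mono hs _ ((measurableSet_lt (hM.adapted s) measurable_const).inter
      (measurableSet_lt (hN.adapted s) measurable_const))
  have hBanti : Antitone B := fun s t hst ω hω u hu => hω u (hu.trans hst)
  set Φ : ℕ → Ω → ℝ≥0∞ := fun t => (B t).indicator fun ω => (1 - M t ω) * (1 - N t ω) with hΦ
  have hstep : ∀ t, ∫⁻ ω, Φ t ω ∂P ≤ ∫⁻ ω, Φ (t + 1) ω ∂P := by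
    intro t
    have hBD : MeasurableSet[𝒢 t] (B t ∩ D t) := (hB t).inter (hD t)
    have hBD' : MeasurableSet[𝒢 t] (B t ∩ (D t)ᶜ) := (hB t).inter (hD t).compl
    set f : Ω → ℝ≥0∞ := (B t ∩ D t).indicator fun ω => 1 - N t ω with hf
    set g : Ω → ℝ≥0∞ := (B t ∩ (D t)ᶜ).indicator fun ω => 1 - M t ω with hg
    have hfm : Measurable[𝒢 t] f := (Measurable.const_sub (hN.adapted t) 1).indicator hBD
    have hgm : Measurable[𝒢 t] g := (Measurable.const_sub (hM.adapted t) 1).indicator hBD'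
    have h1 := hM.lintegral_mul_one_sub_le t hfm
      (fun ω => Set.indicator_apply_le' (fun _ => tsub_le_self) (fun _ => zero_le))
      (fun ω hω => ((Set.mem_of_indicator_ne_zero hω).1 t le_rfl).1.le)
    have h2 := hN.lintegral_mul_one_sub_le t hgm
      (fun ω => Set.indicator_apply_le' (fun _ => tsub_le_self) (fun _ => zero_le))
      (fun ω hω => ((Set.mem_of_indicator_ne_zero hω).1 t le_rfl).2.le)
    have hfm' : Measurable f := hfm.mono (𝒢.le t) le_rfl
    calc ∫⁻ ω, Φ t ω ∂P = ∫⁻ ω, (f ω * (1 - M t ω) + g ω * (1 - N t ω)) ∂P := by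
          refine lintegral_congr fun ω => ?_
          by_cases hω : ω ∈ B t <;> by_cases hd : ω ∈ D t <;>
            simp [hΦ, hf, hg, hω, hd, mul_comm]
      _ = ∫⁻ ω, f ω * (1 - M t ω) ∂P + ∫⁻ ω, g ω * (1 - N t ω) ∂P :=
          lintegral_add_left (hfm'.fun_mul (Measurable.const_sub (hM.measurable t) 1)) _
      _ ≤ ∫⁻ ω, f ω * (1 - M (t + 1) ω) ∂P + ∫⁻ ω, g ω * (1 - N (t + 1) ω) ∂P :=
          add_le_add h1 h2
      _ = ∫⁻ ω, (f ω * (1 - M (t + 1) ω) + g ω * (1 - N (t + 1) ω)) ∂P :=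
          (lintegral_add_left
            (hfm'.fun_mul (Measurable.const_sub (hM.measurable (t + 1)) 1)) _).symm
      _ ≤ ∫⁻ ω, Φ (t + 1) ω ∂P := by
          refine lintegral_mono fun ω => ?_
          by_cases hω : ω ∈ B t
          · have hB1 : M (t + 1) ω < 1 → N (t + 1) ω < 1 → ω ∈ B (t + 1) := by
              intro h3 h4 s hs
              rcases Nat.le_succ_iff.1 hs with h5 | h5
              · exact hω s h5
              · subst h5; exact ⟨h3, h4⟩
            by_cases hd : ω ∈ D t
            · by_cases h3 : M (t + 1) ω < 1
              · have h4 : N (t + 1) ω < 1 := by rw [hND t ω hd]; exact (hω t le_rfl).2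
                simp [hΦ, hf, hg, hω, hd, hB1 h3 h4, hND t ω hd, mul_comm]
              · simp [hf, hg, hω, hd, tsub_eq_zero_of_le (not_lt.1 h3)]
            · by_cases h3 : N (t + 1) ω < 1
              · have h4 : M (t + 1) ω < 1 := by rw [hMD t ω hd]; exact (hω t le_rfl).1
                simp [hΦ, hf, hg, hω, hd, hB1 h4 h3, hMD t ω hd]
              · simp [hf, hg, hω, hd, tsub_eq_zero_of_le (not_lt.1 h3)]
          · simp [hf, hg, hω]
  have h0 : (1 - a) * (1 - b) ≤ ∫⁻ ω, Φ 0 ω ∂P := by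
    calc (1 - a) * (1 - b) = ∫⁻ _, (1 - a) * (1 - b) ∂P := by simp
      _ ≤ _ := by
        refine lintegral_mono fun ω => ?_
        by_cases hω : ω ∈ B 0
        · simp only [hΦ, hω, Set.indicator_of_mem]
          exact mul_le_mul' (tsub_le_tsub_left (ha ω) _) (tsub_le_tsub_left (hb ω) _)
        · have : 1 ≤ M 0 ω ∨ 1 ≤ N 0 ω := by
            by_contra hcon
            push Not at hcon
            exact hω fun s hs => by rw [Nat.le_zero.1 hs]; exact hcon
          rcases this with h | h
          · simp [tsub_eq_zero_of_le (h.trans (ha ω))]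
          · simp [tsub_eq_zero_of_le (h.trans (hb ω))]
  have hall : ∀ t, (1 - a) * (1 - b) ≤ P (B t) := by
    intro t
    have h1 : (1 - a) * (1 - b) ≤ ∫⁻ ω, Φ t ω ∂P := by
      induction t with
      | zero => exact h0
      | succ t ih => exact ih.trans (hstep t)
    refine h1.trans ?_
    rw [hΦ, lintegral_indicator (𝒢.le t _ (hB t))]
    calc _ ≤ ∫⁻ _ in B t, 1 ∂P := lintegral_mono fun ω =>
          (mul_le_mul' tsub_le_self tsub_le_self).trans (one_mul 1).le
      _ = P (B t) := by simp
  have hset : {ω | ∀ t, M t ω < 1 ∧ N t ω < 1} = ⋂ t, B t := by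
    ext ω
    simp only [hBdef, Set.mem_ofPred_eq, Set.mem_iInter]
    exact ⟨fun h t s _ => h s, fun h t => h t t le_rfl⟩
  rw [hset, hBanti.measure_iInter (fun t => (𝒢.le t _ (hB t)).nullMeasurableSet)
    ⟨0, measure_ne_top _ _⟩]
  exact le_iInf hall

end IsESuper

/-! ### Running maxima of a supermartingale -/

/-- The maximum of `1` and of the values of the sequence `m` up to time `t`. -/
noncomputable def runMax (m : ℕ → ℝ) : ℕ → ℝ
  | 0 => 1
  | t + 1 => max (runMax m t) (m (t + 1))

theorem one_le_runMax (m : ℕ → ℝ) (t : ℕ) : 1 ≤ runMax m t := by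
  induction t with
  | zero => exact le_rfl
  | succ t ih => exact ih.trans (le_max_left _ _)

theorem runMax_mono (m : ℕ → ℝ) : Monotone (runMax m) :=
  monotone_nat_of_le_succ fun _ => le_max_left _ _

theorem le_runMax {m : ℕ → ℝ} (h0 : m 0 ≤ 1) {s t : ℕ} (h : s ≤ t) : m s ≤ runMax m t := by
  refine le_trans ?_ (runMax_mono m h)
  cases s with
  | zero => exact h0
  | succ s => exact le_max_right _ _

/-- The value at `m` of the tangent to the square root at `r`. If `r` is the running maximum of a
supermartingale and `m` its current value, this is again a supermartingale. -/
noncomputable def sqrtTangent (r m : ℝ) : ℝ := √r / 2 + m / (2 * √r)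

theorem sqrt_le_sqrtTangent {r m : ℝ} (hr : 0 < r) (hm : 0 ≤ m) : √m ≤ sqrtTangent r m := by
  have h : 0 < √r := Real.sqrt_pos.2 hr
  have : sqrtTangent r m - √m = (√r - √m) ^ 2 / (2 * √r) := by
    unfold sqrtTangent
    field_simp
    nlinarith [Real.sq_sqrt hr.le, Real.sq_sqrt hm]
  have h2 : 0 ≤ (√r - √m) ^ 2 / (2 * √r) := by positivity
  linarith

theorem sqrtTangent_max_le {r m : ℝ} (hr : 0 < r) (hm : 0 ≤ m) :
    sqrtTangent (max r m) m ≤ sqrtTangent r m := by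
  rcases le_total m r with h | h
  · rw [max_eq_left h]
  · rw [max_eq_right h]
    refine le_trans (le_of_eq ?_) (sqrt_le_sqrtTangent hr hm)
    have hm' : 0 < √m := Real.sqrt_pos.2 (hr.trans_le h)
    unfold sqrtTangent
    field_simp
    nlinarith [Real.sq_sqrt hm]

/-- A supermartingale that dominates half of the square root of the running maximum of the
positive supermartingale `m`. -/
theorem isESuper_sqrtTangent {Ω : Type*} [MeasurableSpace Ω] {P : Measure Ω}
    {𝒢 : Filtration ℕ ‹MeasurableSpace Ω›} {m : ℕ → Ω → ℝ} (hpos : ∀ t ω, 0 ≤ m t ω)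
    (hmeas : ∀ t, Measurable[𝒢 t] (m t))
    (h : IsESuper P 𝒢 fun t ω => ENNReal.ofReal (m t ω)) :
    IsESuper P 𝒢 fun t ω =>
      ENNReal.ofReal (sqrtTangent (runMax (fun s => m s ω) t) (m t ω)) := by
  have hr : ∀ t, Measurable[𝒢 t] fun ω => runMax (fun s => m s ω) t := by
    intro t
    induction t with
    | zero => exact measurable_const
    | succ t ih => exact (ih.mono (𝒢.mono t.le_succ) le_rfl).max (hmeas (t + 1))
  have hrpos : ∀ t ω, 0 < runMax (fun s => m s ω) t := fun t ω =>
    one_pos.trans_le (one_le_runMax _ t)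
  have hsplit : ∀ r x : ℝ, 0 < r → 0 ≤ x → ENNReal.ofReal (sqrtTangent r x) =
      ENNReal.ofReal (√r / 2) + ENNReal.ofReal (1 / (2 * √r)) * ENNReal.ofReal x := by
    intro r x hr hx
    rw [← ENNReal.ofReal_mul (by positivity), ← ENNReal.ofReal_add (by positivity) (by positivity)]
    unfold sqrtTangent
    congr 1; ring
  refine ⟨fun t => ?_, fun t f hf => ?_⟩
  · exact Measurable.ennreal_ofReal (((hr t).sqrt.div_const 2).add
      ((hmeas t).div ((hr t).sqrt.const_mul 2)))
  · set c : Ω → ℝ≥0∞ := fun ω => ENNReal.ofReal (√(runMax (fun s => m s ω) t) / 2) with hc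
    set d : Ω → ℝ≥0∞ := fun ω => ENNReal.ofReal (1 / (2 * √(runMax (fun s => m s ω) t))) with hd
    have hcm : Measurable[𝒢 t] c := Measurable.ennreal_ofReal ((hr t).sqrt.div_const 2)
    have hdm : Measurable[𝒢 t] d :=
      Measurable.ennreal_ofReal (measurable_const.div ((hr t).sqrt.const_mul 2))
    have hfc : Measurable fun ω => f ω * c ω := (hf.fun_mul hcm).mono (𝒢.le t) le_rfl
    calc ∫⁻ ω, f ω * ENNReal.ofReal (sqrtTangent (runMax (fun s => m s ω) (t + 1)) (m (t + 1) ω)) ∂P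
        ≤ ∫⁻ ω, (f ω * c ω + (f ω * d ω) * ENNReal.ofReal (m (t + 1) ω)) ∂P := by
          refine lintegral_mono fun ω => ?_
          have h1 := sqrtTangent_max_le (hrpos t ω) (hpos (t + 1) ω)
          have h2 := ENNReal.ofReal_le_ofReal h1
          rw [hsplit _ _ (hrpos t ω) (hpos (t + 1) ω)] at h2
          calc _ ≤ f ω * _ := mul_le_mul_right h2 (f ω)
            _ = _ := by rw [mul_add, mul_assoc]
      _ = ∫⁻ ω, f ω * c ω ∂P + ∫⁻ ω, (f ω * d ω) * ENNReal.ofReal (m (t + 1) ω) ∂P :=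
          lintegral_add_left hfc _
      _ ≤ ∫⁻ ω, f ω * c ω ∂P + ∫⁻ ω, (f ω * d ω) * ENNReal.ofReal (m t ω) ∂P :=
          add_le_add le_rfl (h.step t _ (hf.fun_mul hdm))
      _ = ∫⁻ ω, (f ω * c ω + (f ω * d ω) * ENNReal.ofReal (m t ω)) ∂P :=
          (lintegral_add_left hfc _).symm
      _ = _ := by
          refine lintegral_congr fun ω => ?_
          rw [hsplit _ _ (hrpos t ω) (hpos t ω), mul_add, mul_assoc]

/-! ### Exponential supermartingales of a single arm -/

/-- The exponent `∑ (λ (x - m) - λ² / 2)` over the rewards `x` sampled from arm `i` by time `t`. -/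
noncomputable def expStat {k : ℕ} (A : ℕ → Finset (Fin k)) (x : Fin k → ℕ → ℝ) (i : Fin k)
    (m lam : ℝ) (t : ℕ) : ℝ :=
  ∑ s ∈ (Finset.range t).filter (fun s => i ∈ A s), (lam * (x i s - m) - lam ^ 2 / 2)

theorem expStat_zero {k : ℕ} (A : ℕ → Finset (Fin k)) (x : Fin k → ℕ → ℝ) (i : Fin k)
    (m lam : ℝ) : expStat A x i m lam 0 = 0 := by
  simp [expStat]

theorem sum_filter_range_succ {k : ℕ} {β : Type*} [AddCommMonoid β] (A : ℕ → Finset (Fin k))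
    (i : Fin k) (f : ℕ → β) (t : ℕ) :
    ∑ s ∈ (Finset.range (t + 1)).filter (fun s => i ∈ A s), f s =
      (∑ s ∈ (Finset.range t).filter (fun s => i ∈ A s), f s) + if i ∈ A t then f t else 0 := by
  rw [Finset.sum_filter, Finset.sum_filter, Finset.sum_range_succ]

theorem expStat_succ {k : ℕ} (A : ℕ → Finset (Fin k)) (x : Fin k → ℕ → ℝ) (i : Fin k)
    (m lam : ℝ) (t : ℕ) : expStat A x i m lam (t + 1) =
      expStat A x i m lam t + if i ∈ A t then lam * (x i t - m) - lam ^ 2 / 2 else 0 :=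
  sum_filter_range_succ A i _ t

theorem expStat_succ_of_notMem {k : ℕ} {A : ℕ → Finset (Fin k)} (x : Fin k → ℕ → ℝ) {i : Fin k}
    (m lam : ℝ) {t : ℕ} (h : i ∉ A t) :
    expStat A x i m lam (t + 1) = expStat A x i m lam t := by
  rw [expStat_succ, if_neg h, add_zero]

/-- In terms of the centred sum and the number of samples. -/
theorem expStat_eq {k : ℕ} (A : ℕ → Finset (Fin k)) (x : Fin k → ℕ → ℝ) (i : Fin k)
    (m lam : ℝ) (t : ℕ) : expStat A x i m lam t =
      lam * (∑ s ∈ (Finset.range t).filter (fun s => i ∈ A s), (x i s - m))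
        - lam ^ 2 / 2 * numSamples A i t := by
  unfold expStat numSamples
  rw [Finset.sum_sub_distrib, ← Finset.mul_sum, Finset.sum_const, nsmul_eq_mul]
  ring

theorem lintegral_exp_le_one_of_subgaussian {ν : Measure ℝ} [IsProbabilityMeasure ν]
    (h : HasSubgaussianMGF (fun y => y - mean ν) 1 ν) {lam m : ℝ} (hlam : lam * (mean ν - m) ≤ 0) :
    ∫⁻ y, ENNReal.ofReal (Real.exp (lam * (y - m) - lam ^ 2 / 2)) ∂ν ≤ 1 := by
  have h1 := h.mgf_le lam
  have hint := h.integrable_exp_mul lam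
  have e : ∀ y, Real.exp (lam * (y - m) - lam ^ 2 / 2) =
      Real.exp (lam * (mean ν - m) - lam ^ 2 / 2) * Real.exp (lam * (y - mean ν)) := by
    intro y; rw [← Real.exp_add]; congr 1; ring
  rw [← ofReal_integral_eq_lintegral_ofReal]
  · refine ENNReal.ofReal_le_one.2 ?_
    rw [integral_congr_ae (Filter.Eventually.of_forall e), integral_const_mul]
    have h2 : ∫ y, Real.exp (lam * (y - mean ν)) ∂ν ≤ Real.exp (lam ^ 2 / 2) := by
      simpa [mgf] using h1
    calc _ ≤ Real.exp (lam * (mean ν - m) - lam ^ 2 / 2) * Real.exp (lam ^ 2 / 2) := by gcongr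
      _ = Real.exp (lam * (mean ν - m)) := by rw [← Real.exp_add]; congr 1; ring
      _ ≤ 1 := Real.exp_le_one_iff.2 hlam
  · rw [funext e]; exact hint.const_mul _
  · exact Filter.Eventually.of_forall fun y => (Real.exp_pos _).le

section Model

variable {Ω : Type*} [m : MeasurableSpace Ω] {P : Measure Ω} {k : ℕ}
  {ν : Fin k → Measure ℝ} {U : Ω → ℝ} {X : Fin k → ℕ → Ω → ℝ} {A : ℕ → Ω → Finset (Fin k)}
  {hU : Measurable U} {hX : ∀ i s, Measurable (X i s)} {hA : ∀ s, Measurable (A s)}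

theorem measurable_expStat (h : IsBanditModel P ν U X A hU hX hA) (i : Fin k) (μ lam : ℝ)
    (t : ℕ) : Measurable[tableFiltration U X hU hX t] fun ω =>
      expStat (fun s => A s ω) (fun i s => X i s ω) i μ lam t := by
  have : (fun ω => expStat (fun s => A s ω) (fun i s => X i s ω) i μ lam t) = fun ω =>
      ∑ s ∈ Finset.range t, if i ∈ A s ω then lam * (X i s ω - μ) - lam ^ 2 / 2 else 0 := by
    ext ω; unfold expStat; rw [Finset.sum_filter]
  rw [this]
  refine Finset.measurable_sum _ fun s hs => ?_
  have hs' := Finset.mem_range.1 hs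
  refine Measurable.ite (measurable_sampled_table h hs'.le (measurableSet_mem_finset i)) ?_
    measurable_const
  exact (((measurable_table i hs').sub_const μ).const_mul lam).sub_const _

theorem isESuper_exp (h : IsBanditModel P ν U X A hU hX hA) (i : Fin k) {μ lam : ℝ}
    (hν : ∫⁻ y, ENNReal.ofReal (Real.exp (lam * (y - μ) - lam ^ 2 / 2)) ∂(ν i) ≤ 1) :
    IsESuper P (tableFiltration U X hU hX) fun t ω =>
      ENNReal.ofReal (Real.exp (expStat (fun s => A s ω) (fun i s => X i s ω) i μ lam t)) := by
  refine ⟨fun t => (measurable_expStat h i μ lam t).exp.ennreal_ofReal, fun t f hf => ?_⟩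
  set 𝒢 := tableFiltration U X hU hX
  set M : Ω → ℝ≥0∞ := fun ω =>
    ENNReal.ofReal (Real.exp (expStat (fun s => A s ω) (fun i s => X i s ω) i μ lam t)) with hM
  have hMm : Measurable[𝒢 t] M := (measurable_expStat h i μ lam t).exp.ennreal_ofReal
  set g : ℝ → ℝ≥0∞ := fun y => ENNReal.ofReal (Real.exp (lam * (y - μ) - lam ^ 2 / 2)) with hg
  have hgm : Measurable g := by fun_prop
  set S : Set Ω := {ω | i ∈ A t ω} with hS
  have hSm : MeasurableSet[𝒢 t] S :=
    measurable_sampled_table h le_rfl (measurableSet_mem_finset i)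
  have hfM : Measurable[𝒢 t] fun ω => f ω * M ω := hf.fun_mul hMm
  have hF : Measurable[𝒢 t] (Sᶜ.indicator fun ω => f ω * M ω) := hfM.indicator hSm.compl
  calc ∫⁻ ω, f ω * ENNReal.ofReal (Real.exp
        (expStat (fun s => A s ω) (fun i s => X i s ω) i μ lam (t + 1))) ∂P
      = ∫⁻ ω, (Sᶜ.indicator (fun ω => f ω * M ω) ω
          + S.indicator (fun ω => f ω * M ω) ω * g (X i t ω)) ∂P := by
        refine lintegral_congr fun ω => ?_
        by_cases hω : i ∈ A t ω
        · have h1 : ω ∈ S := hω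
          rw [Set.indicator_of_notMem (Set.notMem_compl_iff.2 h1), Set.indicator_of_mem h1,
            zero_add, expStat_succ, if_pos hω, Real.exp_add, ENNReal.ofReal_mul (Real.exp_pos _).le,
            mul_assoc]
        · have h1 : ω ∉ S := hω
          rw [Set.indicator_of_mem (Set.mem_compl h1), Set.indicator_of_notMem h1, zero_mul,
            add_zero, expStat_succ, if_neg hω, add_zero]
    _ = ∫⁻ ω, Sᶜ.indicator (fun ω => f ω * M ω) ω ∂P
          + ∫⁻ ω, S.indicator (fun ω => f ω * M ω) ω * g (X i t ω) ∂P :=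
        lintegral_add_left (hF.mono (𝒢.le t) le_rfl) _
    _ ≤ ∫⁻ ω, Sᶜ.indicator (fun ω => f ω * M ω) ω ∂P
          + ∫⁻ ω, S.indicator (fun ω => f ω * M ω) ω ∂P :=
        add_le_add le_rfl (lintegral_mul_reward_le h i t (hfM.indicator hSm) hgm hν)
    _ = ∫⁻ ω, (Sᶜ.indicator (fun ω => f ω * M ω) ω + S.indicator (fun ω => f ω * M ω) ω) ∂P :=
        (lintegral_add_left (hF.mono (𝒢.le t) le_rfl) _).symm
    _ = ∫⁻ ω, f ω * M ω ∂P := by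
        refine lintegral_congr fun ω => ?_
        exact Set.indicator_compl_add_self_apply S (fun ω => f ω * M ω) ω

end Model

/-! ### Mixtures over a geometric grid -/

/-- Weights `a^s ((k + a)^{-s} - (k + 1 + a)^{-s})`: a telescoping probability sequence that decays
like `k^{-1-s}`. -/
noncomputable def mixWeight (s a : ℝ) (k : ℕ) : ℝ :=
  a ^ s * (((k : ℝ) + a) ^ (-s) - ((k : ℝ) + 1 + a) ^ (-s))

theorem mixWeight_nonneg {s a : ℝ} (hs : 0 < s) (ha : 0 < a) (k : ℕ) : 0 ≤ mixWeight s a k := by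
  unfold mixWeight
  refine mul_nonneg (Real.rpow_nonneg ha.le s) (sub_nonneg.2 ?_)
  exact Real.rpow_le_rpow_of_nonpos (by positivity) (by linarith) (by linarith)

theorem sum_mixWeight {s a : ℝ} (ha : 0 < a) (n : ℕ) :
    ∑ k ∈ Finset.range n, mixWeight s a k = 1 - a ^ s * ((n : ℝ) + a) ^ (-s) := by
  induction n with
  | zero =>
    rw [Real.rpow_neg (by positivity)]
    simp [mul_inv_cancel₀ (Real.rpow_pos_of_pos ha s).ne']
  | succ n ih =>
    rw [Finset.sum_range_succ, ih]
    unfold mixWeight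
    push_cast
    ring

theorem hasSum_mixWeight {s a : ℝ} (hs : 0 < s) (ha : 0 < a) : HasSum (mixWeight s a) 1 := by
  rw [hasSum_iff_tendsto_nat_of_nonneg (mixWeight_nonneg hs ha)]
  simp_rw [sum_mixWeight ha]
  have h1 : Filter.Tendsto (fun n : ℕ => (n : ℝ) + a) Filter.atTop Filter.atTop :=
    Filter.tendsto_atTop_add_const_right _ _ tendsto_natCast_atTop_atTop
  have h2 := ((tendsto_rpow_neg_atTop hs).comp h1).const_mul (a ^ s)
  simpa using h2.const_sub 1

theorem tsum_ofReal_mixWeight {s a : ℝ} (hs : 0 < s) (ha : 0 < a) :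
    ∑' k, ENNReal.ofReal (mixWeight s a k) = 1 := by
  rw [← ENNReal.ofReal_tsum_of_nonneg (mixWeight_nonneg hs ha) (hasSum_mixWeight hs ha).summable,
    (hasSum_mixWeight hs ha).tsum_eq, ENNReal.ofReal_one]

/-- The midpoint rule for the convex function `s x^{-1-s}`, in the form of a lower bound. -/
theorem midpoint_rpow_le {s m h : ℝ} (hs : 0 < s) (hh : 0 ≤ h) (hm : h < m) :
    2 * h * s * m ^ (-1 - s) ≤ (m - h) ^ (-s) - (m + h) ^ (-s) := by
  set g : ℝ → ℝ := fun u => (m - u) ^ (-s) - (m + u) ^ (-s) - 2 * u * s * m ^ (-1 - s) with hg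
  have hder : ∀ u ∈ Set.Icc 0 h, HasDerivAt g
      (s * (m - u) ^ (-s - 1) + s * (m + u) ^ (-s - 1) - 2 * s * m ^ (-1 - s)) u := by
    intro u hu
    have h1 : HasDerivAt (fun u => (m - u) ^ (-s)) (-1 * (-s) * (m - u) ^ (-s - 1)) u :=
      ((hasDerivAt_id u).const_sub m).rpow_const (Or.inl (by
        have := hu.2; simp only [id]; linarith))
    have h2 : HasDerivAt (fun u => (m + u) ^ (-s)) (1 * (-s) * (m + u) ^ (-s - 1)) u :=
      ((hasDerivAt_id u).const_add m).rpow_const (Or.inl (by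
        have := hu.1; simp only [id]; linarith))
    have h3 : HasDerivAt (fun u => 2 * u * s * m ^ (-1 - s)) (2 * 1 * s * m ^ (-1 - s)) u :=
      (((hasDerivAt_id u).const_mul 2).mul_const s).mul_const _
    exact ((h1.sub h2).sub h3).congr_deriv (by ring)
  have hmono : MonotoneOn g (Set.Icc 0 h) := by
    refine monotoneOn_of_deriv_nonneg (convex_Icc 0 h)
      (fun u hu => (hder u hu).continuousAt.continuousWithinAt)
      (fun u hu => (hder u (interior_subset hu)).differentiableAt.differentiableWithinAt)
      fun u hu => ?_
    have hu' := interior_subset hu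
    rw [(hder u hu').deriv]
    have hp1 : 0 < m - u := by linarith [hu'.2]
    have hp2 : 0 < m + u := by linarith [hu'.1]
    have hm0 : 0 < m := by linarith
    -- By the AM-GM inequality, as `(m - u) (m + u) ≤ m²`.
    have hprod : m ^ (-s - 1) * m ^ (-s - 1) ≤ (m - u) ^ (-s - 1) * (m + u) ^ (-s - 1) := by
      rw [← Real.mul_rpow hm0.le hm0.le, ← Real.mul_rpow hp1.le hp2.le]
      exact Real.rpow_le_rpow_of_nonpos (by positivity) (by nlinarith [sq_nonneg u])
        (by linarith)
    have e : (-1 - s) = -s - 1 := by ring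
    rw [e]
    have q0 : 0 < m ^ (-s - 1) := Real.rpow_pos_of_pos hm0 _
    have q1 : 0 < (m - u) ^ (-s - 1) := Real.rpow_pos_of_pos hp1 _
    have q2 : 0 < (m + u) ^ (-s - 1) := Real.rpow_pos_of_pos hp2 _
    have : 2 * m ^ (-s - 1) ≤ (m - u) ^ (-s - 1) + (m + u) ^ (-s - 1) := by
      refine abs_le_of_sq_le_sq' ?_ (by positivity) |>.2
      nlinarith [sq_nonneg ((m - u) ^ (-s - 1) - (m + u) ^ (-s - 1))]
    nlinarith
  have := hmono (Set.left_mem_Icc.2 hh) (Set.right_mem_Icc.2 hh) hh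
  simp only [hg] at this
  simp at this
  linarith

theorem le_mixWeight {s a : ℝ} (hs : 0 < s) (ha : 0 < a) (k : ℕ) :
    s * a ^ s * ((k : ℝ) + 1 / 2 + a) ^ (-1 - s) ≤ mixWeight s a k := by
  have h := midpoint_rpow_le (s := s) (m := (k : ℝ) + 1 / 2 + a) (h := 1 / 2) hs (by norm_num)
    (by have : (0 : ℝ) ≤ k := k.cast_nonneg
        linarith)
  have e1 : (k : ℝ) + 1 / 2 + a - 1 / 2 = k + a := by ring
  have e2 : (k : ℝ) + 1 / 2 + a + 1 / 2 = k + 1 + a := by ring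
  rw [e1, e2] at h
  unfold mixWeight
  have := mul_le_mul_of_nonneg_left h (Real.rpow_nonneg ha.le s)
  calc _ = a ^ s * (2 * (1 / 2) * s * ((k : ℝ) + 1 / 2 + a) ^ (-1 - s)) := by ring
    _ ≤ _ := this

/-- The weight carried by the two neighbouring grid points `K` and `K + 1`, balanced. -/
noncomputable def pairWeight (s a : ℝ) (K : ℕ) : ℝ := s * a ^ s * ((K : ℝ) + 1 + a) ^ (-1 - s)

theorem pairWeight_pos {s a : ℝ} (hs : 0 < s) (ha : 0 < a) (K : ℕ) : 0 < pairWeight s a K := by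
  unfold pairWeight; positivity

theorem sq_pairWeight_le {s a : ℝ} (hs : 0 < s) (ha : 0 < a) (K : ℕ) :
    pairWeight s a K ^ 2 ≤ mixWeight s a K * mixWeight s a (K + 1) := by
  have h1 := le_mixWeight hs ha K
  have h2 := le_mixWeight hs ha (K + 1)
  have hK : (0 : ℝ) ≤ K := K.cast_nonneg
  refine le_trans ?_ (mul_le_mul h1 h2 (by positivity) (mixWeight_nonneg hs ha K))
  have h3 : ((K : ℝ) + 1 + a) ^ (-1 - s) * ((K : ℝ) + 1 + a) ^ (-1 - s) ≤
      ((K : ℝ) + 1 / 2 + a) ^ (-1 - s) * (((K + 1 : ℕ) : ℝ) + 1 / 2 + a) ^ (-1 - s) := by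
    rw [← Real.mul_rpow (by positivity) (by positivity),
      ← Real.mul_rpow (by positivity) (by positivity)]
    refine Real.rpow_le_rpow_of_nonpos (by positivity) ?_ (by linarith)
    push_cast
    nlinarith
  unfold pairWeight
  have h4 : 0 ≤ (s * a ^ s) ^ 2 := sq_nonneg _
  have := mul_le_mul_of_nonneg_left h3 h4
  linarith

theorem two_mul_pairWeight_mul_exp_le {s a : ℝ} (hs : 0 < s) (ha : 0 < a) (K : ℕ) {u v y : ℝ}
    (huv : 2 * y ≤ u + v) :
    2 * pairWeight s a K * Real.exp y ≤
      mixWeight s a K * Real.exp u + mixWeight s a (K + 1) * Real.exp v := by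
  have h1 := sq_pairWeight_le hs ha K
  have h2 := pairWeight_pos hs ha K
  have h3 := mixWeight_nonneg hs ha K
  have h4 := mixWeight_nonneg hs ha (K + 1)
  refine abs_le_of_sq_le_sq' ?_ (by positivity) |>.2
  have h5 : Real.exp y ^ 2 ≤ Real.exp u * Real.exp v := by
    rw [← Real.exp_add, ← Real.exp_nat_mul]
    exact Real.exp_le_exp.2 (by push_cast; linarith)
  have h6 : pairWeight s a K ^ 2 * Real.exp y ^ 2 ≤
      (mixWeight s a K * mixWeight s a (K + 1)) * (Real.exp u * Real.exp v) :=
    mul_le_mul h1 h5 (by positivity) (by positivity)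
  nlinarith [sq_nonneg (mixWeight s a K * Real.exp u - mixWeight s a (K + 1) * Real.exp v)]

/-- The largest grid point relative to the optimal one, `2ρ / (1 + ρ²)`. It is also the share of
the optimal exponent that is attained on average by the two grid points that enclose the optimum. -/
noncomputable def gridTop (ρ : ℝ) : ℝ := 2 * ρ / (1 + ρ ^ 2)

theorem gridTop_pos {ρ : ℝ} (hρ : 1 < ρ) : 0 < gridTop ρ := by
  unfold gridTop; positivity

theorem gridTop_le_one {ρ : ℝ} : gridTop ρ ≤ 1 := by
  unfold gridTop
  rw [div_le_one (by positivity)]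
  nlinarith [sq_nonneg (ρ - 1)]

/-- The grid points relative to the optimal rate `√(2 x₁)` of the first round. -/
noncomputable def gridPt (ρ : ℝ) (k : ℕ) : ℝ := gridTop ρ * (ρ ^ k)⁻¹

theorem gridPt_pos {ρ : ℝ} (hρ : 1 < ρ) (k : ℕ) : 0 < gridPt ρ k := by
  have := gridTop_pos hρ
  unfold gridPt; positivity

theorem gridPt_le_one {ρ : ℝ} (hρ : 1 < ρ) (k : ℕ) : gridPt ρ k ≤ 1 := by
  unfold gridPt
  have h1 : (ρ ^ k)⁻¹ ≤ 1 := inv_le_one_of_one_le₀ (one_le_pow₀ hρ.le)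
  exact mul_le_one₀ gridTop_le_one (by positivity) h1

/-- The rates `λ_k` of the mixture. -/
noncomputable def gridRate (ρ x₁ : ℝ) (k : ℕ) : ℝ := √(2 * x₁) * gridPt ρ k

/-- The mixture `∑_k w_k exp(λ_k y - λ_k² n / 2)`. -/
noncomputable def mixSum (s a ρ x₁ : ℝ) (n : ℝ) (y : ℝ) : ℝ≥0∞ :=
  ∑' k, ENNReal.ofReal (mixWeight s a k *
    Real.exp (gridRate ρ x₁ k * y - gridRate ρ x₁ k ^ 2 / 2 * n))

theorem gridRate_exponent {ρ x₁ n x : ℝ} (hx₁ : 0 ≤ x₁) (hn : 0 ≤ n) (k : ℕ) :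
    gridRate ρ x₁ k * √(2 * x * n) - gridRate ρ x₁ k ^ 2 / 2 * n =
      2 * gridPt ρ k * (√(x₁ * n) * √x) - gridPt ρ k ^ 2 * (x₁ * n) := by
  have e1 : √(2 * x₁) * √(2 * x * n) = 2 * (√(x₁ * n) * √x) := by
    rw [← Real.sqrt_mul (by positivity), ← Real.sqrt_mul (by positivity)]
    rw [show 2 * x₁ * (2 * x * n) = 2 ^ 2 * (x₁ * n * x) by ring, Real.sqrt_mul (by positivity),
      Real.sqrt_sq (by norm_num)]
  unfold gridRate
  rw [mul_pow, Real.sq_sqrt (by positivity)]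
  linear_combination gridPt ρ k * e1

/-- While `n x₁ ≤ x`, the exponents are at least as large as in the first round. -/
theorem gridRate_exponent_ge {ρ x₁ n x : ℝ} (hρ : 1 < ρ) (hx₁ : 0 ≤ x₁) (hn : 1 ≤ n)
    (h : x₁ * n ≤ x) (k : ℕ) :
    x₁ * (2 * gridPt ρ k - gridPt ρ k ^ 2) ≤
      gridRate ρ x₁ k * √(2 * x * n) - gridRate ρ x₁ k ^ 2 / 2 * n := by
  rw [gridRate_exponent hx₁ (by linarith)]
  have h0 := gridPt_pos hρ k
  have h1 := gridPt_le_one hρ k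
  have h2 : x₁ * n ≤ √(x₁ * n) * √x := by
    calc x₁ * n = √(x₁ * n) * √(x₁ * n) := (Real.mul_self_sqrt (by positivity)).symm
      _ ≤ _ := by gcongr
  have h3 : x₁ ≤ x₁ * n := le_mul_of_one_le_right hx₁ hn
  have h4 : 0 ≤ 2 * gridPt ρ k - gridPt ρ k ^ 2 := by nlinarith
  nlinarith

theorem add_le_mixSum {s a ρ x₁ n y : ℝ} (hs : 0 < s) (ha : 0 < a) (K : ℕ) :
    ENNReal.ofReal (mixWeight s a K *
      Real.exp (gridRate ρ x₁ K * y - gridRate ρ x₁ K ^ 2 / 2 * n) + mixWeight s a (K + 1) *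
      Real.exp (gridRate ρ x₁ (K + 1) * y - gridRate ρ x₁ (K + 1) ^ 2 / 2 * n)) ≤
      mixSum s a ρ x₁ n y := by
  have h3 := mixWeight_nonneg hs ha K
  have h4 := mixWeight_nonneg hs ha (K + 1)
  rw [ENNReal.ofReal_add (by positivity) (by positivity)]
  have := ENNReal.sum_le_tsum (f := fun k => ENNReal.ofReal (mixWeight s a k *
    Real.exp (gridRate ρ x₁ k * y - gridRate ρ x₁ k ^ 2 / 2 * n))) ({K, K + 1} : Finset ℕ)
  rwa [Finset.sum_pair (by simp)] at this

/-- The mixture at a level `x` that is beyond the optimum of the largest rate: the two grid points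
that enclose the optimal rate yield at least the share `gridTop ρ` of the optimal exponent. -/
theorem exists_pair_le_mixSum {s a ρ x₁ n x : ℝ} (hs : 0 < s) (ha : 0 < a) (hρ : 1 < ρ)
    (hx₁ : 0 ≤ x₁) (hn : 0 ≤ n) (hx : 0 < x) (h : x ≤ x₁ * n) :
    ∃ K : ℕ, (ρ ^ 2) ^ K ≤ x₁ * n / x ∧
      ENNReal.ofReal (2 * pairWeight s a K * Real.exp (gridTop ρ * x)) ≤
        mixSum s a ρ x₁ n (√(2 * x * n)) := by
  have hr : 0 < √x := Real.sqrt_pos.2 hx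
  have hz : 1 ≤ √(x₁ * n) / √x := by
    rw [one_le_div hr]; exact Real.sqrt_le_sqrt h
  obtain ⟨K, hK1, hK2⟩ := exists_nat_pow_near hz hρ
  refine ⟨K, ?_, ?_⟩
  · have := pow_le_pow_left₀ (by positivity) hK1 2
    rwa [div_pow, Real.sq_sqrt (by positivity), Real.sq_sqrt hx.le, ← pow_mul, mul_comm, pow_mul]
      at this
  · refine le_trans (ENNReal.ofReal_le_ofReal ?_) (add_le_mixSum hs ha K)
    refine two_mul_pairWeight_mul_exp_le hs ha K ?_
    rw [gridRate_exponent hx₁ hn, gridRate_exponent hx₁ hn]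
    set z := √(x₁ * n) / √x with hzdef
    have hp : √(x₁ * n) = z * √x := by rw [hzdef]; field_simp
    have hx2 : √x * √x = x := Real.mul_self_sqrt hx.le
    have e1 : √(x₁ * n) * √x = z * x := by rw [hp, mul_assoc, hx2]
    have e2 : x₁ * n = z ^ 2 * x := by
      rw [← Real.mul_self_sqrt (show 0 ≤ x₁ * n by positivity), hp]
      linear_combination z ^ 2 * hx2
    rw [e1, e2]
    -- `u` locates the optimal rate between the two grid points
    set u := z * (ρ ^ K)⁻¹ with hu
    have hρK : 0 < ρ ^ K := by positivity
    have hu1 : 1 ≤ u := by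
      rw [hu, ← div_eq_mul_inv, one_le_div hρK]; exact hK1
    have hu2 : u ≤ ρ := by
      rw [hu, ← div_eq_mul_inv, div_le_iff₀ hρK]
      have := hK2.le
      rw [pow_succ] at this
      linarith
    have g1 : gridPt ρ K * z = gridTop ρ * u := by unfold gridPt; rw [hu]; ring
    have g2 : gridPt ρ (K + 1) * z = gridTop ρ * u / ρ := by
      unfold gridPt; rw [hu, pow_succ]; field_simp
    have e3 : 2 * gridPt ρ K * (z * x) - gridPt ρ K ^ 2 * (z ^ 2 * x) +
        (2 * gridPt ρ (K + 1) * (z * x) - gridPt ρ (K + 1) ^ 2 * (z ^ 2 * x)) =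
        (2 * (gridTop ρ * u) - (gridTop ρ * u) ^ 2 + (2 * (gridTop ρ * u / ρ)
          - (gridTop ρ * u / ρ) ^ 2)) * x := by
      rw [← g2, ← g1]; ring
    rw [e3]
    have e4 : 2 * (gridTop ρ * u) - (gridTop ρ * u) ^ 2 + (2 * (gridTop ρ * u / ρ)
          - (gridTop ρ * u / ρ) ^ 2) - 2 * gridTop ρ =
          4 * ((u - 1) * (ρ - u)) / (1 + ρ ^ 2) := by
      unfold gridTop
      field_simp
      ring
    have e5 : 0 ≤ 4 * ((u - 1) * (ρ - u)) / (1 + ρ ^ 2) := by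
      have := mul_nonneg (sub_nonneg.2 hu1) (sub_nonneg.2 hu2)
      positivity
    nlinarith

/-- The same two-point bound for the first two grid points in the first rounds. -/
theorem pair_zero_le_mixSum {s a ρ x₁ n x : ℝ} (hs : 0 < s) (ha : 0 < a) (hρ : 1 < ρ)
    (hx₁ : 0 ≤ x₁) (hn : 1 ≤ n) (h : x₁ * n ≤ x) :
    ENNReal.ofReal (2 * pairWeight s a 0 * Real.exp (gridTop ρ * x₁)) ≤
      mixSum s a ρ x₁ n (√(2 * x * n)) := by
  refine le_trans (ENNReal.ofReal_le_ofReal ?_) (add_le_mixSum hs ha 0)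
  refine two_mul_pairWeight_mul_exp_le hs ha 0 ?_
  have h0 := gridRate_exponent_ge hρ hx₁ hn h 0
  have h1 := gridRate_exponent_ge hρ hx₁ hn h (0 + 1)
  have e : 2 * gridPt ρ 0 - gridPt ρ 0 ^ 2 + (2 * gridPt ρ (0 + 1) - gridPt ρ (0 + 1) ^ 2)
      = 2 * gridTop ρ := by
    unfold gridPt gridTop
    field_simp
    ring
  have e2 : x₁ * (2 * gridPt ρ 0 - gridPt ρ 0 ^ 2) +
      x₁ * (2 * gridPt ρ (0 + 1) - gridPt ρ (0 + 1) ^ 2) = 2 * (gridTop ρ * x₁) := by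
    rw [← mul_add, e]; ring
  linarith

/-! ### Numerical bounds -/

theorem le_rpow_of_pow_le {a b : ℝ} (ha : 0 ≤ a) (hb : 0 ≤ b) (p q : ℕ) (hq : q ≠ 0)
    (h : b ^ q ≤ a ^ p) : b ≤ a ^ ((p : ℝ) / q) := by
  have h1 : b = (b ^ q) ^ ((1 : ℝ) / q) := by
    rw [one_div, Real.pow_rpow_inv_natCast hb hq]
  have h2 : a ^ ((p : ℝ) / q) = (a ^ p) ^ ((1 : ℝ) / q) := by
    rw [← Real.rpow_natCast, ← Real.rpow_mul ha]; congr 1; ring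
  rw [h1, h2]
  exact Real.rpow_le_rpow (by positivity) h (by positivity)

theorem one_add_mul_le_exp_mul {p L : ℝ} (hp : 1 ≤ p) :
    1 + p * (Real.exp L - 1) ≤ Real.exp (p * L) := by
  have h := one_add_mul_self_le_rpow_one_add (s := Real.exp L - 1)
    (by linarith [Real.exp_pos L]) hp
  rwa [add_sub_cancel, ← Real.exp_mul, mul_comm L p] at h

theorem exp_ge_sum {x : ℝ} (hx : 0 ≤ x) :
    1 + x + x ^ 2 / 2 + x ^ 3 / 6 + x ^ 4 / 24 + x ^ 5 / 120 + x ^ 6 / 720 ≤ Real.exp x := by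
  have h := Real.sum_le_exp_of_nonneg hx 7
  simp [Finset.sum_range_succ, Nat.factorial] at h
  linarith

theorem log_ge_of_sum_exp_neg {c y : ℝ} (hc : 0 ≤ c) (hy : 0 < y)
    (h : 1 ≤ y * (1 + c + c ^ 2 / 2 + c ^ 3 / 6 + c ^ 4 / 24 + c ^ 5 / 120 + c ^ 6 / 720)) :
    -c ≤ Real.log y := by
  rw [Real.le_log_iff_exp_le hy, Real.exp_neg, inv_le_iff_one_le_mul₀ (Real.exp_pos c)]
  exact h.trans (mul_le_mul_of_nonneg_left (exp_ge_sum hc) hy.le)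

/-! ### The confidence boundaries are crossed with probability less than `δ` -/

/-- The weights `w` and the rates `lam` define a mixture that is at least `κ` as soon as the sum of
`n` centred rewards reaches the boundary `n φ(n, δ)`. Then a supermartingale inequality bounds the
probability of ever crossing the boundary by `1 / κ`. -/
structure IsCertificate (φ : ℕ → ℝ → ℝ) (δ κ : ℝ) (w lam : ℕ → ℝ) : Prop where
  weight_nonneg : ∀ k, 0 ≤ w k
  rate_nonneg : ∀ k, 0 ≤ lam k
  tsum_weight : ∑' k, ENNReal.ofReal (w k) = 1
  le_tsum : ∀ n : ℕ, 1 ≤ n → ENNReal.ofReal κ ≤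
    ∑' k, ENNReal.ofReal (w k * Real.exp (lam k * (n * φ n δ) - lam k ^ 2 / 2 * n))

theorem IsCertificate.of_mixSum {φ : ℕ → ℝ → ℝ} {δ κ s a ρ x₁ : ℝ} (hs : 0 < s) (ha : 0 < a)
    (hρ : 1 < ρ) (x : ℕ → ℝ) (hφ : ∀ n : ℕ, φ n δ = √(2 * x n / n))
    (h : ∀ n : ℕ, 1 ≤ n → ENNReal.ofReal κ ≤ mixSum s a ρ x₁ n (√(2 * x n * n))) :
    IsCertificate φ δ κ (mixWeight s a) (gridRate ρ x₁) := by
  refine ⟨mixWeight_nonneg hs ha, fun k => ?_, tsum_ofReal_mixWeight hs ha, fun n hn => ?_⟩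
  · have := gridPt_pos hρ k
    unfold gridRate; positivity
  · have hn' : (0 : ℝ) < n := by exact_mod_cast hn
    have e : (n : ℝ) * φ n δ = √(2 * x n * n) := by
      rw [hφ]
      nth_rewrite 1 [← Real.sqrt_sq hn'.le]
      rw [← Real.sqrt_mul (by positivity)]
      congr 1; field_simp
    rw [e]
    exact h n hn

/-- The grid ratio that is used for `φ⁰` and `φ^IS`. -/
noncomputable def ratio : ℝ := 1.28

theorem gridTop_ratio_ge : 0.97 ≤ gridTop ratio := by
  unfold gridTop ratio; norm_num

theorem gridTop_ratio_le : gridTop ratio ≤ 0.9703 := by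
  unfold gridTop ratio; norm_num

theorem log_ratio_sq_ge : 0.4912 ≤ Real.log (ratio ^ 2) := by
  have h := Real.le_log_one_add_of_nonneg (x := 0.28) (by norm_num)
  rw [Real.log_pow]
  have e : (ratio : ℝ) = 1 + 0.28 := by unfold ratio; norm_num
  rw [e]
  push_cast
  norm_num at h ⊢
  linarith

theorem mul_le_log_of_ratio_pow_le {K : ℕ} {y : ℝ} (h : (ratio ^ 2) ^ K ≤ y) :
    K * 0.4912 ≤ Real.log y := by
  have hpos : (0 : ℝ) < (ratio ^ 2) ^ K := by unfold ratio; positivity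
  have h1 := Real.log_le_log hpos h
  rw [Real.log_pow] at h1
  have h2 := mul_le_mul_of_nonneg_left log_ratio_sq_ge (Nat.cast_nonneg (α := ℝ) K)
  linarith

/-- For `φ^IS`, at the two grid points that enclose the optimal rate: the factor
`(K + 1.44) ^ (-1.4)` of the weight is paid for by `1.445 log log (2.041 N)`, as `K` is at most of
the order `log N`. -/
theorem exp_le_pairWeight_IS {L N : ℝ} (hL : 0 ≤ L) (hN : 1 ≤ N) {K : ℕ}
    (hK : K * 0.4912 ≤ Real.log N) :
    1.02 * Real.exp L ≤ 2 * pairWeight 0.4 0.44 K * Real.exp (gridTop ratio *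
      (1.445 * Real.log (Real.log (2.041 * N)) + 1.0325 * (Real.log 4.983 + L))) := by
  have hlog2 := Real.log_two_gt_d9
  have hl : 0.7134 ≤ Real.log 2.041 := by
    have h1 := Real.le_log_one_add_of_nonneg (x := 0.0205) (by norm_num)
    have h2 : Real.log 2.041 = Real.log 2 + Real.log (1 + 0.0205) := by
      rw [← Real.log_mul (by norm_num) (by norm_num)]; norm_num
    rw [h2]; norm_num at h1 hlog2 ⊢; linarith
  set b := Real.log (2.041 * N) with hb
  have hbN : b = Real.log 2.041 + Real.log N := by
    rw [hb, Real.log_mul (by norm_num) (by linarith)]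
  have hKnn : (0 : ℝ) ≤ K := K.cast_nonneg
  have hb1 : 0.4912 * (K + 1.44) ≤ b := by rw [hbN]; linarith
  have hb0 : 0.7 ≤ b := by linarith
  have hbpos : 0 < b := by linarith
  have hlb : -0.5 ≤ Real.log b := by
    refine (log_ge_of_sum_exp_neg (c := 0.5) (y := 0.7) (by norm_num) (by norm_num)
      (by norm_num)).trans (Real.log_le_log (by norm_num) hb0)
  have hl4 : 0 ≤ Real.log 4.983 := Real.log_nonneg (by norm_num)
  have g1 := gridTop_ratio_ge
  have g2 := gridTop_ratio_le
  set G := gridTop ratio with hG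
  have hexp : 1.4 * Real.log b - 0.002 + Real.log 4.983 + L ≤
      G * (1.445 * Real.log b + 1.0325 * (Real.log 4.983 + L)) := by
    have h1 : 0 ≤ (G * 1.0325 - 1) * (Real.log 4.983 + L) :=
      mul_nonneg (by linarith) (by linarith)
    have h2 : 0 ≤ (G * 1.445 - 1.4) * (Real.log b + 0.5) := mul_nonneg (by linarith) (by linarith)
    linarith
  have hrp : Real.exp (1.4 * Real.log b) = b ^ (1.4 : ℝ) := by
    rw [Real.rpow_def_of_pos hbpos, mul_comm]
  have h1 : 0.71 ≤ (0.44 : ℝ) ^ (0.4 : ℝ) := by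
    have := le_rpow_of_pow_le (a := 0.44) (b := 0.71) (by norm_num) (by norm_num) 2 5
      (by norm_num) (by norm_num)
    convert this using 2; norm_num
  have h2 : 0.369 ≤ (0.4912 : ℝ) ^ (1.4 : ℝ) := by
    have := le_rpow_of_pow_le (a := 0.4912) (b := 0.369) (by norm_num) (by norm_num) 7 5
      (by norm_num) (by norm_num)
    convert this using 2; norm_num
  have h3 : (0.4912 : ℝ) ^ (1.4 : ℝ) ≤ (K + 1 + 0.44 : ℝ) ^ (-1 - 0.4 : ℝ) * b ^ (1.4 : ℝ) := by
    have h4 : (0.4912 * (K + 1 + 0.44) : ℝ) ^ (1.4 : ℝ) ≤ b ^ (1.4 : ℝ) :=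
      Real.rpow_le_rpow (by positivity) (by linarith) (by norm_num)
    rw [Real.mul_rpow (by norm_num) (by positivity)] at h4
    have h5 : (K + 1 + 0.44 : ℝ) ^ (-1 - 0.4 : ℝ) * (K + 1 + 0.44 : ℝ) ^ (1.4 : ℝ) = 1 := by
      rw [← Real.rpow_add (by positivity)]; norm_num
    have h6 := mul_le_mul_of_nonneg_left h4
      (show 0 ≤ (K + 1 + 0.44 : ℝ) ^ (-1 - 0.4 : ℝ) by positivity)
    calc _ = 0.4912 ^ (1.4 : ℝ) *
          ((K + 1 + 0.44 : ℝ) ^ (-1 - 0.4 : ℝ) * (K + 1 + 0.44 : ℝ) ^ (1.4 : ℝ)) := by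
            rw [h5, mul_one]
      _ ≤ _ := by linarith
  have h7 : 0.998 ≤ Real.exp (-0.002) := by
    have := Real.add_one_le_exp (-0.002 : ℝ); linarith
  have h8 : b ^ (1.4 : ℝ) * 0.998 * 4.983 * Real.exp L ≤ Real.exp (G * (1.445 * Real.log b
      + 1.0325 * (Real.log 4.983 + L))) := by
    refine le_trans ?_ (Real.exp_le_exp.2 hexp)
    rw [Real.exp_add, Real.exp_add, Real.exp_log (by norm_num), sub_eq_add_neg, Real.exp_add, hrp]
    gcongr
  have hE := Real.exp_pos L
  calc 1.02 * Real.exp L ≤ 2 * 0.4 * 0.71 * 0.369 * (0.998 * 4.983 * Real.exp L) := by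
        nlinarith
    _ ≤ 2 * 0.4 * (0.44 : ℝ) ^ (0.4 : ℝ) * ((K + 1 + 0.44 : ℝ) ^ (-1 - 0.4 : ℝ) * b ^ (1.4 : ℝ)) *
        (0.998 * 4.983 * Real.exp L) := by
        gcongr
        exact h2.trans h3
    _ = 2 * pairWeight 0.4 0.44 K * (b ^ (1.4 : ℝ) * 0.998 * 4.983 * Real.exp L) := by
        unfold pairWeight; ring
    _ ≤ _ := by
        have := pairWeight_pos (s := 0.4) (a := 0.44) (by norm_num) (by norm_num) K
        gcongr

theorem exists_certificate_phiIS {δ : ℝ} (h0 : 0 < δ) (h1 : δ < 1) :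
    ∃ w lam, IsCertificate phiIS δ (1 + 1.02 * (1 / δ - 1)) w lam := by
  set L := Real.log (1 / δ) with hL
  have hLpos : 0 < L := Real.log_pos (by rw [lt_div_iff₀ h0]; linarith)
  have hexpL : Real.exp L = 1 / δ := Real.exp_log (by positivity)
  set x : ℝ → ℝ := fun N =>
    1.445 * Real.log (Real.log (2.041 * N)) + 1.0325 * (Real.log 4.983 + L) with hx
  have hlogδ : Real.log (4.983 / δ) = Real.log 4.983 + L := by
    rw [hL, ← Real.log_mul (by norm_num) (by positivity)]; congr 1; ring
  have hmono : ∀ N : ℝ, 1 ≤ N → x 1 ≤ x N := by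
    intro N hN
    have hp : 0 < Real.log (2.041 * 1) := Real.log_pos (by norm_num)
    have : Real.log (Real.log (2.041 * 1)) ≤ Real.log (Real.log (2.041 * N)) :=
      Real.log_le_log hp (Real.log_le_log (by norm_num) (by linarith))
    simp only [hx]; linarith
  have hx1 : 0 < x 1 := by
    have h2 : -0.4 ≤ Real.log (Real.log (2.041 * 1)) := by
      have h3 : 0.69 ≤ Real.log (2.041 * 1) := by
        have := Real.log_two_gt_d9
        have h4 : Real.log 2 ≤ Real.log (2.041 * 1) :=
          Real.log_le_log (by norm_num) (by norm_num)
        norm_num at this h4 ⊢; linarith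
      exact (log_ge_of_sum_exp_neg (c := 0.4) (y := 0.69) (by norm_num) (by norm_num)
        (by norm_num)).trans (Real.log_le_log (by norm_num) h3)
    have h5 : 0.69 ≤ Real.log 4.983 := by
      have := Real.log_two_gt_d9
      have h4 : Real.log 2 ≤ Real.log 4.983 := Real.log_le_log (by norm_num) (by norm_num)
      norm_num at this h4 ⊢; linarith
    simp only [hx]; linarith
  refine ⟨mixWeight 0.4 0.44, gridRate ratio (x 1), IsCertificate.of_mixSum (by norm_num)
    (by norm_num) (by unfold ratio; norm_num) (fun n => x n) (fun n => ?_) (fun n hn => ?_)⟩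
  · unfold phiIS
    rw [hlogδ]
    congr 2
    simp only [hx]; ring
  · have hn' : (1 : ℝ) ≤ n := by exact_mod_cast hn
    have hxn := hx1.trans_le (hmono n hn')
    have key : ∀ N : ℝ, 1 ≤ N → ∀ K : ℕ, K * 0.4912 ≤ Real.log N →
        ENNReal.ofReal (1 + 1.02 * (1 / δ - 1)) ≤
          ENNReal.ofReal (2 * pairWeight 0.4 0.44 K * Real.exp (gridTop ratio * x N)) := by
      intro N hN K hK
      refine ENNReal.ofReal_le_ofReal ?_
      have := exp_le_pairWeight_IS hLpos.le hN hK
      rw [hexpL] at this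
      simp only [hx]
      linarith
    rcases le_total (x 1 * n) (x n) with h | h
    · refine (key 1 le_rfl 0 (by simp)).trans ?_
      exact pair_zero_le_mixSum (by norm_num) (by norm_num) (by unfold ratio; norm_num)
        hx1.le hn' h
    · obtain ⟨K, hK, hK2⟩ := exists_pair_le_mixSum (s := 0.4) (a := 0.44) (ρ := ratio)
        (by norm_num) (by norm_num) (by unfold ratio; norm_num) hx1.le (by linarith) hxn h
      refine (key n hn' K (mul_le_log_of_ratio_pow_le (hK.trans ?_))).trans hK2
      rw [div_le_iff₀ hxn, mul_comm]
      exact mul_le_mul_of_nonneg_left (hmono n hn') (by linarith)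

/-- The value of the mixture for `φ⁰` in the first rounds. As `δ → 1` the boundary is so low that
all terms of the mixture are close to their weights, so that these have to be summed: the first four
grid points provide the excess over `1`, the others only contribute their weight. -/
theorem le_mixSum_phiZero_of_le {L n x : ℝ} (hL : 0 < L) (hn : 1 ≤ n) (h : 2 * L * n ≤ x) :
    ENNReal.ofReal (1 + 1.02 * (Real.exp L - 1)) ≤
      mixSum 0.5 1 ratio (2 * L) n (√(2 * x * n)) := by
  have hρ : (1 : ℝ) < ratio := by unfold ratio; norm_num
  have hs : (0 : ℝ) < 0.5 := by norm_num
  set z := Real.exp L - 1 with hz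
  have hz0 : 0 ≤ z := by have := Real.add_one_le_exp L; linarith
  set u : ℕ → ℝ := fun k => 2 * gridPt ratio k - gridPt ratio k ^ 2 with hu
  have hw := mixWeight_nonneg hs one_pos
  have hunn : ∀ k, 0 ≤ u k := fun k => by
    have h1 := gridPt_pos hρ k
    have h2 := gridPt_le_one hρ k
    simp only [hu]; nlinarith
  have hu4 : ∀ k ∈ Finset.range 4, 1 ≤ 2 * u k := by
    intro k hk
    have hk' := Finset.mem_range.1 hk
    interval_cases k <;> norm_num [hu, gridPt, gridTop, ratio]
  set c : ℕ → ℝ := fun k => if k ∈ Finset.range 4 then mixWeight 0.5 1 k * (2 * u k * z) else 0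
    with hc
  have hcnn : ∀ k, 0 ≤ c k := by
    intro k
    simp only [hc]
    split_ifs
    · have := hw k; have := hunn k; positivity
    · exact le_rfl
  have hterm : ∀ k, ENNReal.ofReal (mixWeight 0.5 1 k) + ENNReal.ofReal (c k) ≤
      ENNReal.ofReal (mixWeight 0.5 1 k * Real.exp (gridRate ratio (2 * L) k * √(2 * x * n)
        - gridRate ratio (2 * L) k ^ 2 / 2 * n)) := by
    intro k
    rw [← ENNReal.ofReal_add (hw k) (hcnn k)]
    refine ENNReal.ofReal_le_ofReal ?_
    have h1 := gridRate_exponent_ge hρ (by positivity) hn h k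
    have h2 : Real.exp (2 * u k * L) ≤ Real.exp (gridRate ratio (2 * L) k * √(2 * x * n)
        - gridRate ratio (2 * L) k ^ 2 / 2 * n) := Real.exp_le_exp.2 (by
      simp only [hu]; linarith)
    refine le_trans ?_ (mul_le_mul_of_nonneg_left h2 (hw k))
    simp only [hc]
    split_ifs with hk
    · have h3 := one_add_mul_le_exp_mul (L := L) (hu4 k hk)
      have := mul_le_mul_of_nonneg_left h3 (hw k)
      linarith
    · have h3 : 1 ≤ Real.exp (2 * u k * L) := Real.one_le_exp (by have := hunn k; positivity)
      have := mul_le_mul_of_nonneg_left h3 (hw k)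
      linarith
  have hsumc : 1.02 * z ≤ ∑ k ∈ Finset.range 4, c k := by
    have e : ∑ k ∈ Finset.range 4, c k =
        (∑ k ∈ Finset.range 4, mixWeight 0.5 1 k * (2 * u k)) * z := by
      rw [Finset.sum_mul]
      refine Finset.sum_congr rfl fun k hk => ?_
      simp only [hc, if_pos hk]; ring
    rw [e]
    refine mul_le_mul_of_nonneg_right ?_ hz0
    have hr : ∀ y q : ℝ, 0 < y → 0 < q → 1 ≤ q ^ 2 * y → y ^ (-0.5 : ℝ) ≤ q := by
      intro y q hy hq hyq
      have h3 : (q ^ 2)⁻¹ ≤ y := by rwa [inv_le_iff_one_le_mul₀ (by positivity), mul_comm]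
      have h4 := Real.rpow_le_rpow_of_nonpos (z := (-0.5 : ℝ)) (by positivity) h3 (by norm_num)
      refine h4.trans (le_of_eq ?_)
      rw [Real.inv_rpow (by positivity), ← Real.rpow_natCast, ← Real.rpow_mul hq.le,
        ← Real.rpow_neg hq.le]
      norm_num
    have r2 := hr 2 0.7072 (by norm_num) (by norm_num) (by norm_num)
    have r3 := hr 3 0.5774 (by norm_num) (by norm_num) (by norm_num)
    have r4 := hr 4 0.5 (by norm_num) (by norm_num) (by norm_num)
    have r5 := hr 5 0.4473 (by norm_num) (by norm_num) (by norm_num)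
    simp only [Finset.sum_range_succ, Finset.sum_range_zero, mixWeight, hu, gridPt, gridTop, ratio]
    norm_num at r2 r3 r4 r5 ⊢
    linarith
  calc ENNReal.ofReal (1 + 1.02 * z) = 1 + ENNReal.ofReal (1.02 * z) := by
        rw [ENNReal.ofReal_add one_pos.le (by positivity), ENNReal.ofReal_one]
    _ ≤ 1 + ∑ k ∈ Finset.range 4, ENNReal.ofReal (c k) := by
        rw [← ENNReal.ofReal_sum_of_nonneg fun k _ => hcnn k]
        gcongr
    _ ≤ 1 + ∑' k, ENNReal.ofReal (c k) := by
        gcongr; exact ENNReal.sum_le_tsum _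
    _ = ∑' k, (ENNReal.ofReal (mixWeight 0.5 1 k) + ENNReal.ofReal (c k)) := by
        rw [ENNReal.tsum_add, tsum_ofReal_mixWeight hs one_pos]
    _ ≤ _ := ENNReal.tsum_le_tsum hterm

/-- For `φ⁰`, at the two grid points that enclose the optimal rate. Here `q = log₂ (2 n)`. For small
`L = log (1 / δ)` the term `log (1 + log q / L)` in the bound on `K` is needed, as then `e ^ L`
cannot pay for the constants. -/
theorem exp_le_pairWeight_phiZero {L q : ℝ} (hL : 0 < L) (hq : 2 ≤ q) {K : ℕ}
    (hK : K * 0.4912 ≤ (q - 1) * Real.log 2 - Real.log (1 + Real.log q / L)) :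
    1 + 1.02 * (Real.exp L - 1) ≤ 2 * pairWeight 0.5 1 K *
      Real.exp (gridTop ratio * (2 * (Real.log q + L))) := by
  have hl2 := Real.log_two_gt_d9
  have hl2' := Real.log_two_lt_d9
  have hlq : Real.log 2 ≤ Real.log q := Real.log_le_log (by norm_num) hq
  have hlq0 : 0 < Real.log q := by linarith
  have hq0 : 0 < q := by linarith
  have hKnn : (0 : ℝ) ≤ K := K.cast_nonneg
  set p : ℝ := 97 / 75 with hp
  -- A linear lower bound on `q ^ (1.94 / 1.5)`, from Bernoulli's inequality at `q = 2`.
  have hqp : 1.584 * q - 0.72 ≤ q ^ p := by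
    have h1 := one_add_mul_self_le_rpow_one_add (s := q / 2 - 1) (p := p) (by linarith)
      (by norm_num [hp])
    rw [add_sub_cancel, Real.div_rpow hq0.le (by norm_num)] at h1
    have h2 : 2.45 ≤ (2 : ℝ) ^ p := by
      have := le_rpow_of_pow_le (a := 2) (b := 2.45) (by norm_num) (by norm_num) 97 75
        (by norm_num) (by norm_num)
      rw [hp]; exact_mod_cast this
    rw [le_div_iff₀ (by positivity)] at h1
    have h3 : 0 ≤ 1 + p * (q / 2 - 1) := by
      have : 0 ≤ p * (q / 2 - 1) := mul_nonneg (by norm_num [hp]) (by linarith)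
      linarith
    have h4 := mul_le_mul_of_nonneg_left h2 h3
    rw [hp] at h4 h1 ⊢
    linarith
  have hlogp : Real.log (q ^ p) = p * Real.log q := Real.log_rpow hq0 p
  have hKpos : (0 : ℝ) < K + 2 := by linarith
  -- the comparison of `K + 2` with `q ^ p`
  have hmain : Real.log (K + 2) ≤ p * Real.log q + 0.6 * L := by
    rcases le_total L 1 with h | h
    · have h1 : 0.514 ≤ Real.log (1 + Real.log q / L) := by
        have h2 : Real.log 2 ≤ Real.log q / L := by
          rw [le_div_iff₀ hL]; nlinarith
        have h3 := Real.le_log_one_add_of_nonneg (x := Real.log 2) (by linarith)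
        have h4 : 0.514 ≤ 2 * Real.log 2 / (Real.log 2 + 2) := by
          rw [le_div_iff₀ (by linarith)]; linarith
        exact h4.trans (h3.trans (Real.log_le_log (by linarith) (by linarith)))
      have h5 : (K : ℝ) + 2 ≤ 1.584 * q - 0.72 := by nlinarith
      have h6 := Real.log_le_log hKpos (h5.trans hqp)
      rw [hlogp] at h6
      exact h6.trans (le_add_of_nonneg_right (by positivity))
    · have h1 : 0 ≤ Real.log (1 + Real.log q / L) := by
        refine Real.log_nonneg ?_
        have : 0 ≤ Real.log q / L := by positivity
        linarith
      have h2 : 1.8 ≤ Real.exp (0.6 * L) := by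
        refine le_trans ?_ (Real.exp_le_exp.2 (show 0.6 ≤ 0.6 * L by linarith))
        exact le_trans (by norm_num) (exp_ge_sum (x := 0.6) (by norm_num))
      have h5 : (K : ℝ) + 2 ≤ q ^ p * Real.exp (0.6 * L) := by
        have h6 : (K : ℝ) + 2 ≤ (1.584 * q - 0.72) * 1.8 := by nlinarith
        refine h6.trans (mul_le_mul hqp h2 (by norm_num) (by positivity))
      have h6 := Real.log_le_log hKpos h5
      rw [Real.log_mul (by positivity) (by positivity), hlogp, Real.log_exp] at h6
      exact h6
  have hpw : 2 * pairWeight 0.5 1 K = Real.exp (-1.5 * Real.log (K + 2)) := by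
    unfold pairWeight
    rw [show (K : ℝ) + 1 + 1 = K + 2 by ring, Real.one_rpow, Real.rpow_def_of_pos hKpos,
      show Real.log ((K : ℝ) + 2) * (-1 - 0.5) = -1.5 * Real.log (K + 2) by ring]
    ring
  rw [hpw, ← Real.exp_add]
  have hB := one_add_mul_le_exp_mul (p := 1.02) (L := L) (by norm_num)
  refine hB.trans (Real.exp_le_exp.2 ?_)
  have hG := mul_le_mul_of_nonneg_right gridTop_ratio_ge
    (show 0 ≤ 2 * (Real.log q + L) by linarith)
  rw [hp] at hmain
  linarith

theorem exists_certificate_phiZero {δ : ℝ} (h0 : 0 < δ) (h1 : δ < 1) :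
    ∃ w lam, IsCertificate phiZero δ (1 + 1.02 * (1 / δ - 1)) w lam := by
  set L := Real.log (1 / δ) with hL
  have hLpos : 0 < L := Real.log_pos (by rw [lt_div_iff₀ h0]; linarith)
  have hexpL : Real.exp L = 1 / δ := Real.exp_log (by positivity)
  have hl2 := Real.log_two_gt_d9
  have hρ : (1 : ℝ) < ratio := by unfold ratio; norm_num
  set q : ℝ → ℝ := fun n => Real.logb 2 (2 * n) with hq
  have hq1 : ∀ n : ℕ, 1 ≤ n → 1 ≤ q n := by
    intro n hn
    have hn' : (1 : ℝ) ≤ n := by exact_mod_cast hn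
    simp only [hq]
    rw [Real.le_logb_iff_rpow_le (by norm_num) (by linarith)]
    simp; linarith
  rw [← hexpL]
  refine ⟨mixWeight 0.5 1, gridRate ratio (2 * L), IsCertificate.of_mixSum (by norm_num)
    one_pos hρ (fun n => if n = 0 then 0 else 2 * (Real.log (q n) + L)) (fun n => ?_)
    (fun n hn => ?_)⟩
  · unfold phiZero
    rcases Nat.eq_zero_or_pos n with hn | hn
    · subst hn; simp
    · have h2 := hq1 n hn
      rw [if_neg (by omega), div_eq_mul_one_div (Real.logb 2 (2 * (n : ℝ))) δ,
        Real.log_mul (by simp only [hq] at h2; linarith) (by positivity)]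
      congr 2
      simp only [hq]; ring
  · rw [if_neg (by omega)]
    have hn' : (1 : ℝ) ≤ n := by exact_mod_cast hn
    have hlq : 0 ≤ Real.log (q n) := Real.log_nonneg (hq1 n hn)
    rcases le_or_gt (2 * L * n) (2 * (Real.log (q n) + L)) with h | h
    · exact le_mixSum_phiZero_of_le hLpos hn' h
    · have hx : 0 < 2 * (Real.log (q n) + L) := by linarith
      obtain ⟨K, hK, hK2⟩ := exists_pair_le_mixSum (s := 0.5) (a := 1) (ρ := ratio)
        (x₁ := 2 * L) (n := n) (by norm_num) one_pos hρ (by linarith) (by linarith) hx h.le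
      refine le_trans (ENNReal.ofReal_le_ofReal ?_) hK2
      have hn2 : 2 ≤ n := by
        by_contra hcon
        have : n = 1 := by omega
        subst this
        simp only [Nat.cast_one] at h hlq
        linarith
      have hn2' : (2 : ℝ) ≤ n := by exact_mod_cast hn2
      refine exp_le_pairWeight_phiZero hLpos ?_ ?_
      · simp only [hq]
        rw [Real.le_logb_iff_rpow_le (by norm_num) (by linarith)]
        norm_num; linarith
      · refine (mul_le_log_of_ratio_pow_le hK).trans (le_of_eq ?_)
        have e1 : 2 * L * n / (2 * (Real.log (q n) + L)) = n / (1 + Real.log (q n) / L) := by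
          field_simp
          ring
        have e2 : (q n - 1) * Real.log 2 = Real.log n := by
          simp only [hq, Real.logb]
          rw [Real.log_mul (by norm_num) (by linarith)]
          field_simp
          ring
        rw [e1, e2, Real.log_div (by linarith) (by positivity)]

theorem one_sub_gridTop (z : ℝ) : 1 - gridTop (1 + z) = z ^ 2 / (1 + (1 + z) ^ 2) := by
  unfold gridTop
  field_simp
  ring

theorem log_ge_of_ge {L : ℝ} (hL : 2.3 ≤ L) : 0.83 ≤ Real.log L := by
  have h1 := Real.le_log_one_add_of_nonneg (x := 0.15) (by norm_num)
  have h2 := Real.log_two_gt_d9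
  have h3 : Real.log 2.3 = Real.log 2 + Real.log (1 + 0.15) := by
    rw [← Real.log_mul (by norm_num) (by norm_num)]; norm_num
  have h4 : Real.log 2.3 ≤ Real.log L := Real.log_le_log (by norm_num) hL
  rw [h3] at h4
  norm_num at h1 h2 h4 ⊢
  linarith

/-- The loss of the grid with ratio `1 + 0.425 / √L` is of the order `1 / L`, so that it costs only
a constant factor at the level `L = log (1 / δ)`. -/
theorem one_sub_gridTop_le {L : ℝ} (hL : 0 < L) :
    1 - gridTop (1 + 0.425 / √L) ≤ 0.0904 / L := by
  have hg : 0 < √L := Real.sqrt_pos.2 hL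
  rw [one_sub_gridTop, div_pow, Real.sq_sqrt hL.le, div_le_iff₀ (by positivity), div_mul_eq_mul_div,
    div_le_div_iff_of_pos_right hL]
  have : 0 < 0.425 / √L := by positivity
  nlinarith

/-- For `φ^JJ`, in the first rounds, the first grid point suffices. -/
theorem exp_le_first_weight_phiJJ {L : ℝ} (hL : 2.3 ≤ L) :
    1.02 * Real.exp L ≤ mixWeight 0.45 0.2 0 * Real.exp
      ((L + 3 * Real.log L + 1.5 * Real.log (Real.log (Real.exp 1 * 1 / 2))) *
        (2 * gridTop (1 + 0.425 / √L) - gridTop (1 + 0.425 / √L) ^ 2)) := by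
  have hL0 : 0 < L := by linarith
  have hlogL := log_ge_of_ge hL
  have hlogL2 : Real.log L ≤ L := (Real.log_le_sub_one_of_pos hL0).trans (by linarith)
  set l := Real.log (Real.log (Real.exp 1 * 1 / 2)) with hl
  have hb : Real.log (Real.exp 1 * 1 / 2) = 1 - Real.log 2 := by
    rw [mul_one, Real.log_div (Real.exp_pos 1).ne' two_ne_zero, Real.log_exp]
  have hb1 : 0.3068 ≤ 1 - Real.log 2 := by have := Real.log_two_lt_d9; linarith
  have hb2 : 1 - Real.log 2 ≤ 1 := by have := Real.log_two_gt_d9; linarith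
  have hl1 : -1.19 ≤ l := by
    rw [hl, hb]
    exact (log_ge_of_sum_exp_neg (c := 1.19) (y := 0.3068) (by norm_num) (by norm_num)
      (by norm_num)).trans (Real.log_le_log (by norm_num) hb1)
  have hl2 : l ≤ 0 := by
    rw [hl, hb]; exact Real.log_nonpos (by linarith) hb2
  set G := gridTop (1 + 0.425 / √L) with hG
  have hG1 : 1 - G ≤ 0.0904 / L := one_sub_gridTop_le hL0
  have hG2 : 0 ≤ 1 - G := sub_nonneg.2 gridTop_le_one
  have hX : L + 3 * Real.log L + 1.5 * l ≤ 4 * L := by linarith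
  have hloss : (L + 3 * Real.log L + 1.5 * l) * (1 - G) ^ 2 ≤ 0.0143 := by
    calc _ ≤ 4 * L * (0.0904 / L) ^ 2 := by gcongr
      _ = 0.03268864 / L := by field_simp; norm_num
      _ ≤ 0.0143 := by rw [div_le_iff₀ hL0]; linarith
  have hw : 0.55 ≤ mixWeight 0.45 0.2 0 := by
    have h6 : 2.2223 ≤ (6 : ℝ) ^ (0.45 : ℝ) := by
      have := le_rpow_of_pow_le (a := 6) (b := 2.2223) (by norm_num) (by norm_num) 9 20
        (by norm_num) (by norm_num)
      convert this using 2; norm_num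
    unfold mixWeight
    have e1 : (0.2 : ℝ) ^ (0.45 : ℝ) * (0.2 : ℝ) ^ (-0.45 : ℝ) = 1 := by
      rw [← Real.rpow_add (by norm_num)]; norm_num
    have e2 : (0.2 : ℝ) ^ (0.45 : ℝ) * (1.2 : ℝ) ^ (-0.45 : ℝ) = ((6 : ℝ) ^ (0.45 : ℝ))⁻¹ := by
      rw [Real.rpow_neg (by norm_num), ← div_eq_mul_inv,
        ← Real.div_rpow (by norm_num) (by norm_num), ← Real.inv_rpow (by norm_num)]
      norm_num
    have e3 : ((6 : ℝ) ^ (0.45 : ℝ))⁻¹ ≤ 0.45 := by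
      rw [inv_le_iff_one_le_mul₀ (by positivity)]; linarith
    have e4 : ((0 : ℕ) : ℝ) + 0.2 = 0.2 := by norm_num
    have e5 : ((0 : ℕ) : ℝ) + 1 + 0.2 = 1.2 := by norm_num
    rw [e4, e5, mul_sub, e1, e2]
    linarith
  have hexp : L + 0.69 ≤ (L + 3 * Real.log L + 1.5 * l) * (2 * G - G ^ 2) := by
    have : (L + 3 * Real.log L + 1.5 * l) * (2 * G - G ^ 2) = (L + 3 * Real.log L + 1.5 * l)
      - (L + 3 * Real.log L + 1.5 * l) * (1 - G) ^ 2 := by ring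
    rw [this]; linarith
  have h69 : 1.9 ≤ Real.exp 0.69 := le_trans (by norm_num) (exp_ge_sum (x := 0.69) (by norm_num))
  have hE := Real.exp_pos L
  calc 1.02 * Real.exp L ≤ 0.55 * (Real.exp L * 1.9) := by linarith
    _ ≤ 0.55 * Real.exp (L + 0.69) := by rw [Real.exp_add]; gcongr
    _ ≤ _ := mul_le_mul hw (Real.exp_le_exp.2 hexp) (Real.exp_pos _).le (by linarith)

/-- For `φ^JJ`, at the two grid points that enclose the optimal rate. Here `β = log (e n / 2)`. The
grid is fine, with `K` up to the order `√L β`, and the weight lost by this is paid for by the term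
`3 log L` of the boundary. -/
theorem exp_le_pairWeight_phiJJ {L β : ℝ} (hL : 2.3 ≤ L) (hβ : 1 ≤ β) {K : ℕ}
    (hK : K * Real.log ((1 + 0.425 / √L) ^ 2) ≤ β - 0.3068) :
    1.02 * Real.exp L ≤ 2 * pairWeight 0.45 0.2 K * Real.exp
      (gridTop (1 + 0.425 / √L) * (L + 3 * Real.log L + 1.5 * Real.log β)) := by
  have hL0 : 0 < L := by linarith
  have hg : 0 < √L := Real.sqrt_pos.2 hL0
  have hg1 : 1.516 ≤ √L := Real.le_sqrt_of_sq_le (by norm_num; linarith)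
  have hlogL := log_ge_of_ge hL
  have hβ0 : 0 < β := by linarith
  have hlogβ : 0 ≤ Real.log β := Real.log_nonneg hβ
  have hKnn : (0 : ℝ) ≤ K := K.cast_nonneg
  set z := 0.425 / √L with hz
  have hz0 : 0 < z := by positivity
  have hz1 : z ≤ 0.2804 := by
    rw [hz, div_le_iff₀ hg]; linarith
  have hlogρ : 0.7454 / √L ≤ Real.log ((1 + z) ^ 2) := by
    rw [Real.log_pow]
    have h1 := Real.le_log_one_add_of_nonneg hz0.le
    have h2 : 0.3727 / √L ≤ 2 * z / (z + 2) := by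
      rw [le_div_iff₀ (by linarith)]
      have e : 2 * z = 0.85 / √L := by rw [hz]; ring
      rw [e, div_mul_eq_mul_div, div_le_div_iff_of_pos_right hg]
      linarith
    push_cast
    have e : 0.7454 / √L = 2 * (0.3727 / √L) := by ring
    rw [e]; linarith
  have hK1 : (K : ℝ) + 1 + 0.2 ≤ 1.7216 * (√L * β) := by
    have h1 : (K : ℝ) * (0.7454 / √L) ≤ β - 0.3068 :=
      (mul_le_mul_of_nonneg_left hlogρ hKnn).trans hK
    rw [mul_div_assoc', div_le_iff₀ hg] at h1
    nlinarith [mul_nonneg (sub_nonneg.2 hg1) (sub_nonneg.2 hβ)]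
  set G := gridTop (1 + z) with hG
  have hG1 : 1 - G ≤ 0.0904 / L := one_sub_gridTop_le hL0
  have hG2 : 0 ≤ 1 - G := sub_nonneg.2 gridTop_le_one
  have hG3 : 1.45 ≤ 1.5 * G := by
    have : 1 - G ≤ 1 / 30 := by
      rw [hG, one_sub_gridTop, div_le_iff₀ (by positivity)]
      nlinarith
    linarith
  have hlogL2 : Real.log L ≤ 0.368 * L := by
    have h1 := Real.log_le_sub_one_of_pos (show 0 < L / Real.exp 1 by positivity)
    rw [Real.log_div hL0.ne' (Real.exp_pos 1).ne', Real.log_exp] at h1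
    have h2 : L / Real.exp 1 ≤ 0.368 * L := by
      rw [div_le_iff₀ (Real.exp_pos 1)]
      have := Real.exp_one_gt_d9
      nlinarith
    linarith
  have hexp : L + 3 * Real.log L - 0.1905 + 1.45 * Real.log β ≤
      G * (L + 3 * Real.log L + 1.5 * Real.log β) := by
    have h1 : (1 - G) * (L + 3 * Real.log L) ≤ 0.1905 := by
      calc _ ≤ 0.0904 / L * (2.104 * L) := by
            refine mul_le_mul hG1 (by linarith) (by linarith) (by positivity)
        _ = 0.1902016 := by field_simp; norm_num
        _ ≤ _ := by norm_num
    have h2 : 0 ≤ (1.5 * G - 1.45) * Real.log β := mul_nonneg (by linarith) hlogβ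
    linarith
  have hpw : 0.1944 * Real.exp (-1.45 * (Real.log L / 2 + Real.log β)) ≤
      2 * pairWeight 0.45 0.2 K := by
    have h1 : 0.48 ≤ (0.2 : ℝ) ^ (0.45 : ℝ) := by
      have := le_rpow_of_pow_le (a := 0.2) (b := 0.48) (by norm_num) (by norm_num) 9 20
        (by norm_num) (by norm_num)
      convert this using 2; norm_num
    have h2 : 0.45 ≤ (1.7216 : ℝ) ^ (-1 - 0.45 : ℝ) := by
      have := le_rpow_of_pow_le (a := 1.7216⁻¹) (b := 0.45) (by norm_num) (by norm_num) 29 20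
        (by norm_num) (by norm_num)
      rw [Real.inv_rpow (by norm_num), ← Real.rpow_neg (by norm_num)] at this
      convert this using 2; norm_num
    have h3 : Real.exp (-1.45 * (Real.log L / 2 + Real.log β)) = (√L * β) ^ (-1 - 0.45 : ℝ) := by
      rw [Real.rpow_def_of_pos (by positivity), Real.log_mul hg.ne' hβ0.ne', Real.log_sqrt hL0.le]
      congr 1; ring
    have h4 : (1.7216 : ℝ) ^ (-1 - 0.45 : ℝ) * (√L * β) ^ (-1 - 0.45 : ℝ) ≤
        ((K : ℝ) + 1 + 0.2) ^ (-1 - 0.45 : ℝ) := by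
      rw [← Real.mul_rpow (by norm_num) (by positivity)]
      exact Real.rpow_le_rpow_of_nonpos (by positivity) hK1 (by norm_num)
    rw [h3]
    unfold pairWeight
    calc 0.1944 * (√L * β) ^ (-1 - 0.45 : ℝ)
        = 2 * (0.45 * 0.48 * (0.45 * (√L * β) ^ (-1 - 0.45 : ℝ))) := by ring
      _ ≤ 2 * (0.45 * 0.2 ^ (0.45 : ℝ) *
          (1.7216 ^ (-1 - 0.45 : ℝ) * (√L * β) ^ (-1 - 0.45 : ℝ))) := by gcongr
      _ ≤ _ := by gcongr
  have h17 : 5.4 ≤ Real.exp 1.69 := le_trans (by norm_num) (exp_ge_sum (x := 1.69) (by norm_num))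
  have hE := Real.exp_pos L
  calc 1.02 * Real.exp L ≤ 0.1944 * (5.4 * Real.exp L) := by linarith
    _ ≤ 0.1944 * (Real.exp 1.69 * Real.exp L) := by gcongr
    _ ≤ 0.1944 * Real.exp (-1.45 * (Real.log L / 2 + Real.log β)
          + (L + 3 * Real.log L - 0.1905 + 1.45 * Real.log β)) := by
        rw [← Real.exp_add]
        exact mul_le_mul_of_nonneg_left (Real.exp_le_exp.2 (by linarith)) (by norm_num)
    _ ≤ 2 * pairWeight 0.45 0.2 K * Real.exp (G * (L + 3 * Real.log L + 1.5 * Real.log β)) := by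
        rw [Real.exp_add, ← mul_assoc]
        exact mul_le_mul hpw (Real.exp_le_exp.2 hexp) (Real.exp_pos _).le
          (by have := pairWeight_pos (s := 0.45) (a := 0.2) (by norm_num) (by norm_num) K
              linarith)

theorem exists_certificate_phiJJ {δ : ℝ} (h0 : 0 < δ) (h1 : δ ≤ 0.1) :
    ∃ w lam, IsCertificate phiJJ δ (1 + 1.02 * (1 / δ - 1)) w lam := by
  set L := Real.log (1 / δ) with hL
  have hL1 : 2.3 ≤ L := by
    rw [hL, Real.le_log_iff_exp_le (by positivity)]
    have h2 : (10 : ℝ) ≤ 1 / δ := by rw [le_div_iff₀ h0]; linarith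
    refine le_trans ?_ h2
    have h3 : Real.exp 2.3 ^ 10 ≤ 10 ^ 10 := by
      rw [← Real.exp_nat_mul]
      have h4 : Real.exp (((10 : ℕ) : ℝ) * 2.3) = Real.exp 1 ^ 23 := by
        rw [← Real.exp_nat_mul]; norm_num
      rw [h4]
      calc Real.exp 1 ^ 23 ≤ 2.7182818286 ^ 23 :=
            pow_le_pow_left₀ (Real.exp_pos 1).le Real.exp_one_lt_d9.le 23
        _ ≤ _ := by norm_num
    exact le_of_pow_le_pow_left₀ (by norm_num) (by norm_num) h3
  have hL0 : 0 < L := by linarith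
  have hexpL : Real.exp L = 1 / δ := Real.exp_log (by positivity)
  have hg : 0 < √L := Real.sqrt_pos.2 hL0
  have hρ : 1 < 1 + 0.425 / √L := by
    have : 0 < 0.425 / √L := by positivity
    linarith
  set x : ℝ → ℝ := fun n =>
    L + 3 * Real.log L + 1.5 * Real.log (Real.log (Real.exp 1 * n / 2)) with hx
  have hlogL := log_ge_of_ge hL1
  have hl2 := Real.log_two_gt_d9
  have hl2' := Real.log_two_lt_d9
  have hlogn : ∀ n : ℝ, 1 ≤ n → Real.log (Real.exp 1 * n / 2) = 1 + Real.log n - Real.log 2 := by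
    intro n hn
    rw [Real.log_div (by positivity) two_ne_zero, Real.log_mul (Real.exp_pos 1).ne' (by linarith),
      Real.log_exp]
  have hmono : ∀ n : ℝ, 1 ≤ n → x 1 ≤ x n := by
    intro n hn
    have h3 : 0 ≤ Real.log n := Real.log_nonneg hn
    have : Real.log (Real.log (Real.exp 1 * 1 / 2)) ≤ Real.log (Real.log (Real.exp 1 * n / 2)) := by
      rw [hlogn 1 le_rfl, hlogn n hn]
      exact Real.log_le_log (by rw [Real.log_one]; linarith) (by rw [Real.log_one]; linarith)
    simp only [hx]; linarith
  have hx1 : 0 < x 1 := by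
    have : -1.19 ≤ Real.log (Real.log (Real.exp 1 * 1 / 2)) := by
      rw [hlogn 1 le_rfl, Real.log_one]
      exact (log_ge_of_sum_exp_neg (c := 1.19) (y := 0.3068) (by norm_num) (by norm_num)
        (by norm_num)).trans (Real.log_le_log (by norm_num) (by linarith))
    simp only [hx]; linarith
  refine ⟨mixWeight 0.45 0.2, gridRate (1 + 0.425 / √L) (x 1), IsCertificate.of_mixSum
    (by norm_num) (by norm_num) hρ (fun n => x n) (fun n => ?_) (fun n hn => ?_)⟩
  · unfold phiJJ
    congr 2
    simp only [hx]; ring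
  · have hn' : (1 : ℝ) ≤ n := by exact_mod_cast hn
    have hxn := hx1.trans_le (hmono n hn')
    have hκ : 1 + 1.02 * (1 / δ - 1) ≤ 1.02 * Real.exp L := by rw [hexpL]; linarith
    rcases le_or_gt (x 1 * n) (x n) with h | h
    · have h2 := gridRate_exponent_ge hρ hx1.le hn' h 0
      refine le_trans (ENNReal.ofReal_le_ofReal ?_) (ENNReal.le_tsum 0)
      refine (hκ.trans (exp_le_first_weight_phiJJ hL1)).trans ?_
      refine mul_le_mul_of_nonneg_left (Real.exp_le_exp.2 (le_trans (le_of_eq ?_) h2))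
        (mixWeight_nonneg (by norm_num) (by norm_num) 0)
      simp [hx, gridPt]
    · have hn2 : 2 ≤ n := by
        by_contra hcon
        have : n = 1 := by omega
        subst this
        simp at h
      have hn2' : (2 : ℝ) ≤ n := by exact_mod_cast hn2
      obtain ⟨K, hK, hK2⟩ := exists_pair_le_mixSum (s := 0.45) (a := 0.2)
        (by norm_num) (by norm_num) hρ hx1.le (by linarith) hxn h.le
      refine le_trans (ENNReal.ofReal_le_ofReal ?_) hK2
      refine hκ.trans (exp_le_pairWeight_phiJJ hL1 ?_ ?_)
      · rw [hlogn n hn']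
        have := Real.log_le_log (by norm_num) hn2'
        linarith
      · rw [hlogn n hn', ← Real.log_pow]
        have h3 : ((1 + 0.425 / √L) ^ 2) ^ K ≤ (n : ℝ) := by
          refine hK.trans ?_
          rw [div_le_iff₀ hxn, mul_comm]
          exact mul_le_mul_of_nonneg_left (hmono n hn') (by linarith)
        have h4 := Real.log_le_log (by positivity) h3
        linarith

/-- The excess of `κ` over `1 / δ` by the factor `1.02` in `1 / δ - 1` leaves room for the failure
probability `δ / 51` of the other arms. -/
theorem exists_certificate {φ : ℕ → ℝ → ℝ} {δ : ℝ} (hφ : IsBoundary φ δ) (h0 : 0 < δ)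
    (h1 : δ < 1) : ∃ w lam, IsCertificate φ δ (1 + 1.02 * (1 / δ - 1)) w lam := by
  rcases hφ with rfl | rfl | ⟨rfl, h⟩
  · exact exists_certificate_phiZero h0 h1
  · exact exists_certificate_phiIS h0 h1
  · exact exists_certificate_phiJJ h0 h

/-! ### Sample counts and rejection sets along a path -/

section Path

variable {k : ℕ} {A : ℕ → Finset (Fin k)} {x : Fin k → ℕ → ℝ} {φ : ℕ → ℝ → ℝ} {δ μ₀ : ℝ}

theorem numSamples_zero (A : ℕ → Finset (Fin k)) (i : Fin k) : numSamples A i 0 = 0 := by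
  simp [numSamples]

theorem numSamples_succ (A : ℕ → Finset (Fin k)) (i : Fin k) (t : ℕ) :
    numSamples A i (t + 1) = numSamples A i t + if i ∈ A t then 1 else 0 := by
  unfold numSamples
  rw [Finset.card_eq_sum_ones, Finset.card_eq_sum_ones]
  exact sum_filter_range_succ A i (fun _ => 1) t

theorem numSamples_mono (A : ℕ → Finset (Fin k)) (i : Fin k) : Monotone (numSamples A i) :=
  monotone_nat_of_le_succ fun t => by rw [numSamples_succ]; omega

/-- The round in which arm `j` is sampled for the last time before time `T`. -/
theorem exists_last_sample {j : Fin k} {T n : ℕ} (h : numSamples A j T = n + 1) :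
    ∃ t < T, j ∈ A t ∧ numSamples A j t = n := by
  induction T with
  | zero => rw [numSamples_zero] at h; omega
  | succ T ih =>
    rw [numSamples_succ] at h
    by_cases hj : j ∈ A T
    · rw [if_pos hj] at h
      exact ⟨T, T.lt_succ_self, hj, by omega⟩
    · rw [if_neg hj] at h
      obtain ⟨t, ht, h2⟩ := ih h
      exact ⟨t, ht.trans T.lt_succ_self, h2⟩

theorem dmE_eq (t : ℕ) (i : Fin k) :
    dmE μ₀ A x i t = ∑' l, dmWeight l * Real.exp (expStat A x i μ₀ (dmLam l) t) := rfl

theorem dmE_succ_of_notMem {i : Fin k} {t : ℕ} (h : i ∉ A t) :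
    dmE μ₀ A x i (t + 1) = dmE μ₀ A x i t := by
  simp only [dmE_eq, expStat_succ_of_notMem x _ _ h]

/-- A sampled arm is not rejected, so the evidence of the rejected arms does not change. -/
theorem rejSet_mono (hδ : 0 < δ) (h : IsUCB φ δ μ₀ A x) : Monotone (rejSet δ μ₀ A x) := by
  refine monotone_nat_of_le_succ fun t => ?_
  refine subset_eBH _ _ _ fun i hi => ?_
  have hself := eBH_selfConsistent δ hδ (fun i => dmE μ₀ A x i t) i hi
  have hnot : i ∉ A t := by
    by_cases hR : rejSet δ μ₀ A x t = Finset.univ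
    · rw [(h t).1 hR]; simp
    · obtain ⟨j, hj, hA, -⟩ := (h t).2 hR
      rw [hA, Finset.mem_singleton]
      rintro rfl
      exact hj hi
  simp only [dmE_succ_of_notMem hnot]
  exact hself

theorem sum_numSamples (h : IsUCB φ δ μ₀ A x) {T : ℕ}
    (hT : ∀ t < T, rejSet δ μ₀ A x t ≠ Finset.univ) : ∑ j, numSamples A j T = T := by
  induction T with
  | zero => simp [numSamples_zero]
  | succ T ih =>
    obtain ⟨i, -, hA, -⟩ := (h T).2 (hT T T.lt_succ_self)
    simp only [numSamples_succ, Finset.sum_add_distrib, hA, Finset.mem_singleton]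
    rw [ih fun t ht => hT t (ht.trans T.lt_succ_self)]
    simp

/-! ### Growth of the evidence -/

theorem dmWeight_pos (l : ℕ) : 0 < dmWeight l := by
  unfold dmWeight
  have h1 : 0 < Real.exp 1 - 1 := by have := Real.add_one_lt_exp one_ne_zero; linarith
  positivity

theorem dmLam_pos (l : ℕ) : 0 < dmLam l := by unfold dmLam; positivity

theorem dmLam_le_one (l : ℕ) : dmLam l ≤ 1 := by
  unfold dmLam
  rw [div_le_one (Real.exp_pos _)]
  exact Real.one_le_exp (by positivity)

/-- Comparison of the weights with a telescoping series after the first term. -/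
theorem sum_dmWeight_le (n : ℕ) : ∑ l ∈ Finset.range n, dmWeight l ≤ 1 := by
  have h3 := Real.exp_one_lt_d9
  have hE := Real.exp_pos 1
  set C := 2 * (Real.exp 1 - 1) / Real.exp 1 with hC
  have hC0 : 0 ≤ C := by
    have := Real.add_one_lt_exp one_ne_zero
    exact div_nonneg (by linarith) hE.le
  have hC1 : C * (3 / 4) ≤ 1 := by
    rw [hC, div_mul_eq_mul_div, div_le_one hE]; linarith
  have key : ∀ n : ℕ, ∑ l ∈ Finset.range (n + 1), dmWeight l ≤ C * (3 / 4 - 1 / ((n : ℝ) + 2)) := by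
    intro n
    have e : ∀ l, dmWeight l = C * (1 / ((l : ℝ) + 2) ^ 2) := by
      intro l; unfold dmWeight; rw [hC]; field_simp
    induction n with
    | zero => simp only [Finset.sum_range_succ, Finset.sum_range_zero, e]; norm_num
    | succ n ih =>
      rw [Finset.sum_range_succ, e]
      have : 1 / (((n + 1 : ℕ) : ℝ) + 2) ^ 2 ≤ 1 / ((n : ℝ) + 2) - 1 / (((n + 1 : ℕ) : ℝ) + 2) := by
        push_cast
        rw [div_sub_div _ _ (by positivity) (by positivity), div_le_div_iff₀ (by positivity)
          (by positivity)]
        have : (0 : ℝ) ≤ n := n.cast_nonneg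
        nlinarith
      have := mul_le_mul_of_nonneg_left this hC0
      linarith
  cases n with
  | zero => simp
  | succ n =>
    refine (key n).trans (le_trans ?_ hC1)
    have : 0 ≤ 1 / ((n : ℝ) + 2) := by positivity
    exact mul_le_mul_of_nonneg_left (by linarith) hC0

theorem summable_dmWeight : Summable dmWeight :=
  summable_of_sum_range_le (fun l => (dmWeight_pos l).le) sum_dmWeight_le

theorem summable_dmE (i : Fin k) (t : ℕ) :
    Summable fun l => dmWeight l * Real.exp (expStat A x i μ₀ (dmLam l) t) := by
  set S := ∑ s ∈ (Finset.range t).filter (fun s => i ∈ A s), (x i s - μ₀) with hS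
  refine Summable.of_nonneg_of_le (fun l => mul_nonneg (dmWeight_pos l).le (Real.exp_pos _).le)
    (fun l => ?_) (summable_dmWeight.mul_right (Real.exp |S|))
  refine mul_le_mul_of_nonneg_left (Real.exp_le_exp.2 ?_) (dmWeight_pos l).le
  rw [expStat_eq]
  have h1 : dmLam l * S ≤ |S| := by
    calc dmLam l * S ≤ dmLam l * |S| := mul_le_mul_of_nonneg_left (le_abs_self S) (dmLam_pos l).le
      _ ≤ 1 * |S| := mul_le_mul_of_nonneg_right (dmLam_le_one l) (abs_nonneg S)
      _ = |S| := one_mul _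
  have h2 : 0 ≤ dmLam l ^ 2 / 2 * (numSamples A i t : ℝ) := by positivity
  linarith

theorem le_dmE (i : Fin k) (t l : ℕ) :
    dmWeight l * Real.exp (expStat A x i μ₀ (dmLam l) t) ≤ dmE μ₀ A x i t := by
  rw [dmE_eq]
  exact (summable_dmE i t).le_tsum l fun l _ => mul_nonneg (dmWeight_pos l).le (Real.exp_pos _).le

theorem dmE_nonneg (i : Fin k) (t : ℕ) : 0 ≤ dmE μ₀ A x i t := by
  rw [dmE_eq]
  exact tsum_nonneg fun l => mul_nonneg (dmWeight_pos l).le (Real.exp_pos _).le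

theorem exp_one_le_log {H : ℝ} (hH : Real.exp (Real.exp 1) ≤ H) : Real.exp 1 ≤ Real.log H := by
  rwa [Real.le_log_iff_exp_le ((Real.exp_pos _).trans_le hH)]

theorem one_le_log_log {H : ℝ} (hH : Real.exp (Real.exp 1) ≤ H) :
    1 ≤ Real.log (Real.log H) := by
  have h := exp_one_le_log hH
  rwa [Real.le_log_iff_exp_le ((Real.exp_pos _).trans_le h)]

/-- A grid point of the evidence within a factor `e` of the rate `1 / (2 √H)`. The weight there
costs only a factor `(log H)²`. -/
theorem exists_dmLam {H : ℝ} (hH : Real.exp (Real.exp 1) ≤ H) :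
    ∃ l, dmLam l ≤ 1 / √H / 2 ∧ 1 / √H / 2 / Real.exp 1 ≤ dmLam l ∧
      Real.exp (-2 * Real.log (Real.log H)) ≤ dmWeight l := by
  have hH0 : 0 < H := (Real.exp_pos _).trans_le hH
  have hlog := exp_one_le_log hH
  have he := Real.exp_one_gt_d9
  have he' := Real.exp_one_lt_d9
  have hl2 := Real.log_two_gt_d9
  have hl2' := Real.log_two_lt_d9
  have hlH : 0 < Real.log H := by linarith
  set D := Real.log H / 2 + Real.log 2 with hD
  have hd : 1 / √H / 2 = Real.exp (-D) := by
    rw [hD, neg_add, Real.exp_add, Real.exp_neg, Real.exp_neg, Real.exp_log two_pos,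
      ← Real.log_sqrt hH0.le, Real.exp_log (Real.sqrt_pos.2 hH0)]
    field_simp
  have hlam : ∀ l, dmLam l = Real.exp (-((l : ℝ) + 5 / 2)) := by
    intro l; unfold dmLam; rw [Real.exp_neg, one_div]
  refine ⟨⌈D - 5 / 2⌉₊, ?_, ?_, ?_⟩
  · rw [hd, hlam, Real.exp_le_exp]
    have := Nat.le_ceil (D - 5 / 2)
    linarith
  · rw [hd, hlam, ← Real.exp_sub, Real.exp_le_exp]
    rcases le_or_gt (D - 5 / 2) 0 with h | h
    · rw [Nat.ceil_eq_zero.2 h]; push_cast; linarith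
    · have := Nat.ceil_lt_add_one h.le
      linarith
  · have hbound : (⌈D - 5 / 2⌉₊ : ℝ) + 2 ≤ Real.log H := by
      rcases le_or_gt (D - 5 / 2) 0 with h | h
      · rw [Nat.ceil_eq_zero.2 h]; push_cast; linarith
      · have := Nat.ceil_lt_add_one h.le
        linarith
    have e : Real.exp (-2 * Real.log (Real.log H)) = 1 / Real.log H ^ 2 := by
      rw [show -2 * Real.log (Real.log H) = -(((2 : ℕ) : ℝ) * Real.log (Real.log H)) by
        push_cast; ring, Real.exp_neg, Real.exp_nat_mul, Real.exp_log hlH, one_div]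
    rw [e]
    unfold dmWeight
    rw [div_le_div_iff₀ (by positivity) (by positivity)]
    have h1 : ((⌈D - 5 / 2⌉₊ : ℝ) + 2) ^ 2 ≤ Real.log H ^ 2 :=
      pow_le_pow_left₀ (by positivity) hbound 2
    have h2 : 0 ≤ ((⌈D - 5 / 2⌉₊ : ℝ) + 2) ^ 2 := by positivity
    nlinarith

theorem exp_le_dmE {H : ℝ} (hH : Real.exp (Real.exp 1) ≤ H) {i : Fin k} {t : ℕ}
    (h : (numSamples A i t : ℝ) * (1 / √H / 2) ≤
      ∑ s ∈ (Finset.range t).filter (fun s => i ∈ A s), (x i s - μ₀)) :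
    Real.exp ((numSamples A i t : ℝ) / (8 * Real.exp 1 * H) - 2 * Real.log (Real.log H)) ≤
      dmE μ₀ A x i t := by
  obtain ⟨l, hl1, hl2, hl3⟩ := exists_dmLam hH
  have hH0 : 0 < H := (Real.exp_pos _).trans_le hH
  refine le_trans ?_ (le_dmE i t l)
  rw [show (numSamples A i t : ℝ) / (8 * Real.exp 1 * H) - 2 * Real.log (Real.log H) =
    -2 * Real.log (Real.log H) + (numSamples A i t : ℝ) / (8 * Real.exp 1 * H) by ring,
    Real.exp_add]
  refine mul_le_mul hl3 (Real.exp_le_exp.2 ?_) (Real.exp_pos _).le (dmWeight_pos l).le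
  rw [expStat_eq]
  set n : ℝ := (numSamples A i t : ℝ) with hn
  have hn0 : 0 ≤ n := Nat.cast_nonneg _
  set d := 1 / √H / 2 with hd
  have hd2 : d ^ 2 = 1 / (4 * H) := by
    rw [hd, div_pow, div_pow, Real.sq_sqrt hH0.le]; field_simp; norm_num
  have hd0 : 0 < d := by have := Real.sqrt_pos.2 hH0; positivity
  have hlam := dmLam_pos l
  have h1 := mul_le_mul_of_nonneg_left h hlam.le
  have h2 : n / (8 * Real.exp 1 * H) = n * (d / Real.exp 1 * d / 2) := by
    have : d / Real.exp 1 * d / 2 = d ^ 2 / (2 * Real.exp 1) := by field_simp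
    rw [this, hd2]; field_simp; ring
  have h3 : d / Real.exp 1 * d / 2 ≤ dmLam l * d - dmLam l ^ 2 / 2 := by
    have h4 : dmLam l * d / 2 ≤ dmLam l * d - dmLam l ^ 2 / 2 := by nlinarith
    have h5 := mul_le_mul_of_nonneg_right hl2 hd0.le
    linarith
  have h4 := mul_le_mul_of_nonneg_left h3 hn0
  rw [h2]
  linarith

end Path

/-! ### The width of the confidence boundaries -/

/-- A number of samples after which every boundary is at most `1 / (2 √H)`. -/
noncomputable def burnIn (δ H : ℝ) : ℝ := 134 * H * (Real.log (Real.log H) + Real.log (1 / δ))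

theorem burnIn_mono {δ H H' : ℝ} (h0 : 0 < δ) (h1 : δ < 1) (hH : Real.exp (Real.exp 1) ≤ H)
    (h : H ≤ H') : burnIn δ H ≤ burnIn δ H' := by
  have hH0 : 0 < H := (Real.exp_pos _).trans_le hH
  have hl := exp_one_le_log hH
  have hll := one_le_log_log hH
  have hL : 0 < Real.log (1 / δ) := Real.log_pos (by rw [lt_div_iff₀ h0]; linarith)
  have h2 : Real.log (Real.log H) ≤ Real.log (Real.log H') :=
    Real.log_le_log ((Real.exp_pos 1).trans_le hl) (Real.log_le_log hH0 h)
  have hH'0 : 0 < H' := hH0.trans_le h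
  unfold burnIn
  gcongr

theorem log_log_add_le {H g : ℝ} (hH : Real.exp (Real.exp 1) ≤ H) (hg : 1 ≤ g) :
    Real.log (Real.log (g * H) + Real.exp 1) ≤ Real.log (Real.log H) + g / 64 + 4.2 := by
  have hH0 : 0 < H := (Real.exp_pos _).trans_le hH
  have hl := exp_one_le_log hH
  have he := Real.exp_one_gt_d9
  have hlg : 0 ≤ Real.log g := Real.log_nonneg hg
  have hlg2 : Real.log g ≤ g / 64 + 3.2 := by
    have h1 := Real.log_le_sub_one_of_pos (show 0 < g / 64 by linarith)
    rw [Real.log_div (by linarith) (by norm_num)] at h1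
    have h2 : Real.log 64 = 6 * Real.log 2 := by
      rw [show (64 : ℝ) = 2 ^ 6 by norm_num, Real.log_pow]; norm_num
    have h3 := Real.log_two_lt_d9
    linarith
  have h1 : Real.log (g * H) + Real.exp 1 ≤ Real.log H * (2 + Real.log g) := by
    rw [Real.log_mul (by linarith) hH0.ne']
    nlinarith
  have h2 : 0 < Real.log (g * H) + Real.exp 1 := by
    rw [Real.log_mul (by linarith) hH0.ne']; linarith
  refine (Real.log_le_log h2 h1).trans ?_
  rw [Real.log_mul (by linarith) (by linarith)]
  have := Real.log_le_sub_one_of_pos (show 0 < 2 + Real.log g by linarith)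
  linarith

/-- A common upper bound for all the boundaries. -/
theorem IsBoundary.le_sqrt {φ : ℕ → ℝ → ℝ} {δ : ℝ} (hφ : IsBoundary φ δ) (h0 : 0 < δ)
    (h1 : δ < 1) {n : ℕ} (hn : 1 ≤ n) :
    φ n δ ≤ √((8 * Real.log (1 / δ) + 4 * Real.log (Real.log n + Real.exp 1) + 4) / n) := by
  have hn' : (1 : ℝ) ≤ n := by exact_mod_cast hn
  have hln : 0 ≤ Real.log n := Real.log_nonneg hn'
  have he := Real.exp_one_gt_d9
  have hl2 := Real.log_two_gt_d9
  have hl2' := Real.log_two_lt_d9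
  have hL : 0 < Real.log (1 / δ) := Real.log_pos (by rw [lt_div_iff₀ h0]; linarith)
  have hΛ : 1 ≤ Real.log (Real.log n + Real.exp 1) := by
    rw [Real.le_log_iff_exp_le (by linarith)]; linarith
  rcases hφ with rfl | rfl | ⟨rfl, hδ⟩
  · unfold phiZero
    refine Real.sqrt_le_sqrt (div_le_div_of_nonneg_right ?_ (by linarith))
    have hq : 0 < Real.logb 2 (2 * (n : ℝ)) := Real.logb_pos (by norm_num) (by linarith)
    rw [div_eq_mul_one_div, Real.log_mul hq.ne' (by positivity)]
    have h2 : Real.logb 2 (2 * (n : ℝ)) ≤ 2 * (Real.log n + Real.exp 1) := by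
      rw [Real.logb, Real.log_mul (by norm_num) (by linarith), div_le_iff₀ (by linarith)]
      nlinarith
    have h3 := Real.log_le_log hq h2
    rw [Real.log_mul (by norm_num) (by linarith)] at h3
    linarith
  · unfold phiIS
    refine Real.sqrt_le_sqrt (div_le_div_of_nonneg_right ?_ (by linarith))
    rw [div_eq_mul_one_div (4.983 : ℝ) δ,
      Real.log_mul (show (4.983 : ℝ) ≠ 0 by norm_num) (by positivity)]
    have h4 : Real.log 4.983 ≤ 1.64 := by
      have h5 : Real.log 4.983 = 2 * Real.log 2 + Real.log 1.24575 := by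
        have : (4.983 : ℝ) = 2 ^ 2 * 1.24575 := by norm_num
        rw [this, Real.log_mul (by norm_num) (by norm_num), Real.log_pow]
        norm_num
      have h6 := Real.log_le_sub_one_of_pos (show (0 : ℝ) < 1.24575 by norm_num)
      rw [h5]; linarith
    have h7 : Real.log (2.041 * (n : ℝ)) ≤ Real.log n + Real.exp 1 := by
      rw [Real.log_mul (by norm_num) (by linarith)]
      have := Real.log_le_sub_one_of_pos (show (0 : ℝ) < 2.041 by norm_num)
      linarith
    have h8 : 0 < Real.log (2.041 * (n : ℝ)) := Real.log_pos (by linarith)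
    have h9 := Real.log_le_log h8 h7
    linarith
  · unfold phiJJ
    refine Real.sqrt_le_sqrt (div_le_div_of_nonneg_right ?_ (by linarith))
    have h4 := Real.log_le_sub_one_of_pos hL
    have e : Real.log (Real.exp 1 * (n : ℝ) / 2) = 1 + Real.log n - Real.log 2 := by
      rw [Real.log_div (by positivity) two_ne_zero, Real.log_mul (Real.exp_pos 1).ne' (by linarith),
        Real.log_exp]
    have h5 : Real.log (Real.log (Real.exp 1 * (n : ℝ) / 2)) ≤
        Real.log (Real.log n + Real.exp 1) := by
      rw [e]; exact Real.log_le_log (by linarith) (by linarith)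
    linarith

theorem IsBoundary.le_of_burnIn_le {φ : ℕ → ℝ → ℝ} {δ H : ℝ} (hφ : IsBoundary φ δ) (h0 : 0 < δ)
    (h1 : δ < 1) (hH : Real.exp (Real.exp 1) ≤ H) {n : ℕ} (hn : burnIn δ H ≤ n) :
    φ n δ ≤ 1 / √H / 2 := by
  have hH0 : 0 < H := (Real.exp_pos _).trans_le hH
  have hll := one_le_log_log hH
  have hL : 0 < Real.log (1 / δ) := Real.log_pos (by rw [lt_div_iff₀ h0]; linarith)
  set g : ℝ := n / H with hg
  have hgH : g * H = n := by rw [hg]; field_simp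
  have hg1 : 134 * (Real.log (Real.log H) + Real.log (1 / δ)) ≤ g := by
    rw [hg, le_div_iff₀ hH0]
    unfold burnIn at hn
    linarith
  have hn0 : (0 : ℝ) < n := by rw [← hgH]; exact mul_pos (by linarith) hH0
  have hn1 : 1 ≤ n := by exact_mod_cast hn0
  refine (hφ.le_sqrt h0 h1 hn1).trans ?_
  have e : 1 / √H / 2 = √(1 / (4 * H)) := by
    rw [Real.sqrt_div zero_le_one, Real.sqrt_mul (by norm_num), Real.sqrt_one,
      show (4 : ℝ) = 2 ^ 2 by norm_num, Real.sqrt_sq (by norm_num), div_div, mul_comm 2]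
  rw [e]
  refine Real.sqrt_le_sqrt ?_
  have h2 := log_log_add_le hH (show 1 ≤ g by linarith)
  rw [hgH] at h2
  rw [div_le_div_iff₀ hn0 (by positivity)]
  have h3 : 8 * Real.log (1 / δ) + 4 * Real.log (Real.log n + Real.exp 1) + 4 ≤ g / 4 := by linarith
  calc _ ≤ g / 4 * (4 * H) := mul_le_mul_of_nonneg_right h3 (by positivity)
    _ = 1 * n := by rw [← hgH]; ring

/-! ### The sample complexity along a path -/

/-- If at most `C e^{-u}` of the numbers `q j` are at least `u`, for every integer `u ≥ 0`, then the
sum of their positive parts is at most `2 C`. -/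
theorem sum_max_zero_le {ι : Type*} (S : Finset ι) (q : ι → ℝ) {C : ℝ} (hC : 0 ≤ C)
    (h : ∀ u : ℕ, ((S.filter fun j => (u : ℝ) ≤ q j).card : ℝ) ≤ C * Real.exp (-u)) :
    ∑ j ∈ S, max (q j) 0 ≤ 2 * C := by
  obtain ⟨N, hN⟩ : ∃ N : ℕ, ∀ j ∈ S, ⌊q j⌋₊ + 1 ≤ N :=
    ⟨S.sup fun j => ⌊q j⌋₊ + 1, fun j hj => Finset.le_sup (f := fun j => ⌊q j⌋₊ + 1) hj⟩
  have h1 : ∀ j ∈ S, max (q j) 0 ≤ ∑ u ∈ Finset.range N, if (u : ℝ) ≤ q j then (1 : ℝ) else 0 := by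
    intro j hj
    rcases le_or_gt 0 (q j) with h0 | h0
    · rw [max_eq_left h0]
      calc q j ≤ (⌊q j⌋₊ + 1 : ℕ) := by push_cast; exact (Nat.lt_floor_add_one _).le
        _ = ∑ u ∈ Finset.range (⌊q j⌋₊ + 1), (1 : ℝ) := by simp
        _ = ∑ u ∈ Finset.range (⌊q j⌋₊ + 1), if (u : ℝ) ≤ q j then (1 : ℝ) else 0 := by
            refine Finset.sum_congr rfl fun u hu => ?_
            rw [if_pos ((Nat.le_floor_iff h0).1 (Nat.lt_succ_iff.1 (Finset.mem_range.1 hu)))]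
        _ ≤ _ := Finset.sum_le_sum_of_subset_of_nonneg (Finset.range_subset_range.2 (hN j hj))
            fun u _ _ => by split_ifs <;> norm_num
    · rw [max_eq_right h0.le]
      exact Finset.sum_nonneg fun u _ => by split_ifs <;> norm_num
  calc ∑ j ∈ S, max (q j) 0
      ≤ ∑ j ∈ S, ∑ u ∈ Finset.range N, (if (u : ℝ) ≤ q j then (1 : ℝ) else 0) :=
        Finset.sum_le_sum h1
    _ = ∑ u ∈ Finset.range N, ((S.filter fun j => (u : ℝ) ≤ q j).card : ℝ) := by
        rw [Finset.sum_comm]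
        refine Finset.sum_congr rfl fun u _ => ?_
        rw [Finset.sum_ite, Finset.sum_const_zero, add_zero, Finset.sum_const, nsmul_eq_mul,
          mul_one]
    _ ≤ ∑ u ∈ Finset.range N, C * (1 / 2) ^ u := by
        refine Finset.sum_le_sum fun u _ => (h u).trans ?_
        refine mul_le_mul_of_nonneg_left ?_ hC
        have e : Real.exp (-(u : ℝ)) = Real.exp (-1) ^ u := by
          rw [← Real.exp_nat_mul]; congr 1; ring
        rw [e]
        refine pow_le_pow_left₀ (Real.exp_pos _).le ?_ u
        rw [Real.exp_neg, one_div]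
        exact inv_anti₀ two_pos (by have := Real.add_one_le_exp 1; linarith)
    _ = C * ∑ u ∈ Finset.range N, (1 / 2 : ℝ) ^ u := by rw [Finset.mul_sum]
    _ ≤ C * 2 := mul_le_mul_of_nonneg_left (sum_geometric_two_le N) hC
    _ = 2 * C := mul_comm _ _

/-- The properties of a path that make the arm `i` be rejected in time. Here `m j` is the mean of
arm `j` and `H j` its complexity; `z j` bounds the deviations of the arms `j ≠ i`, upwards
for the nulls and downwards for the non-nulls, at the rate `1 / (2 √(H j))` that matters for
them. For arm `i` itself, the upper confidence bound never fails. -/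
structure IsGoodPath {k : ℕ} (A : ℕ → Finset (Fin k)) (x : Fin k → ℕ → ℝ) (φ : ℕ → ℝ → ℝ)
    (δ μ₀ : ℝ) (m H z : Fin k → ℝ) (i : Fin k) (T : ℕ) : Prop where
  ucb : IsUCB φ δ μ₀ A x
  boundary : IsBoundary φ δ
  pos : 0 < δ
  lt_one : δ < 1
  le_H : ∀ j, Real.exp (Real.exp 1) ≤ H j
  null_gap : ∀ j, m j ≤ μ₀ → 1 / √(H j) ≤ m i - m j
  nonnull_gap : ∀ j, μ₀ < m j → 1 / √(H j) ≤ m j - μ₀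
  z_nonneg : ∀ j, 0 ≤ z j
  target_ucb : ∀ t, 1 ≤ numSamples A i t →
    -((numSamples A i t : ℝ) * φ (numSamples A i t) δ) ≤
      ∑ s ∈ (Finset.range t).filter (fun s => i ∈ A s), (x i s - m i)
  null_dev : ∀ j, m j ≤ μ₀ → ∀ t ≤ T, expStat A x j (m j) (1 / √(H j) / 2) t ≤ z j
  nonnull_dev : ∀ j, j ≠ i → μ₀ < m j → ∀ t ≤ T,
    expStat A x j (m j) (-(1 / √(H j) / 2)) t ≤ z j

namespace IsGoodPath

variable {k : ℕ} {A : ℕ → Finset (Fin k)} {x : Fin k → ℕ → ℝ} {φ : ℕ → ℝ → ℝ}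
  {δ μ₀ : ℝ} {m H z : Fin k → ℝ} {i : Fin k} {T : ℕ}

theorem H_pos (h : IsGoodPath A x φ δ μ₀ m H z i T) (j : Fin k) : 0 < H j :=
  (Real.exp_pos _).trans_le (h.le_H j)

theorem log_inv_pos (h : IsGoodPath A x φ δ μ₀ m H z i T) : 0 < Real.log (1 / δ) :=
  Real.log_pos (by rw [lt_div_iff₀ h.pos]; linarith [h.lt_one])

theorem burnIn_pos (h : IsGoodPath A x φ δ μ₀ m H z i T) (j : Fin k) : 0 < burnIn δ (H j) := by
  have h1 := h.H_pos j
  have h2 := one_le_log_log (h.le_H j)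
  have h3 := h.log_inv_pos
  unfold burnIn; positivity

theorem sum_sub_eq (A : ℕ → Finset (Fin k)) (x : Fin k → ℕ → ℝ) (j : Fin k) (t : ℕ) (a : ℝ) :
    ∑ s ∈ (Finset.range t).filter (fun s => j ∈ A s), (x j s - a) =
      ∑ s ∈ (Finset.range t).filter (fun s => j ∈ A s), x j s - numSamples A j t * a := by
  rw [Finset.sum_sub_distrib, Finset.sum_const, nsmul_eq_mul]; rfl

/-- The number of samples after which the evidence of the non-null arm `j` grows. -/
noncomputable def growthStart (δ : ℝ) (H z : Fin k → ℝ) (j : Fin k) : ℝ :=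
  burnIn δ (H j) + 8 * H j * z j

theorem growthStart_nonneg (h : IsGoodPath A x φ δ μ₀ m H z i T) (j : Fin k) :
    0 ≤ growthStart δ H z j := by
  have h1 := h.burnIn_pos j
  have h2 := h.z_nonneg j
  have h3 := h.H_pos j
  unfold growthStart; positivity

theorem exp_le_dmE (h : IsGoodPath A x φ δ μ₀ m H z i T) {j : Fin k} (hj : μ₀ < m j) {t : ℕ}
    (ht : t ≤ T) (hn : growthStart δ H z j ≤ numSamples A j t) :
    Real.exp ((numSamples A j t : ℝ) / (8 * Real.exp 1 * H j) - 2 * Real.log (Real.log (H j))) ≤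
      dmE μ₀ A x j t := by
  refine BanditTesting.exp_le_dmE (h.le_H j) ?_
  have hH := h.H_pos j
  have hz := h.z_nonneg j
  have hb := h.burnIn_pos j
  set n := numSamples A j t with hnn
  unfold growthStart at hn
  have hHz : 0 ≤ 8 * H j * z j := by positivity
  have hn0 : (0 : ℝ) < n := by linarith
  set d := 1 / √(H j) with hd
  have hd0 : 0 < d := by have := Real.sqrt_pos.2 hH; positivity
  have hd2 : d ^ 2 * H j = 1 := by
    rw [hd, div_pow, Real.sq_sqrt hH.le]; field_simp
  have hgap := h.nonnull_gap j hj
  -- the centred sum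
  have hkey : -((n : ℝ) * (d / 2)) ≤
      ∑ s ∈ (Finset.range t).filter (fun s => j ∈ A s), (x j s - m j) := by
    by_cases hji : j = i
    · subst hji
      have h1 := h.target_ucb t (by exact_mod_cast hn0)
      have h2 := h.boundary.le_of_burnIn_le h.pos h.lt_one (h.le_H j) (n := n) (by linarith)
      have h3 := mul_le_mul_of_nonneg_left h2 hn0.le
      linarith
    · have h1 := h.nonnull_dev j hji hj t ht
      rw [expStat_eq] at h1
      have h2 : 8 * z j ≤ d ^ 2 * n := by
        have h3 : 8 * H j * z j ≤ n := by linarith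
        have h4 := mul_le_mul_of_nonneg_left h3 (sq_nonneg d)
        calc 8 * z j = 8 * z j * (d ^ 2 * H j) := by rw [hd2, mul_one]
          _ ≤ _ := by linarith
      set S := ∑ s ∈ (Finset.range t).filter (fun s => j ∈ A s), (x j s - m j)
      have h5 : -(d / 2 * S) ≤ d / 2 * (n * (d / 2)) := by nlinarith
      have h6 : 0 ≤ d / 2 * (S + n * (d / 2)) := by linarith
      have := nonneg_of_mul_nonneg_right h6 (by linarith)
      linarith
  rw [sum_sub_eq] at hkey ⊢
  have h7 := mul_le_mul_of_nonneg_left hgap hn0.le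
  linarith

theorem notMem_rejSet (h : IsGoodPath A x φ δ μ₀ m H z i T)
    (hi : i ∉ rejSet δ μ₀ A x T) {t : ℕ} (ht : t ≤ T) : i ∉ rejSet δ μ₀ A x t :=
  fun hh => hi (rejSet_mono h.pos h.ucb ht hh)

theorem sum_numSamples_eq (h : IsGoodPath A x φ δ μ₀ m H z i T)
    (hi : i ∉ rejSet δ μ₀ A x T) : ∑ j, numSamples A j T = T :=
  sum_numSamples h.ucb fun t ht hh => h.notMem_rejSet hi ht.le (by rw [hh]; exact Finset.mem_univ i)

theorem sampled_spec (h : IsGoodPath A x φ δ μ₀ m H z i T) (hi : i ∉ rejSet δ μ₀ A x T) {t : ℕ}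
    (ht : t < T) {j : Fin k} (hj : j ∈ A t) : j ∉ rejSet δ μ₀ A x t ∧
      ucbIndex φ δ A x i t ≤ ucbIndex φ δ A x j t := by
  have hit := h.notMem_rejSet hi ht.le
  obtain ⟨j', h1, h2, h3⟩ := (h.ucb t).2 fun hh => hit (by rw [hh]; exact Finset.mem_univ i)
  rw [h2, Finset.mem_singleton] at hj
  subst hj
  exact ⟨h1, h3 i hit⟩

/-- A null arm is sampled while the target arm is not yet rejected only if its own upper confidence
bound exceeds the mean of the target. -/
theorem numSamples_null_le (h : IsGoodPath A x φ δ μ₀ m H z i T) (hi : i ∉ rejSet δ μ₀ A x T)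
    {j : Fin k} (hj : m j ≤ μ₀) : (numSamples A j T : ℝ) ≤ 1 + growthStart δ H z j := by
  have hH := h.H_pos j
  have hz := h.z_nonneg j
  have hb := h.burnIn_pos j
  have hHz : 0 ≤ 8 * H j * z j := by positivity
  unfold growthStart
  rcases hN : numSamples A j T with _ | n
  · push_cast; linarith
  obtain ⟨t, htT, hjt, hnt⟩ := exists_last_sample hN
  push_cast
  by_contra hcon
  push Not at hcon
  have hnb : burnIn δ (H j) ≤ n := by linarith
  have hn0 : (0 : ℝ) < n := by linarith
  have hn1 : n ≠ 0 := by rintro rfl; simp at hn0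
  set d := 1 / √(H j) with hd
  have hd0 : 0 < d := by have := Real.sqrt_pos.2 hH; positivity
  have hd2 : d ^ 2 * H j = 1 := by
    rw [hd, div_pow, Real.sq_sqrt hH.le]; field_simp
  have hucb := (h.sampled_spec hi htT hjt).2
  unfold ucbIndex at hucb
  rw [hnt, if_neg hn1] at hucb
  split_ifs at hucb with h0
  · exact absurd (top_le_iff.1 hucb) (EReal.coe_ne_top _)
  rw [EReal.coe_le_coe_iff] at hucb
  have hN0 : (0 : ℝ) < numSamples A i t := by exact_mod_cast Nat.pos_of_ne_zero h0
  have htarget : m i ≤ sampleMean A x i t + φ (numSamples A i t) δ := by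
    have h1 := h.target_ucb t (Nat.pos_of_ne_zero h0)
    rw [sum_sub_eq] at h1
    have e : ∑ s ∈ (Finset.range t).filter (fun s => i ∈ A s), x i s =
        numSamples A i t * sampleMean A x i t := by
      unfold sampleMean; field_simp
    rw [e] at h1
    have h2 : 0 ≤ (numSamples A i t : ℝ) *
        (sampleMean A x i t + φ (numSamples A i t) δ - m i) := by linarith
    have := nonneg_of_mul_nonneg_right h2 hN0
    linarith
  have hφ := h.boundary.le_of_burnIn_le h.pos h.lt_one (h.le_H j) hnb
  have hgap := h.null_gap j hj
  have hmean : d / 2 ≤ sampleMean A x j t - m j := by linarith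
  have hdev := h.null_dev j hj t htT.le
  rw [expStat_eq, sum_sub_eq, hnt] at hdev
  have e : ∑ s ∈ (Finset.range t).filter (fun s => j ∈ A s), x j s =
      n * sampleMean A x j t := by
    unfold sampleMean; rw [hnt]; field_simp
  rw [e] at hdev
  have h3 : n * (d ^ 2 / 8) ≤ z j := by
    have h4 := mul_le_mul_of_nonneg_left hmean (show 0 ≤ d / 2 * n by positivity)
    linarith
  have h5 : (n : ℝ) ≤ 8 * H j * z j := by
    calc (n : ℝ) = 8 * H j * (n * (d ^ 2 / 8)) := by linear_combination (-(n : ℝ)) * hd2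
      _ ≤ _ := by gcongr
  linarith

/-- The bound on the samples of an arm that does not use the rejections of other arms. -/
theorem numSamples_le (h : IsGoodPath A x φ δ μ₀ m H z i T) (hi : i ∉ rejSet δ μ₀ A x T)
    (j : Fin k) : (numSamples A j T : ℝ) ≤ 1 + growthStart δ H z j +
      8 * Real.exp 1 * H j * (2 * Real.log (Real.log (H j)) + Real.log (k / δ)) := by
  have hH := h.H_pos j
  have hll := one_le_log_log (h.le_H j)
  have hk1 : (1 : ℝ) ≤ k := by
    have : 0 < k := Fin.pos i
    exact_mod_cast this
  have hgs := h.growthStart_nonneg j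
  have hkδ : 0 ≤ Real.log (k / δ) := by
    refine Real.log_nonneg ?_
    rw [le_div_iff₀ h.pos]; linarith [h.lt_one]
  have hextra : 0 ≤ 8 * Real.exp 1 * H j * (2 * Real.log (Real.log (H j)) + Real.log (k / δ)) := by
    positivity
  rcases le_or_gt (m j) μ₀ with hj | hj
  · linarith [h.numSamples_null_le hi hj]
  · rcases hN : numSamples A j T with _ | n
    · push_cast; linarith
    obtain ⟨t, htT, hjt, hnt⟩ := exists_last_sample hN
    push_cast
    by_contra hcon
    push Not at hcon
    have hrej := (h.sampled_spec hi htT hjt).1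
    have hgrow := h.exp_le_dmE hj htT.le (by rw [hnt]; linarith)
    rw [hnt] at hgrow
    refine hrej (subset_eBH δ _ {j} ?_ (Finset.mem_singleton_self j))
    intro j' hj'
    rw [Finset.mem_singleton] at hj'
    subst hj'
    refine le_trans ?_ hgrow
    rw [Finset.card_singleton, Nat.cast_one, mul_one]
    rw [← Real.log_le_iff_le_exp (by have := h.pos; positivity)]
    have h8 : 0 < 8 * Real.exp 1 * H j' := by positivity
    have : 2 * Real.log (Real.log (H j')) + Real.log (k / δ) ≤ n / (8 * Real.exp 1 * H j') := by
      rw [le_div_iff₀ h8]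
      linarith
    linarith

/-- The bound on the total number of samples that uses the rejections of other arms: the evidence
that e-BH requires decreases with the number of arms for which there is evidence, so that the
factors `k / |R|` in the thresholds cost only a constant per arm. -/
theorem card_le (h : IsGoodPath A x φ δ μ₀ m H z i T) (hi : i ∉ rejSet δ μ₀ A x T) {G : ℝ}
    (hG : ∀ j, H j ≤ G) : (T : ℝ) ≤ ∑ j, (1 + growthStart δ H z j) +
      k * (8 * Real.exp 1 * G * (2 * Real.log (Real.log G) + Real.log (1 / δ) + 2)) := by
  classical
  have hLpos := h.log_inv_pos
  have hδ := h.pos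
  have hHi := h.H_pos i
  have hG0 : 0 < G := hHi.trans_le (hG i)
  have hGe : Real.exp (Real.exp 1) ≤ G := (h.le_H i).trans (hG i)
  have hllG := one_le_log_log hGe
  have hk0 : (0 : ℝ) < k := by
    have : 0 < k := Fin.pos i
    exact_mod_cast this
  have h8 : 0 < 8 * Real.exp 1 * G := by positivity
  have hgs := h.growthStart_nonneg
  set n : Fin k → ℕ := fun j => numSamples A j T with hn
  set S : Finset (Fin k) := Finset.univ.filter fun j =>
    μ₀ < m j ∧ 1 ≤ n j ∧ growthStart δ H z j ≤ (n j : ℝ) - 1 with hS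
  set q : Fin k → ℝ := fun j => ((n j : ℝ) - 1) / (8 * Real.exp 1 * G)
    - 2 * Real.log (Real.log G) - Real.log (1 / δ) with hq
  have hlast : ∀ j ∈ S, ∃ t < T, j ∈ A t ∧ (numSamples A j t : ℝ) = (n j : ℝ) - 1 := by
    intro j hj
    have hj1 := (Finset.mem_filter.1 hj).2.2.1
    obtain ⟨p, hp⟩ : ∃ p, numSamples A j T = p + 1 := ⟨n j - 1, by simp only [hn] at hj1 ⊢; omega⟩
    obtain ⟨t, h1, h2, h3⟩ := exists_last_sample hp
    refine ⟨t, h1, h2, ?_⟩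
    simp only [hn, h3, hp]; push_cast; ring
  choose! τ hτT hτA hτn using hlast
  -- From its last sample on, an arm of `S` has evidence `exp (q j) / δ`.
  have hev : ∀ j ∈ S, ∀ t, τ j ≤ t → t ≤ T → Real.exp (q j) / δ ≤ dmE μ₀ A x j t := by
    intro j hj t h1 h2
    obtain ⟨-, hjm, hj1, hjg⟩ := Finset.mem_filter.1 hj
    have h3 : (n j : ℝ) - 1 ≤ numSamples A j t := by
      rw [← hτn j hj]; exact_mod_cast numSamples_mono A j h1
    refine le_trans ?_ (h.exp_le_dmE hjm h2 (hjg.trans h3))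
    have e : Real.exp (q j) / δ = Real.exp (q j + Real.log (1 / δ)) := by
      rw [Real.exp_add, Real.exp_log (by positivity), mul_one_div]
    rw [e, Real.exp_le_exp]
    have hHj := h.H_pos j
    have h4 : Real.log (Real.log (H j)) ≤ Real.log (Real.log G) :=
      Real.log_le_log ((Real.exp_pos 1).trans_le (exp_one_le_log (h.le_H j)))
        (Real.log_le_log hHj (hG j))
    have h5 : ((n j : ℝ) - 1) / (8 * Real.exp 1 * G) ≤
        (numSamples A j t : ℝ) / (8 * Real.exp 1 * H j) := by
      have := hG j
      gcongr
    simp only [hq]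
    linarith
  have hcount : ∀ u : ℕ, ((S.filter fun j => (u : ℝ) ≤ q j).card : ℝ) ≤ k * Real.exp (-u) := by
    intro u
    set J := S.filter fun j => (u : ℝ) ≤ q j with hJ
    rcases J.eq_empty_or_nonempty with h0 | hne
    · rw [h0]; simp; positivity
    · -- Otherwise `J` is self-consistent when the last of its arms is sampled for the last time.
      obtain ⟨j₀, hj₀, hmax⟩ := J.exists_max_image τ hne
      by_contra hcon
      push Not at hcon
      have hj₀S := (Finset.mem_filter.1 hj₀).1
      refine (h.sampled_spec hi (hτT j₀ hj₀S) (hτA j₀ hj₀S)).1 (subset_eBH δ _ J ?_ hj₀)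
      intro j hj
      obtain ⟨hjS, hju⟩ := Finset.mem_filter.1 hj
      refine le_trans ?_ (hev j hjS (τ j₀) (hmax j hj) (hτT j₀ hj₀S).le)
      have h1 : Real.exp u / δ ≤ Real.exp (q j) / δ :=
        div_le_div_of_nonneg_right (Real.exp_le_exp.2 hju) hδ.le
      refine le_trans ?_ h1
      have hcard : (0 : ℝ) < J.card := by exact_mod_cast hne.card_pos
      rw [div_le_div_iff₀ (by positivity) hδ]
      have h2 : (k : ℝ) ≤ Real.exp u * J.card := by
        have h3 := mul_le_mul_of_nonneg_left hcon.le (Real.exp_pos (u : ℝ)).le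
        have h4 : Real.exp (u : ℝ) * Real.exp (-(u : ℝ)) = 1 := by
          rw [← Real.exp_add]; simp
        calc (k : ℝ) = Real.exp u * (k * Real.exp (-u)) := by linear_combination (-(k : ℝ)) * h4
          _ ≤ _ := h3
      nlinarith
  have hsumq := sum_max_zero_le S q hk0.le hcount
  have hper : ∀ j, (n j : ℝ) ≤ (1 + growthStart δ H z j) +
      8 * Real.exp 1 * G * (2 * Real.log (Real.log G) + Real.log (1 / δ)) +
      if j ∈ S then 8 * Real.exp 1 * G * max (q j) 0 else 0 := by
    intro j
    have hpos : 0 ≤ 8 * Real.exp 1 * G * (2 * Real.log (Real.log G) + Real.log (1 / δ)) := by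
      positivity
    split_ifs with hj
    · have h1 : q j ≤ max (q j) 0 := le_max_left _ _
      have h2 := mul_le_mul_of_nonneg_left h1 h8.le
      have h3 : 8 * Real.exp 1 * G * q j = (n j : ℝ) - 1 -
          8 * Real.exp 1 * G * (2 * Real.log (Real.log G) + Real.log (1 / δ)) := by
        simp only [hq]; field_simp; ring
      have := hgs j
      linarith
    · rcases le_or_gt (m j) μ₀ with hm | hm
      · have := h.numSamples_null_le hi hm
        simp only [hn]; linarith
      · by_contra hcon
        push Not at hcon
        have hg := hgs j
        refine hj (Finset.mem_filter.2 ⟨Finset.mem_univ j, hm, ?_, by linarith⟩)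
        have : (0 : ℝ) < n j := by linarith
        exact_mod_cast this
  calc (T : ℝ) = ∑ j, (n j : ℝ) := by
        have := h.sum_numSamples_eq hi
        exact_mod_cast this.symm
    _ ≤ ∑ j, ((1 + growthStart δ H z j) +
          8 * Real.exp 1 * G * (2 * Real.log (Real.log G) + Real.log (1 / δ)) +
          if j ∈ S then 8 * Real.exp 1 * G * max (q j) 0 else 0) :=
        Finset.sum_le_sum fun j _ => hper j
    _ = ∑ j, (1 + growthStart δ H z j) +
          k * (8 * Real.exp 1 * G * (2 * Real.log (Real.log G) + Real.log (1 / δ))) +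
          8 * Real.exp 1 * G * ∑ j ∈ S, max (q j) 0 := by
        rw [Finset.sum_add_distrib, Finset.sum_add_distrib, Finset.sum_const, Finset.card_univ,
          Fintype.card_fin, nsmul_eq_mul, Finset.sum_ite_mem, Finset.univ_inter, Finset.mul_sum]
    _ ≤ _ := by
        have := mul_le_mul_of_nonneg_left hsumq h8.le
        linarith

end IsGoodPath

/-! ### The complexity bounds -/

namespace IsGoodPath

variable {k : ℕ} {A : ℕ → Finset (Fin k)} {x : Fin k → ℕ → ℝ} {φ : ℕ → ℝ → ℝ}
  {δ μ₀ : ℝ} {m H z : Fin k → ℝ} {i : Fin k} {T : ℕ}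

theorem log_hundred_le : Real.log 102 ≤ 4.86 := by
  have h1 : Real.log 102 ≤ Real.log (2 ^ 7) := Real.log_le_log (by norm_num) (by norm_num)
  rw [Real.log_pow] at h1
  have := Real.log_two_lt_d9
  push_cast at h1
  linarith

theorem le_boundSum (h : IsGoodPath A x φ δ μ₀ m H z i T) (hi : i ∉ rejSet δ μ₀ A x T)
    (hz : ∀ j, z j ≤ 2 * Real.log (102 * k / δ)) :
    (T : ℝ) ≤ 300 * ∑ j, (H j * Real.log (Real.log (H j)) + H j * Real.log (k / δ)) := by
  have hk1 : (1 : ℝ) ≤ k := by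
    have : 0 < k := Fin.pos i
    exact_mod_cast this
  have hδ := h.pos
  have he := Real.exp_one_lt_d9
  have hLk : Real.log (1 / δ) ≤ Real.log (k / δ) :=
    Real.log_le_log (by positivity) (div_le_div_of_nonneg_right hk1 hδ.le)
  have hL := h.log_inv_pos
  have h102 : Real.log (102 * k / δ) = Real.log 102 + Real.log (k / δ) := by
    rw [mul_div_assoc, Real.log_mul (by norm_num) (by positivity)]
  rw [Finset.mul_sum]
  calc (T : ℝ) = ∑ j, (numSamples A j T : ℝ) := by
        have := h.sum_numSamples_eq hi
        exact_mod_cast this.symm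
    _ ≤ _ := Finset.sum_le_sum fun j _ => ?_
  refine (h.numSamples_le hi j).trans ?_
  have hH := h.H_pos j
  have hH1 : 1 ≤ H j := (Real.one_le_exp (Real.exp_pos 1).le).trans (h.le_H j)
  have hll := one_le_log_log (h.le_H j)
  have hzj := hz j
  have h1 := log_hundred_le
  unfold growthStart burnIn
  set ll := Real.log (Real.log (H j))
  set κ := Real.log (k / δ)
  have hκ : 0 < κ := hL.trans_le hLk
  have b1 : 134 * H j * (ll + Real.log (1 / δ)) ≤ 134 * H j * (ll + κ) := by gcongr
  have b2 : 8 * H j * z j ≤ 8 * H j * (2 * (4.86 * ll + κ)) := by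
    gcongr
    rw [h102] at hzj
    linarith
  have b3 : 8 * Real.exp 1 * H j * (2 * ll + κ) ≤ 8 * 2.72 * H j * (2 * ll + κ) := by
    gcongr; linarith
  have b4 : 1 ≤ H j * ll := one_le_mul_of_one_le_of_one_le hH1 hll
  have b5 : 0 < H j * κ := by positivity
  linarith

theorem le_boundMin (h : IsGoodPath A x φ δ μ₀ m H z i T) (hi : i ∉ rejSet δ μ₀ A x T)
    {G : ℝ} (hG : ∀ j, H j ≤ G) (hz : ∑ j, z j ≤ 2 * (k * Real.log (102 / δ))) :
    (T : ℝ) ≤ 300 * (k * G * Real.log (Real.log G / δ)) := by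
  have hk0 : (0 : ℝ) < k := by
    have : 0 < k := Fin.pos i
    exact_mod_cast this
  have hδ := h.pos
  have he := Real.exp_one_lt_d9
  have hL := h.log_inv_pos
  have hGe : Real.exp (Real.exp 1) ≤ G := (h.le_H i).trans (hG i)
  have hG0 : 0 < G := (Real.exp_pos _).trans_le hGe
  have hG1 : 1 ≤ G := (Real.one_le_exp (Real.exp_pos 1).le).trans hGe
  have hll := one_le_log_log hGe
  have hlogG : 0 < Real.log G := (Real.exp_pos 1).trans_le (exp_one_le_log hGe)
  have e1 : Real.log (Real.log G / δ) = Real.log (Real.log G) + Real.log (1 / δ) := by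
    rw [div_eq_mul_one_div, Real.log_mul hlogG.ne' (by positivity)]
  have e2 : Real.log (102 / δ) = Real.log 102 + Real.log (1 / δ) := by
    rw [div_eq_mul_one_div, Real.log_mul (by norm_num) (by positivity)]
  have h102 := log_hundred_le
  refine (h.card_le hi hG).trans ?_
  have hsum : ∑ j, (1 + growthStart δ H z j) ≤ k * (1 + burnIn δ G) + 8 * G * ∑ j, z j := by
    calc ∑ j, (1 + growthStart δ H z j) ≤ ∑ j, ((1 + burnIn δ G) + 8 * G * z j) := by
          refine Finset.sum_le_sum fun j _ => ?_
          have h1 := burnIn_mono h.pos h.lt_one (h.le_H j) (hG j)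
          have h2 : 8 * H j * z j ≤ 8 * G * z j := by
            have := h.z_nonneg j
            have := hG j
            gcongr
          unfold growthStart
          linarith
      _ = _ := by
          rw [Finset.sum_add_distrib, Finset.sum_const, Finset.card_univ, Fintype.card_fin,
            nsmul_eq_mul, Finset.mul_sum]
  have hz2 : 8 * G * ∑ j, z j ≤ 8 * G * (2 * (k * (4.86 * Real.log (Real.log G)
      + Real.log (1 / δ)))) := by
    refine mul_le_mul_of_nonneg_left (hz.trans ?_) (by positivity)
    rw [e2]
    gcongr
    linarith
  rw [e1]
  unfold burnIn at hsum
  set ll := Real.log (Real.log G)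
  set L := Real.log (1 / δ)
  have b3 : 8 * Real.exp 1 * G * (2 * ll + L + 2) ≤ 8 * 2.72 * G * (2 * ll + L + 2 * ll) := by
    gcongr <;> linarith
  have b3' := mul_le_mul_of_nonneg_left b3 hk0.le
  have b4 : 1 ≤ G * ll := one_le_mul_of_one_le_of_one_le hG1 hll
  have b4' := mul_le_mul_of_nonneg_left b4 hk0.le
  have b5 : 0 < k * (G * L) := by positivity
  have b6 : 0 < k * (G * ll) := by positivity
  linarith

end IsGoodPath

/-! ### False discovery rate -/

section Model

variable {Ω : Type*} [mΩ : MeasurableSpace Ω] {P : Measure Ω} {k : ℕ}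
  {ν : Fin k → Measure ℝ} {U : Ω → ℝ} {X : Fin k → ℕ → Ω → ℝ} {A : ℕ → Ω → Finset (Fin k)}
  {hU : Measurable U} {hX : ∀ i s, Measurable (X i s)} {hA : ∀ s, Measurable (A s)} {μ₀ δ : ℝ}

theorem ofReal_dmE {A : ℕ → Finset (Fin k)} {x : Fin k → ℕ → ℝ} (i : Fin k) (t : ℕ) :
    ENNReal.ofReal (dmE μ₀ A x i t) = ∑' l, ENNReal.ofReal (dmWeight l) *
      ENNReal.ofReal (Real.exp (expStat A x i μ₀ (dmLam l) t)) := by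
  rw [dmE_eq, ENNReal.ofReal_tsum_of_nonneg
    (fun l => mul_nonneg (dmWeight_pos l).le (Real.exp_pos _).le) (summable_dmE i t)]
  simp_rw [ENNReal.ofReal_mul (dmWeight_pos _).le]

theorem measurable_dmE (h : IsBanditModel P ν U X A hU hX hA) (i : Fin k) (t : ℕ) :
    Measurable fun ω => dmE μ₀ (fun s => A s ω) (fun i s => X i s ω) i t := by
  have h1 : Measurable fun ω =>
      ENNReal.ofReal (dmE μ₀ (fun s => A s ω) (fun i s => X i s ω) i t) := by
    simp_rw [ofReal_dmE]
    exact measurable_ennreal_tsum fun l => (((measurable_expStat h i μ₀ (dmLam l) t).mono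
      ((tableFiltration U X hU hX).le t) le_rfl).exp.ennreal_ofReal).const_mul _
  have h2 := h1.ennreal_toReal
  simpa only [ENNReal.toReal_ofReal (dmE_nonneg _ _)] using h2

theorem mem_eBH_iff {α : ℝ} {e : Fin k → ℝ} {j : Fin k} :
    j ∈ eBH α e ↔ ∃ R : Finset (Fin k), ESelfConsistent α e R ∧ j ∈ R := by
  classical
  simp only [eBH, Finset.mem_sup, Finset.mem_filter, Finset.mem_univ, true_and, id]

theorem measurableSet_mem_rejSet (h : IsBanditModel P ν U X A hU hX hA) (j : Fin k) (t : ℕ) :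
    MeasurableSet {ω | j ∈ rejSet δ μ₀ (fun s => A s ω) (fun i s => X i s ω) t} := by
  have e : {ω | j ∈ rejSet δ μ₀ (fun s => A s ω) (fun i s => X i s ω) t} =
      ⋃ R : Finset (Fin k), ⋃ (_ : j ∈ R), ⋂ i, ⋂ (_ : i ∈ R),
        {ω | (k : ℝ) / (δ * (R.card : ℝ)) ≤ dmE μ₀ (fun s => A s ω) (fun i s => X i s ω) i t} := by
    ext ω
    simp only [rejSet, Set.mem_ofPred_eq, mem_eBH_iff, Set.mem_iUnion, Set.mem_iInter,
      ESelfConsistent]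
    exact ⟨fun ⟨R, h1, h2⟩ => ⟨R, h2, h1⟩, fun ⟨R, h1, h2⟩ => ⟨R, h2, h1⟩⟩
  rw [e]
  exact MeasurableSet.iUnion fun R => MeasurableSet.iUnion fun _ => MeasurableSet.iInter fun i =>
    MeasurableSet.iInter fun _ => measurableSet_le measurable_const (measurable_dmE h i t)

theorem measurableSet_mem_rejSet_stopped (h : IsBanditModel P ν U X A hU hX hA) (j : Fin k)
    {τ : Ω → ℕ} (hτ : Measurable τ) :
    MeasurableSet {ω | j ∈ rejSet δ μ₀ (fun s => A s ω) (fun i s => X i s ω) (τ ω)} := by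
  have e : {ω | j ∈ rejSet δ μ₀ (fun s => A s ω) (fun i s => X i s ω) (τ ω)} = ⋃ n : ℕ,
      (τ ⁻¹' {n} ∩ {ω | j ∈ rejSet δ μ₀ (fun s => A s ω) (fun i s => X i s ω) n}) := by
    ext ω
    simp
  rw [e]
  exact MeasurableSet.iUnion fun n => (hτ (measurableSet_singleton n)).inter
    (measurableSet_mem_rejSet h j n)

/-- The evidence of a null arm has expectation at most one at every stopping time. -/
theorem lintegral_dmE_stopped_le [IsProbabilityMeasure P] (h : IsBanditModel P ν U X A hU hX hA)
    {j : Fin k} [IsProbabilityMeasure (ν j)]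
    (hsub : HasSubgaussianMGF (fun y => y - mean (ν j)) 1 (ν j)) (hj : mean (ν j) ≤ μ₀)
    {τ : Ω → ℕ} (hτ : IsStoppingTime (banditFiltration U A X hU hA hX)
      (fun ω => (τ ω : WithTop ℕ))) :
    ∫⁻ ω, ENNReal.ofReal (dmE μ₀ (fun s => A s ω) (fun i s => X i s ω) j (τ ω)) ∂P ≤ 1 := by
  have hsuper : IsESuper P (tableFiltration U X hU hX) fun t ω =>
      ENNReal.ofReal (dmE μ₀ (fun s => A s ω) (fun i s => X i s ω) j t) := by
    simp_rw [ofReal_dmE]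
    refine IsESuper.tsum fun l => (isESuper_exp h j ?_).const_mul _
    exact lintegral_exp_le_one_of_subgaussian hsub
      (mul_nonpos_of_nonneg_of_nonpos (dmLam_pos l).le (by linarith))
  refine (hsuper.lintegral_stopped_le (τ := τ) fun n => ?_).trans ?_
  · have := hτ.measurableSet_le n
    refine banditFiltration_le_table h n _ ?_
    convert this using 3
    exact (Nat.cast_le (α := WithTop ℕ)).symm
  · calc ∫⁻ ω, ENNReal.ofReal (dmE μ₀ (fun s => A s ω) (fun i s => X i s ω) j 0) ∂P
        ≤ ∫⁻ _, 1 ∂P := by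
          refine lintegral_mono fun ω => ENNReal.ofReal_le_one.2 ?_
          rw [dmE_eq]
          simp only [expStat_zero, Real.exp_zero, mul_one]
          exact Real.tsum_le_of_sum_range_le (fun l => (dmWeight_pos l).le) sum_dmWeight_le
      _ = 1 := by simp

/-- The e-BH bound: the false discovery proportion is at most `δ` times the average over the arms of
the evidence for the nulls. -/
theorem fdp_le_sum (hδ : 0 < δ) (H₀ : Finset (Fin k)) {e : Fin k → ℝ} (he : ∀ i, 0 ≤ e i) :
    ((H₀ ∩ eBH δ e).card : ℝ) / (max (eBH δ e).card 1 : ℕ) ≤ ∑ j ∈ H₀, δ / k * e j := by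
  set R := eBH δ e with hR
  have h1 : ((H₀ ∩ R).card : ℝ) / (max R.card 1 : ℕ) =
      ∑ j ∈ H₀ ∩ R, 1 / ((max R.card 1 : ℕ) : ℝ) := by
    rw [Finset.sum_const, nsmul_eq_mul, mul_one_div]
  rw [h1]
  refine (Finset.sum_le_sum fun j hj => ?_).trans (Finset.sum_le_sum_of_subset_of_nonneg
    Finset.inter_subset_left fun j _ _ => mul_nonneg (by positivity) (he j))
  have hjR := (Finset.mem_inter.1 hj).2
  have hcard : 0 < R.card := Finset.card_pos.2 ⟨j, hjR⟩
  have hc : (0 : ℝ) < R.card := by exact_mod_cast hcard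
  have hk : (0 : ℝ) < k := by exact_mod_cast Fin.pos j
  rw [max_eq_left (Nat.succ_le_of_lt hcard)]
  have h2 := eBH_selfConsistent δ hδ e j hjR
  calc 1 / (R.card : ℝ) = δ / k * (k / (δ * R.card)) := by field_simp
    _ ≤ _ := mul_le_mul_of_nonneg_left h2 (by positivity)

theorem FDR_stopped_le [IsProbabilityMeasure P] (h : IsBanditModel P ν U X A hU hX hA)
    (hν : ∀ i, IsProbabilityMeasure (ν i))
    (hsub : ∀ i, HasSubgaussianMGF (fun y => y - mean (ν i)) 1 (ν i)) (hδ : 0 < δ)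
    {τ : Ω → ℕ} (hτ : IsStoppingTime (banditFiltration U A X hU hA hX)
      (fun ω => (τ ω : WithTop ℕ))) :
    FDR P (nulls μ₀ ν)
      (fun ω => rejSet δ μ₀ (fun s => A s ω) (fun i s => X i s ω) (τ ω)) ≤ δ := by
  unfold FDR
  set f : Ω → ℝ := fun ω =>
    ((nulls μ₀ ν ∩ rejSet δ μ₀ (fun s => A s ω) (fun i s => X i s ω) (τ ω)).card : ℝ) /
      (max (rejSet δ μ₀ (fun s => A s ω) (fun i s => X i s ω) (τ ω)).card 1 : ℕ) with hf
  by_cases hint : Integrable f P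
  swap
  · rw [integral_undef hint]; exact hδ.le
  have hτm : Measurable τ := by
    refine measurable_of_Iic fun n => ?_
    have := (banditFiltration U A X hU hA hX).le n _ (hτ.measurableSet_le n)
    convert this using 1
    ext ω
    simp
  have hdm : ∀ j, Measurable fun ω =>
      ENNReal.ofReal (dmE μ₀ (fun s => A s ω) (fun i s => X i s ω) j (τ ω)) := fun j =>
    ((measurable_from_prod_countable_right (f := fun p : ℕ × Ω =>
      dmE μ₀ (fun s => A s p.2) (fun i s => X i s p.2) j p.1)
      fun n => measurable_dmE h j n).comp (hτm.prodMk measurable_id)).ennreal_ofReal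
  refine (ENNReal.ofReal_le_ofReal_iff hδ.le).1 ?_
  rw [ofReal_integral_eq_lintegral_ofReal hint
    (Filter.Eventually.of_forall fun ω => by simp only [hf]; positivity)]
  calc ∫⁻ ω, ENNReal.ofReal (f ω) ∂P
      ≤ ∫⁻ ω, ∑ j ∈ nulls μ₀ ν, ENNReal.ofReal (δ / k) *
          ENNReal.ofReal (dmE μ₀ (fun s => A s ω) (fun i s => X i s ω) j (τ ω)) ∂P := by
        refine lintegral_mono fun ω => ?_
        have h1 := fdp_le_sum hδ (nulls μ₀ ν)
          (e := fun j => dmE μ₀ (fun s => A s ω) (fun i s => X i s ω) j (τ ω))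
          (fun j => dmE_nonneg j (τ ω))
        refine (ENNReal.ofReal_le_ofReal h1).trans (le_of_eq ?_)
        rw [ENNReal.ofReal_sum_of_nonneg fun j _ => mul_nonneg (by positivity) (dmE_nonneg j (τ ω))]
        exact Finset.sum_congr rfl fun j _ => ENNReal.ofReal_mul (by positivity)
    _ = ∑ j ∈ nulls μ₀ ν, ENNReal.ofReal (δ / k) *
          ∫⁻ ω, ENNReal.ofReal (dmE μ₀ (fun s => A s ω) (fun i s => X i s ω) j (τ ω)) ∂P := by
        rw [lintegral_finsetSum _ fun j _ => (hdm j).const_mul _]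
        exact Finset.sum_congr rfl fun j _ => lintegral_const_mul _ (hdm j)
    _ ≤ ∑ j ∈ nulls μ₀ ν, ENNReal.ofReal (δ / k) := by
        refine Finset.sum_le_sum fun j hj => ?_
        have := hν j
        have h1 := lintegral_dmE_stopped_le h (hsub j) (Finset.mem_filter.1 hj).2 hτ
        exact (mul_le_mul_right h1 _).trans (mul_one _).le
    _ ≤ ∑ _j : Fin k, ENNReal.ofReal (δ / k) :=
        Finset.sum_le_sum_of_subset (Finset.subset_univ _)
    _ ≤ ENNReal.ofReal δ := by
        rw [← ENNReal.ofReal_sum_of_nonneg fun _ _ => by positivity]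
        refine ENNReal.ofReal_le_ofReal ?_
        rw [Finset.sum_const, Finset.card_univ, Fintype.card_fin, nsmul_eq_mul]
        rcases Nat.eq_zero_or_pos k with hk | hk
        · subst hk; simp; exact hδ.le
        · have : (0 : ℝ) < k := by exact_mod_cast hk
          exact le_of_eq (by field_simp)

end Model

/-! ### The event on which a non-null arm is rejected in time -/

section Path

variable {k : ℕ}

/-- The mixture of the exponential statistics of arm `i` that becomes at least `1` when the upper
confidence bound of arm `i` fails. -/
noncomputable def targetMixture (κ : ℝ) (w lam : ℕ → ℝ) (a : ℝ) (i : Fin k)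
    (A : ℕ → Finset (Fin k)) (x : Fin k → ℕ → ℝ) (t : ℕ) : ℝ≥0∞ :=
  ENNReal.ofReal (1 / κ) *
    ∑' l, ENNReal.ofReal (w l) * ENNReal.ofReal (Real.exp (expStat A x i a (-lam l) t))

/-- The rate at which the deviations of an arm are measured: downwards for a non-null arm, upwards
for a null arm. -/
noncomputable def devRate (μ₀ : ℝ) (m H : Fin k → ℝ) (j : Fin k) : ℝ :=
  if μ₀ < m j then -(1 / √(H j) / 2) else 1 / √(H j) / 2

/-- The exponential statistic that measures the deviations of arm `j`. -/
noncomputable def devExp (μ₀ : ℝ) (m H : Fin k → ℝ) (j : Fin k)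
    (A : ℕ → Finset (Fin k)) (x : Fin k → ℕ → ℝ) (t : ℕ) : ℝ :=
  Real.exp (expStat A x j (m j) (devRate μ₀ m H j) t)

/-- A supermartingale that dominates `δ / (102 k)` times the sum, over the arms other than `i`, of
the square roots of the largest values of `devExp`. The weight is `δ / (51 k)`, because
`sqrtTangent` dominates half of the square root of the maximum. -/
noncomputable def deviationSum (δ μ₀ : ℝ) (m H : Fin k → ℝ) (i : Fin k)
    (A : ℕ → Finset (Fin k)) (x : Fin k → ℕ → ℝ) (t : ℕ) : ℝ≥0∞ :=
  ∑ j ∈ Finset.univ.erase i, ENNReal.ofReal (δ / (51 * k)) *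
    ENNReal.ofReal (sqrtTangent (runMax (devExp μ₀ m H j A x) t) (devExp μ₀ m H j A x t))

variable {A : ℕ → Finset (Fin k)} {x : Fin k → ℕ → ℝ} {φ : ℕ → ℝ → ℝ} {δ κ μ₀ a : ℝ}
  {w lam : ℕ → ℝ} {m H : Fin k → ℝ} {i j : Fin k} {t T : ℕ}

theorem devExp_pos (t : ℕ) : 0 < devExp μ₀ m H j A x t := Real.exp_pos _

theorem devExp_zero : devExp μ₀ m H j A x 0 = 1 := by
  rw [devExp, expStat_zero, Real.exp_zero]

theorem targetMixture_zero_le (hw : ∑' l, ENNReal.ofReal (w l) = 1) :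
    targetMixture κ w lam a i A x 0 ≤ ENNReal.ofReal (1 / κ) := by
  simp [targetMixture, expStat_zero, hw]

theorem targetMixture_succ_of_notMem (h : i ∉ A t) :
    targetMixture κ w lam a i A x (t + 1) = targetMixture κ w lam a i A x t := by
  simp only [targetMixture, expStat_succ_of_notMem x _ _ h]

theorem deviationSum_zero_le (hδ : 0 < δ) : deviationSum δ μ₀ m H i A x 0 ≤
    ENNReal.ofReal (δ / 51) := by
  have hk : (0 : ℝ) < k := by exact_mod_cast Fin.pos i
  have h1 : sqrtTangent 1 1 = 1 := by norm_num [sqrtTangent]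
  calc deviationSum δ μ₀ m H i A x 0
      = ∑ j ∈ Finset.univ.erase i, ENNReal.ofReal (δ / (51 * k)) := by
        unfold deviationSum
        refine Finset.sum_congr rfl fun j _ => ?_
        rw [devExp_zero, show runMax (devExp μ₀ m H j A x) 0 = 1 from rfl, h1, ENNReal.ofReal_one,
          mul_one]
    _ ≤ ∑ _j : Fin k, ENNReal.ofReal (δ / (51 * k)) :=
        Finset.sum_le_sum_of_subset (Finset.subset_univ _)
    _ = ENNReal.ofReal (δ / 51) := by
        rw [← ENNReal.ofReal_sum_of_nonneg fun _ _ => by positivity]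
        congr 1
        rw [Finset.sum_const, Finset.card_univ, Fintype.card_fin, nsmul_eq_mul]
        field_simp

/-- In a round in which arm `i` is sampled, no other arm is. -/
theorem deviationSum_succ_of_mem (hA : IsUCB φ δ μ₀ A x) (h : i ∈ A t) :
    deviationSum δ μ₀ m H i A x (t + 1) = deviationSum δ μ₀ m H i A x t := by
  unfold deviationSum
  refine Finset.sum_congr rfl fun j hj => ?_
  have hji := Finset.ne_of_mem_erase hj
  have hjA : j ∉ A t := by
    by_cases hR : rejSet δ μ₀ A x t = Finset.univ
    · rw [(hA t).1 hR]; exact Finset.notMem_empty j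
    · obtain ⟨l, -, hl, -⟩ := (hA t).2 hR
      rw [hl, Finset.mem_singleton] at h ⊢
      exact fun e => hji (e.trans h.symm)
  have he : devExp μ₀ m H j A x (t + 1) = devExp μ₀ m H j A x t := by
    simp only [devExp, expStat_succ_of_notMem x _ _ hjA]
  have hr : runMax (devExp μ₀ m H j A x) (t + 1) = runMax (devExp μ₀ m H j A x) t := by
    change max _ _ = _
    rw [he]
    exact max_eq_left (le_runMax devExp_zero.le le_rfl)
  rw [he, hr]

theorem le_sum_of_targetMixture_lt (hc : IsCertificate φ δ κ w lam) (hκ : 0 < κ)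
    (hn : 1 ≤ numSamples A i t) (h : targetMixture κ w lam a i A x t < 1) :
    -((numSamples A i t : ℝ) * φ (numSamples A i t) δ) ≤
      ∑ s ∈ (Finset.range t).filter (fun s => i ∈ A s), (x i s - a) := by
  by_contra! hS
  refine absurd h (not_lt.2 ?_)
  calc (1 : ℝ≥0∞) = ENNReal.ofReal (1 / κ) * ENNReal.ofReal κ := by
        rw [← ENNReal.ofReal_mul (by positivity), one_div_mul_cancel hκ.ne', ENNReal.ofReal_one]
    _ ≤ _ := mul_le_mul_right ((hc.le_tsum _ hn).trans (ENNReal.tsum_le_tsum fun l => ?_)) _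
  rw [ENNReal.ofReal_mul (hc.weight_nonneg l)]
  refine mul_le_mul_right (ENNReal.ofReal_le_ofReal (Real.exp_le_exp.2 ?_)) _
  rw [expStat_eq]
  have := mul_le_mul_of_nonneg_left hS.le (hc.rate_nonneg l)
  linarith

theorem sum_sqrt_runMax_lt (hδ : 0 < δ) (h : deviationSum δ μ₀ m H i A x T < 1) :
    ∑ j ∈ Finset.univ.erase i, √(runMax (devExp μ₀ m H j A x) T) < 102 * k / δ := by
  have hk : (0 : ℝ) < k := by exact_mod_cast Fin.pos i
  have h1 : ENNReal.ofReal (∑ j ∈ Finset.univ.erase i,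
      δ / (51 * k) * (√(runMax (devExp μ₀ m H j A x) T) / 2)) < 1 := by
    refine lt_of_le_of_lt ?_ h
    rw [ENNReal.ofReal_sum_of_nonneg fun _ _ => by positivity]
    refine Finset.sum_le_sum fun j _ => ?_
    rw [ENNReal.ofReal_mul (by positivity)]
    refine mul_le_mul_right (ENNReal.ofReal_le_ofReal ?_) _
    have := (devExp_pos (μ₀ := μ₀) (m := m) (H := H) (j := j) (A := A) (x := x) T).le
    exact le_add_of_nonneg_right (by positivity)
  rw [ENNReal.ofReal_lt_one, ← Finset.mul_sum, ← Finset.sum_div] at h1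
  rw [lt_div_iff₀ hδ]
  have h2 := mul_lt_mul_of_pos_left h1 (show (0 : ℝ) < 102 * k by positivity)
  calc _ = 102 * k * (δ / (51 * k) *
        ((∑ j ∈ Finset.univ.erase i, √(runMax (devExp μ₀ m H j A x) T)) / 2)) := by
        field_simp; ring
    _ < _ := by linarith

/-- If neither process reaches `1`, then arm `i` is rejected at any time that exceeds either of the
two complexities. -/
theorem mem_rejSet_of_lt (hA : IsUCB φ δ μ₀ A x) (hφ : IsBoundary φ δ) (h0 : 0 < δ) (h1 : δ < 1)
    (hH : ∀ j, Real.exp (Real.exp 1) ≤ H j) {G : ℝ} (hG : ∀ j, H j ≤ G) (hi : μ₀ < m i)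
    (hnull : ∀ j, m j ≤ μ₀ → 1 / √(H j) ≤ m i - m j)
    (hnonnull : ∀ j, μ₀ < m j → 1 / √(H j) ≤ m j - μ₀)
    (hc : IsCertificate φ δ κ w lam) (hκ : 0 < κ)
    (hM : ∀ t, targetMixture κ w lam (m i) i A x t < 1)
    (hN : deviationSum δ μ₀ m H i A x T < 1)
    (hT : 300 * min (∑ j, (H j * Real.log (Real.log (H j)) + H j * Real.log (k / δ)))
      (k * G * Real.log (Real.log G / δ)) < T) :
    i ∈ rejSet δ μ₀ A x T := by
  by_contra hiR
  have hk : (0 : ℝ) < k := by exact_mod_cast Fin.pos i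
  set r : Fin k → ℝ := fun j => runMax (devExp μ₀ m H j A x) T with hr
  have hr1 : ∀ j, 1 ≤ r j := fun j => one_le_runMax _ T
  have hsum := sum_sqrt_runMax_lt h0 hN
  set z : Fin k → ℝ := fun j => if j = i then 0 else Real.log (r j) with hz
  have hlog : ∀ j, Real.log (r j) = 2 * Real.log (√(r j)) := fun j => by
    rw [Real.log_sqrt (zero_le_one.trans (hr1 j))]; ring
  have hdev : ∀ j, ∀ t ≤ T, expStat A x j (m j) (devRate μ₀ m H j) t ≤ Real.log (r j) := by
    intro j t ht
    rw [Real.le_log_iff_exp_le (one_pos.trans_le (hr1 j))]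
    exact le_runMax (m := devExp μ₀ m H j A x) devExp_zero.le ht
  have hgood : IsGoodPath A x φ δ μ₀ m H z i T :=
    { ucb := hA
      boundary := hφ
      pos := h0
      lt_one := h1
      le_H := hH
      null_gap := hnull
      nonnull_gap := hnonnull
      z_nonneg := fun j => by
        simp only [hz]; split_ifs
        · exact le_rfl
        · exact Real.log_nonneg (hr1 j)
      target_ucb := fun t ht => le_sum_of_targetMixture_lt hc hκ ht (hM t)
      null_dev := fun j hj t ht => by
        have hji : j ≠ i := fun e => absurd (e ▸ hj) (not_le.2 hi)
        have := hdev j t ht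
        simpa only [hz, if_neg hji, devRate, if_neg (not_lt.2 hj)] using this
      nonnull_dev := fun j hji hj t ht => by
        have := hdev j t ht
        simpa only [hz, if_neg hji, devRate, if_pos hj] using this }
  have hzk : ∀ j, z j ≤ 2 * Real.log (102 * k / δ) := by
    intro j
    simp only [hz]; split_ifs with hj
    · have : (1 : ℝ) ≤ 102 * k / δ := by
        have hk1 : (1 : ℝ) ≤ k := by exact_mod_cast Fin.pos i
        rw [one_le_div h0]; linarith
      have := Real.log_nonneg this
      positivity
    · rw [hlog]
      have hpos : 0 < √(r j) := Real.sqrt_pos.2 (one_pos.trans_le (hr1 j))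
      have h2 : √(r j) ≤ ∑ j ∈ Finset.univ.erase i, √(r j) :=
        Finset.single_le_sum (f := fun j => √(r j)) (fun _ _ => Real.sqrt_nonneg _)
          (Finset.mem_erase.2 ⟨hj, Finset.mem_univ j⟩)
      have := Real.log_le_log hpos (h2.trans hsum.le)
      linarith
  have hzs : ∑ j, z j ≤ 2 * (k * Real.log (102 / δ)) := by
    set c : ℝ := 102 / δ with hcdef
    have hcpos : 0 < c := by positivity
    have hc1 : 1 ≤ Real.log c := by
      rw [Real.le_log_iff_exp_le hcpos, hcdef, le_div_iff₀ h0]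
      have := Real.exp_one_lt_d9
      nlinarith [Real.exp_pos 1]
    -- concavity of the logarithm: the bound on the sum of the `√(r j)` is worst when all are `c`
    have hterm : ∀ j, Real.log (√(r j)) ≤ √(r j) / c + (Real.log c - 1) := by
      intro j
      have hpos : 0 < √(r j) := Real.sqrt_pos.2 (one_pos.trans_le (hr1 j))
      have h2 := Real.log_le_sub_one_of_pos (div_pos hpos hcpos)
      rw [Real.log_div hpos.ne' hcpos.ne'] at h2
      linarith
    have hcard : ((Finset.univ.erase i).card : ℝ) ≤ k := by
      have := Finset.card_le_card (Finset.erase_subset i Finset.univ)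
      rw [Finset.card_univ, Fintype.card_fin] at this
      exact_mod_cast this
    calc ∑ j, z j = ∑ j ∈ Finset.univ.erase i, 2 * Real.log (√(r j)) := by
          rw [← Finset.add_sum_erase _ _ (Finset.mem_univ i)]
          have : z i = 0 := if_pos rfl
          rw [this, zero_add]
          refine Finset.sum_congr rfl fun j hj => ?_
          rw [← hlog]
          exact if_neg (Finset.ne_of_mem_erase hj)
      _ ≤ ∑ j ∈ Finset.univ.erase i, 2 * (√(r j) / c + (Real.log c - 1)) :=
          Finset.sum_le_sum fun j _ => by linarith [hterm j]
      _ = 2 * ((∑ j ∈ Finset.univ.erase i, √(r j)) / c +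
            ((Finset.univ.erase i).card : ℝ) * (Real.log c - 1)) := by
          rw [← Finset.mul_sum, Finset.sum_add_distrib, ← Finset.sum_div, Finset.sum_const,
            nsmul_eq_mul]
      _ ≤ 2 * (k + k * (Real.log c - 1)) := by
          have h2 : (∑ j ∈ Finset.univ.erase i, √(r j)) / c ≤ k := by
            rw [div_le_iff₀ hcpos, hcdef]
            exact hsum.le.trans (le_of_eq (by ring))
          have h3 := mul_le_mul_of_nonneg_right hcard (sub_nonneg.2 hc1)
          linarith
      _ = _ := by ring
  have b1 := hgood.le_boundSum hiR hzk
  have b2 := hgood.le_boundMin hiR hG hzs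
  rcases min_choice (∑ j, (H j * Real.log (Real.log (H j)) + H j * Real.log (k / δ)))
    (k * G * Real.log (Real.log G / δ)) with h | h <;> rw [h] at hT <;> linarith

end Path

section Probability

variable {Ω : Type*} [MeasurableSpace Ω] {P : Measure Ω} {k : ℕ}
  {ν : Fin k → Measure ℝ} {U : Ω → ℝ} {X : Fin k → ℕ → Ω → ℝ} {A : ℕ → Ω → Finset (Fin k)}
  {hU : Measurable U} {hX : ∀ i s, Measurable (X i s)} {hA : ∀ s, Measurable (A s)}
  {φ : ℕ → ℝ → ℝ} {δ κ μ₀ : ℝ} {w lam : ℕ → ℝ} {H : Fin k → ℝ}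

theorem isESuper_targetMixture (h : IsBanditModel P ν U X A hU hX hA)
    (hν : ∀ i, IsProbabilityMeasure (ν i))
    (hsub : ∀ i, HasSubgaussianMGF (fun y => y - mean (ν i)) 1 (ν i)) (i : Fin k) :
    IsESuper P (tableFiltration U X hU hX) fun t ω =>
      targetMixture κ w lam (mean (ν i)) i (fun s => A s ω) (fun i s => X i s ω) t := by
  unfold targetMixture
  refine (IsESuper.tsum fun l => (isESuper_exp h i ?_).const_mul _).const_mul _
  have := hν i
  exact lintegral_exp_le_one_of_subgaussian (hsub i) (by simp)

theorem isESuper_deviationSum (h : IsBanditModel P ν U X A hU hX hA)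
    (hν : ∀ i, IsProbabilityMeasure (ν i))
    (hsub : ∀ i, HasSubgaussianMGF (fun y => y - mean (ν i)) 1 (ν i)) (i : Fin k) :
    IsESuper P (tableFiltration U X hU hX) fun t ω =>
      deviationSum δ μ₀ (fun j => mean (ν j)) H i (fun s => A s ω) (fun i s => X i s ω) t := by
  unfold deviationSum
  refine IsESuper.sum _ fun j _ => (isESuper_sqrtTangent (fun t ω => (devExp_pos t).le)
    (fun t => (measurable_expStat h j _ _ t).exp) (isESuper_exp h j ?_)).const_mul _
  have := hν j
  exact lintegral_exp_le_one_of_subgaussian (hsub j) (by simp)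

theorem one_sub_mul_one_sub_eq (h0 : 0 < δ) (h1 : δ < 1) :
    (1 - ENNReal.ofReal (1 / (1 + 1.02 * (1 / δ - 1)))) * (1 - ENNReal.ofReal (δ / 51)) =
      ENNReal.ofReal (1 - δ) := by
  have hinv : 1 ≤ 1 / δ := (one_le_div h0).2 h1.le
  have hκ : 0 < 1 + 1.02 * (1 / δ - 1) := by linarith
  rw [← ENNReal.ofReal_one, ← ENNReal.ofReal_sub _ (by positivity),
    ← ENNReal.ofReal_sub _ (by positivity), ← ENNReal.ofReal_mul]
  · congr 1
    have h2 : δ + 1.02 * (1 - δ) ≠ 0 := by linarith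
    have e : 1 + 1.02 * (1 / δ - 1) = (δ + 1.02 * (1 - δ)) / δ := by field_simp
    rw [e, one_div_div]
    field_simp
    ring
  · rw [sub_nonneg, div_le_one hκ]; linarith

/-- The two failures, of the upper confidence bound of arm `i` and of the deviation bounds of the
other arms, concern different arms. The supermartingales that bound them never move in the same
round, so the probabilities of success multiply: `1 - δ` is reached exactly, which a union bound
cannot give. -/
theorem ofReal_one_sub_le_measure_mem_rejSet [IsProbabilityMeasure P]
    (h : IsBanditModel P ν U X A hU hX hA) (hν : ∀ i, IsProbabilityMeasure (ν i))
    (hsub : ∀ i, HasSubgaussianMGF (fun y => y - mean (ν i)) 1 (ν i))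
    (hUCB : ∀ ω, IsUCB φ δ μ₀ (fun s => A s ω) (fun i s => X i s ω)) (hφ : IsBoundary φ δ)
    (h0 : 0 < δ) (h1 : δ < 1) (hH : ∀ j, Real.exp (Real.exp 1) ≤ H j) {G : ℝ}
    (hG : ∀ j, H j ≤ G) {i : Fin k} (hi : μ₀ < mean (ν i))
    (hnull : ∀ j, mean (ν j) ≤ μ₀ → 1 / √(H j) ≤ mean (ν i) - mean (ν j))
    (hnonnull : ∀ j, μ₀ < mean (ν j) → 1 / √(H j) ≤ mean (ν j) - μ₀) {T : ℕ}
    (hT : 300 * min (∑ j, (H j * Real.log (Real.log (H j)) + H j * Real.log (k / δ)))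
      (k * G * Real.log (Real.log G / δ)) < T) :
    ENNReal.ofReal (1 - δ) ≤
      P {ω | i ∈ rejSet δ μ₀ (fun s => A s ω) (fun i s => X i s ω) T} := by
  obtain ⟨w, lam, hc⟩ := exists_certificate hφ h0 h1
  have hinv : 1 ≤ 1 / δ := (one_le_div h0).2 h1.le
  have hκ : 0 < 1 + 1.02 * (1 / δ - 1) := by linarith
  have hprob := IsESuper.prob_lt_one_and_lt_one
    (isESuper_targetMixture (κ := 1 + 1.02 * (1 / δ - 1)) (w := w) (lam := lam) h hν hsub i)
    (isESuper_deviationSum (δ := δ) (μ₀ := μ₀) (H := H) h hν hsub i)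
    (fun t => {ω | i ∈ A t ω})
    (fun t => measurable_sampled_table h le_rfl (measurableSet_mem_finset i))
    (fun t ω hω => deviationSum_succ_of_mem (hUCB ω) hω)
    (fun t ω hω => targetMixture_succ_of_notMem hω)
    (fun ω => targetMixture_zero_le hc.tsum_weight) (fun ω => deviationSum_zero_le h0)
  rw [one_sub_mul_one_sub_eq h0 h1] at hprob
  refine hprob.trans (measure_mono fun ω hω => ?_)
  exact mem_rejSet_of_lt (m := fun j => mean (ν j)) (hUCB ω) hφ h0 h1 hH hG hi hnull hnonnull hc hκ
    (fun t => (hω t).1) (hω T).2 hT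

theorem le_TPR_of_le_measure [IsProbabilityMeasure P] {H₁ : Finset (Fin k)} (hH₁ : H₁.Nonempty)
    {R : Ω → Finset (Fin k)} (hR : ∀ j, MeasurableSet {ω | j ∈ R ω})
    (h : ∀ j ∈ H₁, ENNReal.ofReal (1 - δ) ≤ P {ω | j ∈ R ω}) : 1 - δ ≤ TPR P H₁ R := by
  classical
  have hpos : (0 : ℝ) < H₁.card := by exact_mod_cast hH₁.card_pos
  have e : ∀ ω, ((H₁ ∩ R ω).card : ℝ) = ∑ j ∈ H₁, {ω | j ∈ R ω}.indicator 1 ω := by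
    intro ω
    rw [← Finset.filter_mem_eq_inter, Finset.card_filter]
    push_cast
    refine Finset.sum_congr rfl fun j _ => ?_
    simp [Set.indicator_apply]
  unfold TPR
  rw [integral_div, le_div_iff₀ hpos]
  simp_rw [e]
  have hint : ∀ j ∈ H₁, Integrable ({ω | j ∈ R ω}.indicator (1 : Ω → ℝ)) P := fun j _ =>
    (integrable_const (1 : ℝ)).indicator (hR j)
  rw [integral_finsetSum _ hint]
  calc (1 - δ) * H₁.card = ∑ j ∈ H₁, (1 - δ) := by
        rw [Finset.sum_const, nsmul_eq_mul, mul_comm]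
    _ ≤ _ := by
        refine Finset.sum_le_sum fun j hj => ?_
        rw [integral_indicator_one (hR j)]
        exact (ENNReal.ofReal_le_iff_le_toReal (measure_ne_top _ _)).1 (h j hj)

end Probability

/-! ### Gaps and complexities -/

section Gaps

variable {k : ℕ} {ν : Fin k → Measure ℝ} {μ₀ δ : ℝ}

theorem exp_exp_one_le_invSq (d : ℝ) : Real.exp (Real.exp 1) ≤ invSq d := le_max_right _ _

theorem one_div_sqrt_invSq_le {d : ℝ} (hd : 0 < d) : 1 / √(invSq d) ≤ d := by
  have h1 : 1 / d ≤ √(invSq d) := by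
    refine Real.le_sqrt_of_sq_le (le_trans (le_of_eq ?_) (le_max_left _ _))
    rw [div_pow, one_pow, one_div]
  rw [div_le_comm₀ (Real.sqrt_pos.2 ((Real.exp_pos _).trans_le (exp_exp_one_le_invSq d))) hd]
  exact h1

theorem invSq_anti {d d' : ℝ} (hd : 0 < d) (h : d ≤ d') : invSq d' ≤ invSq d :=
  max_le_max (inv_anti₀ (by positivity) (by gcongr)) le_rfl

theorem minGap_pos (h : (nonNulls μ₀ ν).Nonempty) : 0 < minGap μ₀ ν h := by
  unfold minGap
  rw [Finset.lt_inf'_iff]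
  exact fun i hi => sub_pos.2 (Finset.mem_filter.1 hi).2

theorem minGap_le_gap (h : (nonNulls μ₀ ν).Nonempty) (j : Fin k) :
    minGap μ₀ ν h ≤ gap μ₀ ν h j := by
  unfold gap
  split_ifs with hj
  · exact Finset.inf'_le (fun i => mean (ν i) - μ₀)
      (Finset.mem_filter.2 ⟨Finset.mem_univ j, hj⟩)
  · obtain ⟨l, hl, hl2⟩ := Finset.exists_mem_eq_inf' h fun j => mean (ν j)
    rw [hl2]
    have := Finset.inf'_le (fun i => mean (ν i) - μ₀) hl
    have h2 : minGap μ₀ ν h ≤ mean (ν l) - μ₀ := this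
    linarith [not_lt.1 hj]

theorem gap_le_of_null (h : (nonNulls μ₀ ν).Nonempty) {i j : Fin k} (hi : μ₀ < mean (ν i))
    (hj : mean (ν j) ≤ μ₀) : gap μ₀ ν h j ≤ mean (ν i) - mean (ν j) := by
  unfold gap
  rw [if_neg (not_lt.2 hj)]
  exact sub_le_sub_right (Finset.inf'_le (fun j => mean (ν j))
    (Finset.mem_filter.2 ⟨Finset.mem_univ i, hi⟩)) _

theorem one_le_mul_log_log {H : ℝ} (hH : Real.exp (Real.exp 1) ≤ H) :
    1 ≤ H * Real.log (Real.log H) :=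
  one_le_mul_of_one_le_of_one_le ((Real.one_le_exp (Real.exp_pos 1).le).trans hH)
    (one_le_log_log hH)

theorem one_le_min_bound (h : (nonNulls μ₀ ν).Nonempty) (h0 : 0 < δ) (h1 : δ < 1) :
    1 ≤ min (boundSum δ μ₀ ν h) (boundMin δ μ₀ ν h) := by
  obtain ⟨i, -⟩ := id h
  have hk : (1 : ℝ) ≤ k := by exact_mod_cast Fin.pos i
  refine le_min ?_ ?_
  · have hlog : 0 ≤ Real.log (k / δ) := Real.log_nonneg (by rw [one_le_div h0]; linarith)
    have hterm : ∀ j, 1 ≤ invSq (gap μ₀ ν h j) * Real.log (Real.log (invSq (gap μ₀ ν h j)))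
        + invSq (gap μ₀ ν h j) * Real.log (k / δ) := fun j =>
      (one_le_mul_log_log (exp_exp_one_le_invSq _)).trans (le_add_of_nonneg_right
        (mul_nonneg ((Real.exp_pos _).le.trans (exp_exp_one_le_invSq _)) hlog))
    exact (hterm i).trans (Finset.single_le_sum
      (f := fun j => invSq (gap μ₀ ν h j) * Real.log (Real.log (invSq (gap μ₀ ν h j)))
        + invSq (gap μ₀ ν h j) * Real.log (k / δ))
      (fun j _ => zero_le_one.trans (hterm j)) (Finset.mem_univ i))
  · have hG := exp_exp_one_le_invSq (minGap μ₀ ν h)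
    have hlogG := (Real.exp_pos 1).trans_le (exp_one_le_log hG)
    unfold boundMin
    rw [mul_assoc]
    refine one_le_mul_of_one_le_of_one_le hk ((one_le_mul_log_log hG).trans ?_)
    refine mul_le_mul_of_nonneg_left (Real.log_le_log hlogG ?_) ((Real.exp_pos _).le.trans hG)
    rw [le_div_iff₀ h0]
    exact mul_le_of_le_one_right hlogG.le h1.le

end Gaps

end BanditTesting

theorem mainTheorem1 :
    ∃ c : ℝ, 0 < c ∧
      ∀ (k : ℕ) (δ μ₀ : ℝ), 0 < δ → δ < 1 →
      ∀ φ : ℕ → ℝ → ℝ, BanditTesting.IsBoundary φ δ →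
      ∀ ν : Fin k → Measure ℝ, (∀ i, IsProbabilityMeasure (ν i)) →
      (∀ i, HasSubgaussianMGF (fun y => y - BanditTesting.mean (ν i)) 1 (ν i)) →
      ∀ (Ω : Type*) [MeasurableSpace Ω] (P : Measure Ω) [IsProbabilityMeasure P]
        (U : Ω → ℝ) (X : Fin k → ℕ → Ω → ℝ) (A : ℕ → Ω → Finset (Fin k))
        (hU : Measurable U) (hX : ∀ i s, Measurable (X i s)) (hA : ∀ s, Measurable (A s)),
      -- the private randomness is uniform on [0,1], the reward of arm i in each round has law ν i,
      -- and all of these are independent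
      P.map U = volume.restrict (Set.Icc 0 1) →
      (∀ i s, P.map (X i s) = ν i) →
      iIndepFun (fun p : Fin k × ℕ => X p.1 p.2) P →
      IndepFun U (fun ω (p : Fin k × ℕ) => X p.1 p.2 ω) P →
      -- the sampled set is chosen from past information, by the UCB rule
      (∀ t, Measurable[BanditTesting.banditFiltration U A X hU hA hX t] (A t)) →
      (∀ ω, BanditTesting.IsUCB φ δ μ₀ (fun s => A s ω) (fun i s => X i s ω)) →
      -- FDR control at every stopping time
      (∀ τ : Ω → ℕ,
        IsStoppingTime (BanditTesting.banditFiltration U A X hU hA hX)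
          (fun ω => (τ ω : WithTop ℕ)) →
        BanditTesting.FDR P (BanditTesting.nulls μ₀ ν)
          (fun ω => BanditTesting.rejSet δ μ₀ (fun s => A s ω) (fun i s => X i s ω) (τ ω)) ≤ δ) ∧
      -- sample complexity of a true positive rate of at least 1 - δ
      (∀ h : (BanditTesting.nonNulls μ₀ ν).Nonempty,
        ∃ T : ℕ,
          (T : ℝ) ≤ c * min (BanditTesting.boundSum δ μ₀ ν h) (BanditTesting.boundMin δ μ₀ ν h) ∧
          ∀ τ : Ω → ℕ, Measurable τ → (∀ ω, T ≤ τ ω) →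
            1 - δ ≤ BanditTesting.TPR P (BanditTesting.nonNulls μ₀ ν)
              (fun ω => BanditTesting.rejSet δ μ₀ (fun s => A s ω) (fun i s => X i s ω)
                (τ ω))) := by
  -- the argument gives `300` times the bound; the rest, as the bound is at least `1`, is for the
  -- rounding of `T`
  refine ⟨302, by norm_num, ?_⟩
  intro k δ μ₀ h0 h1 φ hφ ν hν hsub Ω _ P _ U X A hU hX hA _ hlaw hind hindU hpred hUCB
  have hmodel : BanditTesting.IsBanditModel P ν U X A hU hX hA := ⟨hlaw, hind, hindU, hpred⟩
  refine ⟨fun τ hτ => BanditTesting.FDR_stopped_le hmodel hν hsub h0 hτ, fun h => ?_⟩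
  set B := min (BanditTesting.boundSum δ μ₀ ν h) (BanditTesting.boundMin δ μ₀ ν h)
  have hB1 : 1 ≤ B := BanditTesting.one_le_min_bound h h0 h1
  have hgap : ∀ j, 0 < BanditTesting.gap μ₀ ν h j := fun j =>
    (BanditTesting.minGap_pos h).trans_le (BanditTesting.minGap_le_gap h j)
  refine ⟨⌊302 * B⌋₊, Nat.floor_le (by positivity), fun τ hτ hT => ?_⟩
  refine BanditTesting.le_TPR_of_le_measure h
    (fun j => BanditTesting.measurableSet_mem_rejSet_stopped hmodel j hτ) fun i hi => ?_
  have hi' : μ₀ < BanditTesting.mean (ν i) := (Finset.mem_filter.1 hi).2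
  refine (BanditTesting.ofReal_one_sub_le_measure_mem_rejSet (T := ⌊302 * B⌋₊)
    (H := fun j => BanditTesting.invSq (BanditTesting.gap μ₀ ν h j))
    (G := BanditTesting.invSq (BanditTesting.minGap μ₀ ν h)) hmodel hν hsub hUCB hφ h0 h1
    (fun j => BanditTesting.exp_exp_one_le_invSq _)
    (fun j => BanditTesting.invSq_anti (BanditTesting.minGap_pos h)
      (BanditTesting.minGap_le_gap h j)) hi' (fun j hj => ?_) (fun j hj => ?_) ?_).trans
    (measure_mono fun ω hω => BanditTesting.rejSet_mono h0 (hUCB ω) (hT ω) hω)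
  · exact (BanditTesting.one_div_sqrt_invSq_le (hgap j)).trans
      (BanditTesting.gap_le_of_null h hi' hj)
  · refine (BanditTesting.one_div_sqrt_invSq_le (hgap j)).trans (le_of_eq ?_)
    exact if_pos hj
  · have := Nat.lt_floor_add_one (302 * B)
    calc _ = 300 * B := rfl
      _ < _ := by linarith
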